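/- Let $d\in\mathbb N$ and let $G,\alpha\colon\mathbb R^d\to\mathbb R$ satisfy * (A1) $G\in W^{1,\infty}_{\mathrm{loc}}(\mathbb R^d)$, $G$ is bounded from below and $\int_{\mathbb R^d}e^{-G(x)}\,\mathrm dx<\infty$; * (A2) $\alpha\in W^{1,\infty}(\mathbb R^d)$. On $\mathbb R^{2d}\ni(x,v)$ let $\mu(\mathrm dx\,\mathrm dv)=Z_\mu^{-1}e^{-H(x,v)}\,\mathrm dx\,\mathrm dv$ with $H(x,v)=\tfrac12\|v\|^2+G(x)$ and $Z_\mu=\int_{\mathbb R^{2d}} e^{-H}\,\mathrm dx\,\mathrm dv$, and let $Y=L^2_\mu(\mathbb R^{2d})$ (real-valued functions). Let $A=\overline{\mathcal L^*}$ be the closure in $Y$ of $$\mathcal L^*\varphi=-v^\top\nabla_x\varphi+(\nabla_xG)^\top\nabla_v\varphi-v^\top\nabla_v\varphi+\Delta_v\varphi,\qquad \varphi\in C_0^\infty(\mathbb R^{2d}),$$ let $A^\dagger$ be its Hilbert space adjoint in $Y$, and let $Y_{-1}=[\mathcal D(A^\dagger)]'$, where $\mathcal D(A^\dagger)$ carries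 the graph norm; $Y$ is mapped into $Y_{-1}$ by $y\mapsto\langle y,\cdot\rangle_Y$. Then: 1. $A$ generates a (unique) $C_0$-semigroup $(e^{At})_{t\ge0}$ on $Y$; it acts on $Y_{-1}$ as the dual of the restriction of $(e^{At})^\dagger$ to $\mathcal D(A^\dagger)$. 2. The operator $N\varphi=(\nabla_x\alpha)^\top\nabla_v\varphi-\varphi\,(\nabla_x\alpha)^\top v$, $\varphi\in C_0^\infty(\mathbb R^{2d})$, has a unique extension to a bounded linear operator $N\colon Y\to Y_{-1}$. 3. For every $T>0$, every $y_0\in Y$ and every scalar control $u\in L^2(0,T)$, the bilinear control system $$\tfrac{\mathrm d}{\mathrm dt}y=Ay+uNy,\qquad y(0)=y_0,$$ has a unique mild solution in $C([0,T];Y)$, that is, there is exactly one $y\in C([0,T];Y)$ such that for all $t\in[0,T]$ $$y(t)=e^{At}y_0+\int_0^te^{A(t-s)}Ny(s)\,u(s)\,\mathrm ds ,$$ where the integral is a Bochner integral in $Y_{-1}$. -/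

import Mathlib

open MeasureTheory Filter Topology
open scoped NNReal ContDiff

noncomputable section

namespace KineticFP

/-! ### Strongly continuous semigroups, generators, extrapolation space -/

section Abstract

variable {H : Type*} [NormedAddCommGroup H] [InnerProductSpace ℝ H]

/-- A strongly continuous semigroup of bounded linear operators on `H`. -/
@[ext]
structure C0Semigroup (H : Type*) [NormedAddCommGroup H] [InnerProductSpace ℝ H] where
  /-- The operator at time `t`. -/
  toFun : ℝ≥0 → H →L[ℝ] H
  map_zero : toFun 0 = ContinuousLinearMap.id ℝ H
  map_add : ∀ s t, toFun (s + t) = (toFun s).comp (toFun t)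
  strongly_continuous : ∀ x, Continuous fun t => toFun t x

/-- The operator with graph `A` is the infinitesimal generator of `S`: a pair `(x, y)` belongs to
the graph iff `(S(t) x - x) / t → y` as `t ↓ 0`. (In particular such an `A` is single-valued.) -/
def IsGenerator (A : Submodule ℝ (H × H)) (S : C0Semigroup H) : Prop :=
  ∀ x y : H, (x, y) ∈ A ↔
    Tendsto (fun t : ℝ => t⁻¹ • (S.toFun t.toNNReal x - x)) (𝓝[>] 0) (𝓝 y)

/-- `D(A†)`, the domain of the Hilbert space adjoint, with the graph norm: it is realised as the
graph of `A†`, a closed subspace of `H × H`, through `z ↦ (z, A† z)`. -/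
def AdjDomain (A : Submodule ℝ (H × H)) : Type _ := A.adjoint

instance (A : Submodule ℝ (H × H)) : NormedAddCommGroup (AdjDomain A) :=
  inferInstanceAs (NormedAddCommGroup A.adjoint)

instance (A : Submodule ℝ (H × H)) : NormedSpace ℝ (AdjDomain A) :=
  inferInstanceAs (NormedSpace ℝ A.adjoint)

/-- The inclusion `z ↦ (z, A† z)` of `D(A†)` into `H × H`. -/
def AdjDomain.incl (A : Submodule ℝ (H × H)) : AdjDomain A →L[ℝ] H × H :=
  A.adjoint.subtypeL

/-- The extrapolation space `H₋₁ = [D(A†)]'`. -/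
abbrev Extrap (A : Submodule ℝ (H × H)) : Type _ := StrongDual ℝ (AdjDomain A)

/-- The embedding of `H` into `H₋₁`, `y ↦ (z ↦ ⟨y, z⟩)`. -/
def toExtrap (A : Submodule ℝ (H × H)) : H →L[ℝ] Extrap A :=
  (ContinuousLinearMap.precomp ℝ
    ((ContinuousLinearMap.fst ℝ H H).comp (AdjDomain.incl A))).comp (innerSL ℝ)

theorem toExtrap_apply (A : Submodule ℝ (H × H)) (y : H) (z : AdjDomain A) :
    toExtrap A y z = inner ℝ y (AdjDomain.incl A z).1 := rfl

/-- A generator commutes with its semigroup. -/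
theorem IsGenerator.map_mem {A : Submodule ℝ (H × H)} {S : C0Semigroup H} (hS : IsGenerator A S)
    (t : ℝ≥0) {p : H × H} (hp : p ∈ A) : (S.toFun t p.1, S.toFun t p.2) ∈ A := by
  rw [hS]
  have h := ((S.toFun t).continuous.tendsto p.2).comp ((hS p.1 p.2).1 hp)
  refine h.congr fun s => ?_
  have hc : S.toFun t (S.toFun s.toNNReal p.1) = S.toFun s.toNNReal (S.toFun t p.1) := by
    rw [← ContinuousLinearMap.comp_apply, ← S.map_add, add_comm, S.map_add,
      ContinuousLinearMap.comp_apply]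
  simp [hc]

variable [CompleteSpace H]

/-- The adjoint semigroup maps the graph of `A†` into itself. -/
theorem IsGenerator.adjoint_map_mem {A : Submodule ℝ (H × H)} {S : C0Semigroup H}
    (hS : IsGenerator A S) (t : ℝ≥0) (p : H × H) (hp : p ∈ A.adjoint) :
    ((S.toFun t).adjoint.prodMap (S.toFun t).adjoint) p ∈ A.adjoint := by
  rw [Submodule.mem_adjoint_iff] at hp ⊢
  intro a b hab
  have := hp _ _ (hS.map_mem t hab)
  simpa [ContinuousLinearMap.adjoint_inner_right] using this

/-- The restriction of the adjoint semigroup `S(t)†` to `D(A†)`. -/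
def IsGenerator.adjSemigroup {A : Submodule ℝ (H × H)} {S : C0Semigroup H}
    (hS : IsGenerator A S) (t : ℝ≥0) : AdjDomain A →L[ℝ] AdjDomain A :=
  ContinuousLinearMap.codRestrict
    (((S.toFun t).adjoint.prodMap (S.toFun t).adjoint).comp (AdjDomain.incl A))
    A.adjoint fun z => hS.adjoint_map_mem t z.1 z.2

/-- The extension of `S(t)` to `H₋₁`, that is, the dual operator of `S(t)†` on `D(A†)`. -/
def IsGenerator.extrapSemigroup {A : Submodule ℝ (H × H)} {S : C0Semigroup H}
    (hS : IsGenerator A S) (t : ℝ≥0) : Extrap A →L[ℝ] Extrap A :=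
  ContinuousLinearMap.precomp ℝ (hS.adjSemigroup t)

/-- `extrapSemigroup` does extend the semigroup. -/
theorem IsGenerator.extrapSemigroup_toExtrap {A : Submodule ℝ (H × H)} {S : C0Semigroup H}
    (hS : IsGenerator A S) (t : ℝ≥0) (y : H) :
    hS.extrapSemigroup t (toExtrap A y) = toExtrap A (S.toFun t y) := by
  ext z
  exact ContinuousLinearMap.adjoint_inner_right (S.toFun t) y (AdjDomain.incl A z).1

/-- `y ∈ C([0,T]; H)` is a mild solution of `y' = A y + u N y`, `y(0) = y₀`, where
`N : H → H₋₁` is bounded: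
`y(t) = S(t) y₀ + ∫₀ᵗ S(t-s) N y(s) u(s) ds` for all `t ∈ [0,T]`, the integral being a
Bochner integral in `H₋₁` and `S` being the semigroup generated by `A`. -/
def IsMildSolution {A : Submodule ℝ (H × H)} {S : C0Semigroup H} (hS : IsGenerator A S)
    (N : H →L[ℝ] Extrap A) {T : ℝ} (hT : 0 ≤ T) (y₀ : H) (u : ℝ → ℝ)
    (y : C(Set.Icc (0 : ℝ) T, H)) : Prop :=
  ∀ t : Set.Icc (0 : ℝ) T,
    IntervalIntegrable
      (fun s => u s • hS.extrapSemigroup (t.1 - s).toNNReal (N (Set.IccExtend hT y s)))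
      volume 0 t.1 ∧
    toExtrap A (y t) = toExtrap A (S.toFun t.1.toNNReal y₀) +
      ∫ s in (0 : ℝ)..t.1,
        u s • hS.extrapSemigroup (t.1 - s).toNNReal (N (Set.IccExtend hT y s))

end Abstract

/-! ### Smooth test functions and weak gradients -/

/-- `φ ∈ C₀^∞`. -/
def IsTestFunction {E : Type*} [NormedAddCommGroup E] [NormedSpace ℝ E] (φ : E → ℝ) : Prop :=
  ContDiff ℝ ∞ φ ∧ HasCompactSupport φ

/-- Position space (and velocity space) `ℝᵈ`. -/
abbrev Rd (d : ℕ) : Type := EuclideanSpace ℝ (Fin d)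

/-- `Df` is the weak (distributional) gradient of `f` on `ℝᵈ`. -/
def IsWeakGradient {d : ℕ} (f : Rd d → ℝ) (Df : Rd d → Rd d) : Prop :=
  LocallyIntegrable f volume ∧ LocallyIntegrable Df volume ∧
    ∀ φ : Rd d → ℝ, IsTestFunction φ → ∀ e : Rd d,
      ∫ x, f x * fderiv ℝ φ x e = -∫ x, inner ℝ (Df x) e * φ x

/-- The confinement potential: `G ∈ W^{1,∞}_loc(ℝᵈ)` with weak gradient `DG`, `G` is bounded from
below, and `e^{-G}` is integrable. -/
structure IsConfinementPotential {d : ℕ} (G : Rd d → ℝ) (DG : Rd d → Rd d) : Prop where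
  weakGradient : IsWeakGradient G DG
  locally_bounded : ∀ K : Set (Rd d), IsCompact K → MemLp G ⊤ (volume.restrict K)
  gradient_locally_bounded : ∀ K : Set (Rd d), IsCompact K → MemLp DG ⊤ (volume.restrict K)
  bounded_below : ∃ c : ℝ, ∀ᵐ x ∂volume, c ≤ G x
  integrable_exp : Integrable (fun x => Real.exp (-G x)) volume

/-- The control potential: `α ∈ W^{1,∞}(ℝᵈ)` with weak gradient `Dα`. -/
structure IsControlPotential {d : ℕ} (α : Rd d → ℝ) (Dα : Rd d → Rd d) : Prop where
  weakGradient : IsWeakGradient α Dα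
  bounded : MemLp α ⊤ volume
  gradient_bounded : MemLp Dα ⊤ volume

/-! ### The kinetic Fokker–Planck operator and the control operator -/

/-- Phase space `ℝᵈ × ℝᵈ` with points `(x, v)`. -/
abbrev Phase (d : ℕ) : Type := Rd d × Rd d

/-- `H(x,v) = |v|²/2 + G(x)`. -/
def hamiltonian {d : ℕ} (G : Rd d → ℝ) (p : Phase d) : ℝ := ‖p.2‖ ^ 2 / 2 + G p.1

/-- The probability measure `μ(dx dv) = Z⁻¹ e^{-H(x,v)} dx dv`, `Z = ∫ e^{-H}`. -/
def invMeasure {d : ℕ} (G : Rd d → ℝ) : Measure (Phase d) :=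
  volume.withDensity fun p => ENNReal.ofReal
    ((∫ q : Phase d, Real.exp (-hamiltonian G q))⁻¹ * Real.exp (-hamiltonian G p))

/-- The state space `Y = L²_μ(ℝ^{2d})`. -/
abbrev StateSpace {d : ℕ} (G : Rd d → ℝ) : Type := Lp ℝ 2 (invMeasure G)

/-- `L* φ = -vᵀ∇ₓφ + (∇G)ᵀ∇ᵥφ - vᵀ∇ᵥφ + Δᵥφ`. -/
def lStarFun {d : ℕ} (DG : Rd d → Rd d) (φ : Phase d → ℝ) (p : Phase d) : ℝ :=
  -fderiv ℝ φ p (p.2, 0) + fderiv ℝ φ p (0, DG p.1) - fderiv ℝ φ p (0, p.2)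
    + Laplacian.laplacian (fun w => φ (p.1, w)) p.2

/-- `N φ = (∇α)ᵀ∇ᵥφ - φ (∇α)ᵀv`. -/
def controlFun {d : ℕ} (Dα : Rd d → Rd d) (φ : Phase d → ℝ) (p : Phase d) : ℝ :=
  fderiv ℝ φ p (0, Dα p.1) - φ p * inner ℝ (Dα p.1) p.2

theorem lStarFun_add {d : ℕ} (DG : Rd d → Rd d) {φ ψ : Phase d → ℝ} (hφ : IsTestFunction φ)
    (hψ : IsTestFunction ψ) : lStarFun DG (φ + ψ) = lStarFun DG φ + lStarFun DG ψ := by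
  funext p
  have h1 : fderiv ℝ (φ + ψ) p = fderiv ℝ φ p + fderiv ℝ ψ p :=
    fderiv_add (hφ.1.differentiable (by simp) p) (hψ.1.differentiable (by simp) p)
  have hc : ∀ χ : Phase d → ℝ, ContDiff ℝ ∞ χ →
      ContDiffAt ℝ 2 (fun w => χ (p.1, w)) p.2 := fun χ h =>
    ((h.comp (contDiff_const.prodMk contDiff_id)).of_le (by norm_cast)).contDiffAt
  have h2 : Laplacian.laplacian (fun w => (φ + ψ) (p.1, w)) p.2
      = Laplacian.laplacian (fun w => φ (p.1, w)) p.2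
        + Laplacian.laplacian (fun w => ψ (p.1, w)) p.2 :=
    ContDiffAt.laplacian_add (hc φ hφ.1) (hc ψ hψ.1)
  rw [lStarFun]
  rw [h1, h2]
  simp only [lStarFun, Pi.add_apply, _root_.add_apply]
  ring

theorem lStarFun_smul {d : ℕ} (DG : Rd d → Rd d) (c : ℝ) {φ : Phase d → ℝ}
    (hφ : IsTestFunction φ) : lStarFun DG (c • φ) = c • lStarFun DG φ := by
  funext p
  have h1 : fderiv ℝ (c • φ) p = c • fderiv ℝ φ p :=
    fderiv_const_smul (hφ.1.differentiable (by simp) p) c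
  have hc : ContDiffAt ℝ 2 (fun w => φ (p.1, w)) p.2 :=
    ((hφ.1.comp (contDiff_const.prodMk contDiff_id)).of_le
      (by norm_cast)).contDiffAt
  have h2 : Laplacian.laplacian (fun w => (c • φ) (p.1, w)) p.2
      = c • Laplacian.laplacian (fun w => φ (p.1, w)) p.2 :=
    InnerProductSpace.laplacian_smul c hc
  rw [lStarFun]
  rw [h1, h2]
  simp only [lStarFun, Pi.smul_apply, _root_.smul_apply, smul_eq_mul]
  ring

/-- The graph `{(φ, L* φ) : φ ∈ C₀^∞(ℝ^{2d})}` in `Y × Y`. -/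
def lStarGraph {d : ℕ} (G : Rd d → ℝ) (DG : Rd d → Rd d) :
    Submodule ℝ (StateSpace G × StateSpace G) where
  carrier := {f | ∃ φ : Phase d → ℝ, IsTestFunction φ ∧
    f.1 =ᵐ[invMeasure G] φ ∧ f.2 =ᵐ[invMeasure G] lStarFun DG φ}
  zero_mem' := by
    refine ⟨0, ⟨contDiff_const, HasCompactSupport.zero⟩, Lp.coeFn_zero .., ?_⟩
    have h : lStarFun DG (0 : Phase d → ℝ) = 0 := by
      have := lStarFun_smul DG 0 (φ := 0) ⟨contDiff_const, HasCompactSupport.zero⟩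
      simpa using this
    rw [h]
    exact Lp.coeFn_zero ..
  add_mem' := by
    rintro f g ⟨φ, hφ, hf1, hf2⟩ ⟨ψ, hψ, hg1, hg2⟩
    refine ⟨φ + ψ, ⟨hφ.1.add hψ.1, hφ.2.add hψ.2⟩,
      (Lp.coeFn_add f.1 g.1).trans (hf1.add hg1), ?_⟩
    rw [lStarFun_add DG hφ hψ]
    exact (Lp.coeFn_add f.2 g.2).trans (hf2.add hg2)
  smul_mem' := by
    rintro c f ⟨φ, hφ, hf1, hf2⟩
    refine ⟨c • φ, ⟨hφ.1.const_smul c, hφ.2.smul_left (f := fun _ => c)⟩,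
      (Lp.coeFn_smul c f.1).trans (hf1.const_smul c), ?_⟩
    rw [lStarFun_smul DG c hφ]
    exact (Lp.coeFn_smul c f.2).trans (hf2.const_smul c)

/-- The operator `A`, the closure of `L*` with domain `C₀^∞(ℝ^{2d})`, given by its graph: the
closure of the graph of `L*` in `Y × Y`. -/
def opA {d : ℕ} (G : Rd d → ℝ) (DG : Rd d → Rd d) :
    Submodule ℝ (StateSpace G × StateSpace G) :=
  (lStarGraph G DG).topologicalClosure

/-- `N : Y → Y₋₁ = [D(A†)]'` is the bounded extension of the differential expression
`φ ↦ (∇α)ᵀ∇ᵥφ - φ (∇α)ᵀv` from `C₀^∞(ℝ^{2d})` to `Y`. -/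
def IsControlOperator {d : ℕ} (G : Rd d → ℝ) (DG Dα : Rd d → Rd d)
    (N : StateSpace G →L[ℝ] Extrap (opA G DG)) : Prop :=
  ∀ φ : Phase d → ℝ, IsTestFunction φ →
    ∀ f g : StateSpace G, f =ᵐ[invMeasure G] φ → g =ᵐ[invMeasure G] controlFun Dα φ →
      N f = toExtrap (opA G DG) g

end KineticFP

end

open scoped ENNReal

set_option linter.unusedSectionVars false

noncomputable section

/-! In `L²_μ` the Hamiltonian transport `∇G·∇ᵥ - v·∇ₓ` is antisymmetric, and `-v·∇ᵥ + Δᵥ` equals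
minus `∇ᵥ` composed with its adjoint. Hence `⟨φ, L*φ⟩ = -‖∇ᵥφ‖²` on test functions, and the formal
adjoint of `L*` is the same expression with the transport reversed. Both operators are treated at
once as `kinOp` with `s = 1` and `s = -1`.

Generation. By Lumer–Phillips it suffices that the range of `l - L*` on test functions is dense for
large `l`. Suppose `f` is orthogonal to it. Then `h = e^{-H/2} f` lies in the unweighted `L²` and
solves weakly the conjugated equation, whose operator `flatOp` has transport, diffusion in `v`, and
the potential `l - d/2 + |v|²/4`. Formally one tests with `χ² h`: the transport terms then act on
the cut-off `χ` only. The unbounded factor in `v·∇ₓχ` is absorbed by `|v|²/4`, and the merely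
locally bounded `∇G` meets only `∇ᵥχ`, so removing the velocity cut-off first and the position
cut-off afterwards gives `h = 0` (`flat_uniqueness`). The formal test is justified by mollification.
The commutator with `v·∇ₓ` vanishes in the limit because the kernels are far more concentrated in
velocity than in position. The commutator with the rough coefficient is paired with `∇ᵥ(χ h)` and
absorbed by the diffusion. Since `G` is only locally Lipschitz, the conjugation itself uses smooth
approximations of `G`.

Control operator. The same density with `s = -1` shows that test functions form a core of `A†`. The
formal adjoint `-∇α·∇ᵥ` of `N` satisfies `‖∇α·∇ᵥφ‖² ≤ C² ‖∇ᵥφ‖² = -C² ⟨φ, A†φ⟩`. It therefore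
extends to a bounded `M : D(A†) → Y`, and `N` is the dual of `M`.

Mild solutions. Integrated along the adjoint semigroup, the same bound gives `∫ ‖M S(r)† z‖² dr ≤
C²/2 ‖z‖²`, that is, `N` is `L²`-admissible. By duality the convolution integral, a priori in `Y₋₁`,
is a continuous function with values in `Y`, of squared norm at most `C²/2 ∫ |u|² ‖y‖²`. The mild
equation becomes a Volterra equation, which is a contraction in an exponentially weighted sup norm
(`existsUnique_volterra`). -/

namespace KineticFP

/-! ### Contraction semigroups: the Lumer–Phillips theorem by Yosida approximation -/

section Generation

variable {H : Type*} [NormedAddCommGroup H] [InnerProductSpace ℝ H]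

/-- A densely defined dissipative relation whose resolvent set contains a half-line. -/
structure IsMaximalDissipative (A : Submodule ℝ (H × H)) : Prop where
  dissipative : ∀ p ∈ A, inner ℝ p.1 p.2 ≤ 0
  dense_domain : Dense (Prod.fst '' (A : Set (H × H)))
  range_eq : ∃ l₀ : ℝ, ∀ l ≥ l₀, ∀ y : H, ∃ p ∈ A, l • p.1 - p.2 = y

/-- The basic resolvent estimate for dissipative relations. -/
theorem mul_norm_le_of_dissipative {x y : H} (h : inner ℝ x y ≤ 0) (l : ℝ) :
    l * ‖x‖ ≤ ‖l • x - y‖ := by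
  rcases eq_or_ne x 0 with rfl | hx
  · simp
  have hx' : 0 < ‖x‖ := norm_pos_iff.2 hx
  have h1 : l * ‖x‖ * ‖x‖ ≤ ‖x‖ * ‖l • x - y‖ := by
    calc l * ‖x‖ * ‖x‖ ≤ inner ℝ x (l • x - y) := by
          rw [inner_sub_right, inner_smul_right, real_inner_self_eq_norm_mul_norm]
          nlinarith
      _ ≤ ‖x‖ * ‖l • x - y‖ := real_inner_le_norm _ _
  nlinarith

/-- Dissipativity makes `(x, y) ↦ l • x - y` injective on `A` for `l > 0`, so arbitrarily chosen
preimages depend linearly on the right-hand side; the norm bound is the resolvent estimate. -/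
theorem IsMaximalDissipative.exists_resolvent {A : Submodule ℝ (H × H)}
    (hA : IsMaximalDissipative A) :
    ∃ (l₀ : ℝ) (R : ℝ → H →L[ℝ] H), 0 < l₀ ∧ ∀ l ≥ l₀,
      (∀ y, (R l y, l • R l y - y) ∈ A) ∧ ∀ y, l * ‖R l y‖ ≤ ‖y‖ := by
  obtain ⟨l₀, hl₀⟩ := hA.range_eq
  choose! p hpA hp using hl₀
  -- The half-line in `range_eq` may reach nonpositive values, where the estimate says nothing.
  set l₁ := max l₀ 1
  have hpos : ∀ l ≥ l₁, 0 < l := fun l hl => lt_of_lt_of_le one_pos ((le_max_right _ _).trans hl)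
  have hle : ∀ l ≥ l₁, l₀ ≤ l := fun l hl => (le_max_left _ _).trans hl
  have huniq : ∀ l ≥ l₁, ∀ q ∈ A, q.1 = (p l (l • q.1 - q.2)).1 := by
    intro l hl q hq
    have hsub := A.sub_mem hq (hpA l (hle l hl) (l • q.1 - q.2))
    have h1 := mul_norm_le_of_dissipative (hA.dissipative _ hsub) l
    have h2 : l • (q - p l (l • q.1 - q.2)).1 - (q - p l (l • q.1 - q.2)).2 = 0 := by
      have := hp l (hle l hl) (l • q.1 - q.2)
      simp only [Prod.fst_sub, Prod.snd_sub, smul_sub]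
      rw [sub_sub_sub_comm, this, sub_self]
    rw [h2, norm_zero] at h1
    have h3 : ‖(q - p l (l • q.1 - q.2)).1‖ ≤ 0 := by
      have := hpos l hl
      by_contra hcon
      push Not at hcon
      nlinarith
    simpa [sub_eq_zero] using h3
  have hbound : ∀ l ≥ l₁, ∀ y, ‖(p l y).1‖ ≤ l⁻¹ * ‖y‖ := by
    intro l hl y
    have h1 := mul_norm_le_of_dissipative (hA.dissipative _ (hpA l (hle l hl) y)) l
    rw [hp l (hle l hl) y] at h1
    rw [inv_mul_eq_div, le_div_iff₀ (hpos l hl)]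
    linarith
  have key : ∀ l ≥ l₁, ∃ R : H →L[ℝ] H, ∀ y, R y = (p l y).1 := by
    intro l hl
    refine ⟨LinearMap.mkContinuous
      { toFun := fun y => (p l y).1
        map_add' := fun y z => ?_
        map_smul' := fun c y => ?_ } l⁻¹ (hbound l hl), fun y => rfl⟩
    · have h := huniq l hl _ (A.add_mem (hpA l (hle l hl) y) (hpA l (hle l hl) z))
      have h2 : l • (p l y + p l z).1 - (p l y + p l z).2 = y + z := by
        conv_rhs => rw [← hp l (hle l hl) y, ← hp l (hle l hl) z]
        simp only [Prod.fst_add, Prod.snd_add, smul_add]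
        abel
      rw [h2] at h
      exact h.symm
    · have h := huniq l hl _ (A.smul_mem c (hpA l (hle l hl) y))
      have h2 : l • (c • p l y).1 - (c • p l y).2 = c • y := by
        conv_rhs => rw [← hp l (hle l hl) y]
        simp only [Prod.smul_fst, Prod.smul_snd, smul_sub, smul_comm l c]
      rw [h2] at h
      exact h.symm
  choose! R hR using key
  refine ⟨l₁, R, hpos _ le_rfl, fun l hl => ⟨fun y => ?_, fun y => ?_⟩⟩
  · have h1 : l • R l y - y = (p l y).2 := by
      rw [hR l hl]
      conv_lhs => rw [← hp l (hle l hl) y]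
      have := hp l (hle l hl) y
      rw [this]; rw [sub_eq_iff_eq_add, add_comm, ← sub_eq_iff_eq_add]; exact this
    rw [h1, hR l hl]
    exact hpA l (hle l hl) y
  · rw [hR l hl]
    have := hbound l hl y
    rwa [inv_mul_eq_div, le_div_iff₀ (hpos l hl), mul_comm] at this

theorem exp_smul_apply_comm (B : H →L[ℝ] H) (x : H) (t : ℝ) :
    NormedSpace.exp (t • B) (B x) = B (NormedSpace.exp (t • B) x) := by
  have h : Commute (NormedSpace.exp (t • B)) B :=
    (((Commute.refl B).smul_left t)).exp_left
  exact congrArg (fun T : H →L[ℝ] H => T x) h.eq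

theorem C0Semigroup.continuous_real (S : C0Semigroup H) (x : H) :
    Continuous fun t : ℝ => S.toFun t.toNNReal x :=
  (S.strongly_continuous x).comp continuous_real_toNNReal

variable [CompleteSpace H]

theorem exp_add_of_commute_clm {B C : H →L[ℝ] H} (h : Commute B C) :
    NormedSpace.exp (B + C) = NormedSpace.exp B * NormedSpace.exp C := by
  let _ := NormedAlgebra.restrictScalars ℚ ℝ (H →L[ℝ] H)
  exact NormedSpace.exp_add_of_commute h

theorem hasDerivAt_exp_smul_apply (B : H →L[ℝ] H) (x : H) (t : ℝ) :
    HasDerivAt (fun s : ℝ => NormedSpace.exp (s • B) x) (NormedSpace.exp (t • B) (B x)) t := by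
  have h := hasDerivAt_exp_smul_const (𝕂 := ℝ) B t
  exact ((ContinuousLinearMap.apply ℝ H x).hasFDerivAt.comp_hasDerivAt t h)

/-- The derivative of `‖e^{sB} x‖²` is `2⟨e^{sB} x, B e^{sB} x⟩ ≤ 0`, because `B` commutes with its
exponential. -/
theorem norm_exp_smul_apply_le {B : H →L[ℝ] H} (hB : ∀ x, inner ℝ x (B x) ≤ 0) {t : ℝ}
    (ht : 0 ≤ t) (x : H) : ‖NormedSpace.exp (t • B) x‖ ≤ ‖x‖ := by
  have hd : ∀ s : ℝ, HasDerivAt (fun s : ℝ => ‖NormedSpace.exp (s • B) x‖ ^ 2)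
      (2 * inner ℝ (NormedSpace.exp (s • B) x) (NormedSpace.exp (s • B) (B x))) s := fun s =>
    (hasDerivAt_exp_smul_apply B x s).norm_sq
  have hanti : Antitone fun s : ℝ => ‖NormedSpace.exp (s • B) x‖ ^ 2 := by
    refine antitone_of_deriv_nonpos (fun s => (hd s).differentiableAt) fun s => ?_
    rw [(hd s).deriv, exp_smul_apply_comm]
    linarith [hB (NormedSpace.exp (s • B) x)]
  have := hanti ht
  simp only [zero_smul, NormedSpace.exp_zero, one_apply_eq_self] at this
  exact (sq_le_sq₀ (norm_nonneg _) (norm_nonneg _)).1 this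

/-- The path `s ↦ e^{sB} e^{(t-s)C} x` joins `e^{tC} x` to `e^{tB} x`. By commutation it equals
`e^{s(B-C)} e^{tC} x`, and its velocity is two contractions applied to `(B - C) x`. -/
theorem norm_exp_smul_sub_le {B C : H →L[ℝ] H} (hB : ∀ x, inner ℝ x (B x) ≤ 0)
    (hC : ∀ x, inner ℝ x (C x) ≤ 0) (hBC : Commute B C) {t : ℝ} (ht : 0 ≤ t) (x : H) :
    ‖NormedSpace.exp (t • B) x - NormedSpace.exp (t • C) x‖ ≤ t * ‖B x - C x‖ := by
  have hfac : ∀ s : ℝ, NormedSpace.exp (s • (B - C)) * NormedSpace.exp (t • C)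
      = NormedSpace.exp (s • B) * NormedSpace.exp ((t - s) • C) := by
    intro s
    have h1 : Commute (s • (B - C)) (t • C) :=
      ((hBC.sub_left (Commute.refl C)).smul_left s).smul_right t
    have h2 : Commute (s • B) ((t - s) • C) := (hBC.smul_left s).smul_right _
    rw [← exp_add_of_commute_clm h1, ← exp_add_of_commute_clm h2]
    congr 1
    module
  have hd : ∀ s : ℝ, HasDerivAt
      (fun s : ℝ => NormedSpace.exp (s • (B - C)) (NormedSpace.exp (t • C) x))
      (NormedSpace.exp (s • (B - C)) ((B - C) (NormedSpace.exp (t • C) x))) s := fun s =>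
    hasDerivAt_exp_smul_apply _ _ s
  have hcomm : (B - C) (NormedSpace.exp (t • C) x) = NormedSpace.exp (t • C) ((B - C) x) := by
    have h : Commute (B - C) (NormedSpace.exp (t • C)) :=
      ((hBC.sub_left (Commute.refl C)).smul_right t).exp_right
    exact congrArg (fun T : H →L[ℝ] H => T x) h.eq
  have happ : ∀ s y, NormedSpace.exp (s • (B - C)) (NormedSpace.exp (t • C) y)
      = NormedSpace.exp (s • B) (NormedSpace.exp ((t - s) • C) y) := fun s y =>
    congrArg (fun T : H →L[ℝ] H => T y) (hfac s)
  have hbd : ∀ s ∈ Set.Ico (0 : ℝ) t,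
      ‖NormedSpace.exp (s • (B - C)) ((B - C) (NormedSpace.exp (t • C) x))‖ ≤ ‖B x - C x‖ := by
    intro s hs
    rw [hcomm, happ]
    exact (norm_exp_smul_apply_le hB hs.1 _).trans
      (norm_exp_smul_apply_le hC (by linarith [hs.2]) _)
  have h := norm_image_sub_le_of_norm_deriv_le_segment' (fun s _ => (hd s).hasDerivWithinAt) hbd t
    ⟨ht, le_rfl⟩
  rw [happ, happ] at h
  simp only [sub_self, zero_smul, NormedSpace.exp_zero, one_apply_eq_self, sub_zero]
    at h
  rw [mul_comm]
  exact h

/-- On the domain of `A` the exponentials are Cauchy, locally uniformly in time, by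
`norm_exp_smul_sub_le`. Contractivity carries this to all of `H` by density, and the limit inherits
contractivity, the semigroup law and continuity. It only yields that the generator of `S` extends
`A`; equality needs the range condition. -/
theorem exists_semigroup_of_approx (B : ℕ → H →L[ℝ] H) (hB : ∀ n x, inner ℝ x (B n x) ≤ 0)
    (hcomm : ∀ m n, Commute (B m) (B n)) {A : Submodule ℝ (H × H)}
    (hA : Dense (Prod.fst '' (A : Set (H × H))))
    (hlim : ∀ p ∈ A, Tendsto (fun n => B n p.1) atTop (𝓝 p.2)) :
    ∃ S : C0Semigroup H, (∀ t x, ‖S.toFun t x‖ ≤ ‖x‖) ∧ ∀ p ∈ A,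
      Tendsto (fun t : ℝ => t⁻¹ • (S.toFun t.toNNReal p.1 - p.1)) (𝓝[>] 0) (𝓝 p.2) := by
  have hcauchy : ∀ (T : ℝ) (x : H), UniformCauchySeqOn
      (fun n (t : ℝ) => NormedSpace.exp (t • B n) x) atTop (Set.Icc 0 T) := by
    intro T x
    rw [Metric.uniformCauchySeqOn_iff]
    intro ε hε
    obtain ⟨_, ⟨p, hp, rfl⟩, hpx⟩ := hA.exists_dist_lt x (show 0 < ε / 4 by linarith)
    have hc := (hlim p hp).cauchySeq
    rw [Metric.cauchySeq_iff] at hc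
    -- The difference of exponentials grows like `t ≤ |T|`; the extra `1` keeps the tolerance
    -- meaningful at `T = 0`.
    obtain ⟨N, hN⟩ := hc (ε / (4 * (|T| + 1))) (by positivity)
    refine ⟨N, fun m hm n hn t ht => ?_⟩
    have h1 : ‖NormedSpace.exp (t • B m) p.1 - NormedSpace.exp (t • B n) p.1‖ ≤ ε / 4 := by
      refine (norm_exp_smul_sub_le (hB m) (hB n) (hcomm m n) ht.1 _).trans ?_
      have h2 := (hN m hm n hn).le
      rw [dist_eq_norm] at h2
      calc t * ‖B m p.1 - B n p.1‖ ≤ (|T| + 1) * (ε / (4 * (|T| + 1))) := by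
            gcongr
            exact ht.2.trans ((le_abs_self T).trans (by linarith))
        _ = ε / 4 := by field_simp
    have h2 : ∀ k, ‖NormedSpace.exp (t • B k) x - NormedSpace.exp (t • B k) p.1‖ ≤ ‖x - p.1‖ := by
      intro k
      rw [← map_sub]
      exact norm_exp_smul_apply_le (hB k) ht.1 _
    rw [dist_eq_norm] at hpx ⊢
    calc ‖NormedSpace.exp (t • B m) x - NormedSpace.exp (t • B n) x‖
        = ‖(NormedSpace.exp (t • B m) x - NormedSpace.exp (t • B m) p.1)
          + (NormedSpace.exp (t • B m) p.1 - NormedSpace.exp (t • B n) p.1)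
          - (NormedSpace.exp (t • B n) x - NormedSpace.exp (t • B n) p.1)‖ := by
            congr 1; abel
      _ ≤ ‖x - p.1‖ + ε / 4 + ‖x - p.1‖ := by
            refine (norm_sub_le _ _).trans (add_le_add ((norm_add_le _ _).trans ?_) (h2 n))
            exact add_le_add (h2 m) h1
      _ < ε := by linarith
  have hex : ∀ (t : ℝ≥0) (x : H), ∃ y,
      Tendsto (fun n => NormedSpace.exp ((t : ℝ) • B n) x) atTop (𝓝 y) := fun t x =>
    cauchySeq_tendsto_of_complete ((hcauchy t x).cauchySeq ⟨t.2, le_rfl⟩)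
  choose F hF using hex
  have hFu : ∀ (T : ℝ) (x : H), TendstoUniformlyOn
      (fun n (t : ℝ) => NormedSpace.exp (t • B n) x) (fun t => F t.toNNReal x) atTop
        (Set.Icc 0 T) := by
    intro T x
    refine (hcauchy T x).tendstoUniformlyOn_of_tendsto fun t ht => ?_
    have := hF t.toNNReal x
    rwa [Real.coe_toNNReal _ ht.1] at this
  have hFnorm : ∀ t x, ‖F t x‖ ≤ ‖x‖ := fun t x =>
    le_of_tendsto (hF t x).norm (Eventually.of_forall fun n => norm_exp_smul_apply_le (hB n) t.2 x)
  have hcont : ∀ x, ContinuousOn (fun t : ℝ => F t.toNNReal x) (Set.Ici 0) := by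
    intro x t ht
    have h1 : ContinuousOn (fun t : ℝ => F t.toNNReal x) (Set.Icc 0 (t + 1)) := by
      refine (hFu (t + 1) x).continuousOn (Frequently.of_forall fun n => ?_)
      exact (continuous_iff_continuousAt.2 fun s =>
        (hasDerivAt_exp_smul_apply (B n) x s).continuousAt).continuousOn
    refine (h1 t ⟨ht, by linarith⟩).mono_of_mem_nhdsWithin ?_
    have : Set.Icc (0 : ℝ) (t + 1) = Set.Ici 0 ∩ Set.Iic (t + 1) := rfl
    rw [this]
    exact inter_mem_nhdsWithin _ (Iic_mem_nhds (by linarith))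
  let S : C0Semigroup H :=
    { toFun := fun t => LinearMap.mkContinuous
        { toFun := F t
          map_add' := fun x y => tendsto_nhds_unique (hF t (x + y))
            (by simpa using (hF t x).add (hF t y))
          map_smul' := fun c x => tendsto_nhds_unique (hF t (c • x))
            (by simpa using (hF t x).const_smul c) } 1 (by simpa using hFnorm t)
      map_zero := by
        ext x
        have := hF 0 x
        simp only [NNReal.coe_zero, zero_smul, NormedSpace.exp_zero,
          one_apply_eq_self] at this
        exact tendsto_nhds_unique this tendsto_const_nhds
      map_add := fun s t => by
        ext x
        refine tendsto_nhds_unique (hF (s + t) x) ?_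
        have h1 : ∀ n, NormedSpace.exp (((s + t : ℝ≥0) : ℝ) • B n) x
            = NormedSpace.exp ((s : ℝ) • B n) (NormedSpace.exp ((t : ℝ) • B n) x) := by
          intro n
          rw [NNReal.coe_add, add_smul, exp_add_of_commute_clm
            (((Commute.refl (B n)).smul_left _).smul_right _)]
          rfl
        have h2 := hF s (F t x)
        have h3 : Tendsto (fun n => NormedSpace.exp ((s : ℝ) • B n) (F t x)
            - NormedSpace.exp (((s + t : ℝ≥0) : ℝ) • B n) x) atTop (𝓝 0) := by
          rw [tendsto_zero_iff_norm_tendsto_zero]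
          refine squeeze_zero (fun _ => norm_nonneg _) (g := fun n =>
            ‖F t x - NormedSpace.exp ((t : ℝ) • B n) x‖) (fun n => ?_) ?_
          · rw [h1, ← map_sub]
            exact norm_exp_smul_apply_le (hB n) s.2 _
          · have := (hF t x).const_sub (F t x)
            rw [sub_self] at this
            exact (tendsto_zero_iff_norm_tendsto_zero.1 this)
        have h4 := h2.sub h3
        simp only [sub_sub_cancel, sub_zero] at h4
        exact h4
      strongly_continuous := fun x => by
        have := (hcont x).comp_continuous NNReal.continuous_coe (fun t => t.2)
        refine this.congr fun t => ?_
        simp }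
  refine ⟨S, hFnorm, fun p hp => ?_⟩
  rw [Metric.tendsto_nhds]
  intro ε hε
  have hc0 : Tendsto (fun t : ℝ => F t.toNNReal p.2) (𝓝[≥] 0) (𝓝 p.2) := by
    have h := hcont p.2 0 (Set.self_mem_Ici)
    have h0 : F (Real.toNNReal 0) p.2 = p.2 := by
      have := congrArg (fun T : H →L[ℝ] H => T p.2) S.map_zero
      rw [Real.toNNReal_zero]
      exact this
    have h' : Tendsto (fun t : ℝ => F t.toNNReal p.2) (𝓝[≥] 0) (𝓝 (F (Real.toNNReal 0) p.2)) := h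
    rwa [h0] at h'
  rw [Metric.tendsto_nhds] at hc0
  obtain ⟨δ, hδ, hδ'⟩ := (mem_nhdsGE_iff_exists_Icc_subset).1
    (hc0 (ε / 4) (by linarith))
  have hδ0 : (0 : ℝ) < δ := hδ
  filter_upwards [Ioo_mem_nhdsGT hδ0] with t ht
  have h1 := (Metric.tendstoUniformlyOn_iff.1 (hFu δ p.2)) (ε / 4) (by linarith)
  have h2 := (Metric.tendsto_nhds.1 (hlim p hp)) (ε / 4) (by linarith)
  have hlim3 : Tendsto (fun n => ‖NormedSpace.exp (t • B n) p.1 - p.1 - t • p.2‖) atTop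
      (𝓝 ‖F t.toNNReal p.1 - p.1 - t • p.2‖) := by
    have := hF t.toNNReal p.1
    rw [Real.coe_toNNReal _ ht.1.le] at this
    exact ((this.sub_const _).sub_const _).norm
  -- The velocity of `e^{sBₙ} p.1 - s p.2` is split into three errors of size `ε / 4`: `Bₙ p.1`
  -- against `p.2`, the exponential against the limit semigroup at `p.2`, and the limit semigroup
  -- against the identity at `p.2`.
  have h3 : ‖F t.toNNReal p.1 - p.1 - t • p.2‖ ≤ (3 * ε / 4) * t := by
    refine le_of_tendsto hlim3 ?_
    filter_upwards [h1, h2] with n hn1 hn2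
    have hd : ∀ s ∈ Set.Icc (0 : ℝ) t, HasDerivWithinAt
        (fun s : ℝ => NormedSpace.exp (s • B n) p.1 - s • p.2)
        (NormedSpace.exp (s • B n) (B n p.1) - (1 : ℝ) • p.2) (Set.Icc 0 t) s := fun s _ =>
      ((hasDerivAt_exp_smul_apply (B n) p.1 s).sub
        ((hasDerivAt_id s).smul_const p.2)).hasDerivWithinAt
    have hbd : ∀ s ∈ Set.Ico (0 : ℝ) t,
        ‖NormedSpace.exp (s • B n) (B n p.1) - (1 : ℝ) • p.2‖ ≤ 3 * ε / 4 := by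
      intro s hs
      have e1 : ‖NormedSpace.exp (s • B n) (B n p.1) - NormedSpace.exp (s • B n) p.2‖
          ≤ ε / 4 := by
        rw [← map_sub]
        rw [dist_eq_norm] at hn2
        exact (norm_exp_smul_apply_le (hB n) hs.1 _).trans hn2.le
      have e2 := hn1 s ⟨hs.1, by linarith [hs.2, ht.2]⟩
      have e3 : dist (F s.toNNReal p.2) p.2 < ε / 4 := hδ' ⟨hs.1, by linarith [hs.2, ht.2]⟩
      rw [dist_eq_norm] at e2 e3
      calc ‖NormedSpace.exp (s • B n) (B n p.1) - (1 : ℝ) • p.2‖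
          = ‖(NormedSpace.exp (s • B n) (B n p.1) - NormedSpace.exp (s • B n) p.2)
            - (F s.toNNReal p.2 - NormedSpace.exp (s • B n) p.2) + (F s.toNNReal p.2 - p.2)‖ := by
              rw [one_smul]; congr 1; abel
        _ ≤ ε / 4 + ε / 4 + ε / 4 := by
              refine (norm_add_le _ _).trans (add_le_add ((norm_sub_le _ _).trans ?_) e3.le)
              exact add_le_add e1 e2.le
        _ = 3 * ε / 4 := by ring
    have h := norm_image_sub_le_of_norm_deriv_le_segment' hd hbd t ⟨ht.1.le, le_rfl⟩
    simp only [zero_smul, NormedSpace.exp_zero, one_apply_eq_self, sub_zero] at h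
    rwa [sub_right_comm] at h
  have h4 : t⁻¹ • (S.toFun t.toNNReal p.1 - p.1) - p.2
      = t⁻¹ • (F t.toNNReal p.1 - p.1 - t • p.2) := by
    rw [smul_sub _ _ (t • p.2), inv_smul_smul₀ ht.1.ne']
    rfl
  rw [dist_eq_norm, h4, norm_smul, norm_inv, Real.norm_of_nonneg ht.1.le, inv_mul_eq_div,
    div_lt_iff₀ ht.1]
  nlinarith [ht.1]

/-- The orbits of a semigroup starting in the domain of the generator have right derivatives. -/
theorem IsGenerator.hasDerivWithinAt {A : Submodule ℝ (H × H)} {S : C0Semigroup H}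
    (hS : IsGenerator A S) {p : H × H} (hp : p ∈ A) {t : ℝ} (ht : 0 ≤ t) :
    HasDerivWithinAt (fun s : ℝ => S.toFun s.toNNReal p.1) (S.toFun t.toNNReal p.2)
      (Set.Ici t) t := by
  rw [hasDerivWithinAt_iff_tendsto_slope, Set.Ici_sdiff_left]
  have h1 := ((S.toFun t.toNNReal).continuous.tendsto p.2).comp ((hS p.1 p.2).1 hp)
  have h2 : Tendsto (fun s : ℝ => s - t) (𝓝[>] t) (𝓝[>] 0) := by
    refine tendsto_nhdsWithin_iff.2 ⟨?_, ?_⟩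
    · have : Tendsto (fun s : ℝ => s - t) (𝓝 t) (𝓝 (t - t)) :=
        (continuous_id.sub continuous_const).tendsto t
      rw [sub_self] at this
      exact this.mono_left nhdsWithin_le_nhds
    · filter_upwards [self_mem_nhdsWithin] with s hs
      exact sub_pos.2 (Set.mem_Ioi.1 hs)
  refine (h1.comp h2).congr' ?_
  filter_upwards [self_mem_nhdsWithin] with s hs
  have hs' : t < s := hs
  have h3 : s.toNNReal = t.toNNReal + (s - t).toNNReal := by
    rw [← Real.toNNReal_add ht (by linarith)]
    congr 1; ring
  simp only [Function.comp_apply, slope_def_module]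
  rw [h3, S.map_add]
  simp [smul_sub]

/-- Differences of orbits of two semigroups with the same dissipative generator do not grow. -/
theorem IsGenerator.norm_sub_le {A : Submodule ℝ (H × H)} (hA : ∀ p ∈ A, inner ℝ p.1 p.2 ≤ 0)
    {S S' : C0Semigroup H} (hS : IsGenerator A S) (hS' : IsGenerator A S') {p q : H × H}
    (hp : p ∈ A) (hq : q ∈ A) (t : ℝ≥0) :
    ‖S.toFun t p.1 - S'.toFun t q.1‖ ≤ ‖p.1 - q.1‖ := by
  have hd : ∀ s : ℝ, 0 ≤ s → HasDerivWithinAt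
      (fun s : ℝ => S.toFun s.toNNReal p.1 - S'.toFun s.toNNReal q.1)
      (S.toFun s.toNNReal p.2 - S'.toFun s.toNNReal q.2) (Set.Ici s) s := fun s hs =>
    (hS.hasDerivWithinAt hp hs).sub (hS'.hasDerivWithinAt hq hs)
  -- The difference `w` of the orbits has squared norm with right derivative `2⟨w, A w⟩ ≤ 0`. Only
  -- right derivatives are available, hence this form of the comparison principle.
  have h := image_le_of_deriv_right_le_deriv_boundary (a := 0) (b := (t : ℝ))
    (f := fun s : ℝ => ‖S.toFun s.toNNReal p.1 - S'.toFun s.toNNReal q.1‖ ^ 2)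
    (B := fun _ => ‖p.1 - q.1‖ ^ 2) (B' := fun _ => 0)
    (((S.continuous_real _).sub (S'.continuous_real _)).norm.pow 2).continuousOn
    (fun s hs => (hd s hs.1).norm_sq) (by simp [S.map_zero, S'.map_zero])
    continuousOn_const (fun s _ => hasDerivWithinAt_const _ _ _) (fun s hs => by
      have := hA _ (A.sub_mem (hS.map_mem s.toNNReal hp) (hS'.map_mem s.toNNReal hq))
      simp only [Prod.fst_sub, Prod.snd_sub] at this
      linarith) (x := (t : ℝ)) ⟨t.2, le_rfl⟩
  simp only [Real.toNNReal_coe] at h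
  exact (sq_le_sq₀ (norm_nonneg _) (norm_nonneg _)).1 h

theorem IsGenerator.eq {A : Submodule ℝ (H × H)} (hA : ∀ p ∈ A, inner ℝ p.1 p.2 ≤ 0)
    (hdense : Dense (Prod.fst '' (A : Set (H × H)))) {S S' : C0Semigroup H}
    (hS : IsGenerator A S) (hS' : IsGenerator A S') : S = S' := by
  ext t x
  refine congrFun (Continuous.ext_on hdense (S.toFun t).continuous (S'.toFun t).continuous ?_) x
  rintro _ ⟨p, hp, rfl⟩
  have := hS.norm_sub_le hA hS' hp hp t
  rw [sub_self, norm_zero] at this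
  exact sub_eq_zero.1 (norm_le_zero_iff.1 this)

/-- Contractivity is not part of `C0Semigroup`; comparison with the zero orbit recovers it from
dissipativity. -/
theorem IsGenerator.norm_apply_le {A : Submodule ℝ (H × H)} (hA : ∀ p ∈ A, inner ℝ p.1 p.2 ≤ 0)
    (hdense : Dense (Prod.fst '' (A : Set (H × H)))) {S : C0Semigroup H}
    (hS : IsGenerator A S) (t : ℝ≥0) (x : H) : ‖S.toFun t x‖ ≤ ‖x‖ := by
  have hcl : IsClosed {x | ‖S.toFun t x‖ ≤ ‖x‖} :=
    isClosed_le (S.toFun t).continuous.norm continuous_norm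
  refine hcl.closure_subset_iff.2 ?_ (hdense x)
  rintro _ ⟨p, hp, rfl⟩
  simpa using hS.norm_sub_le hA hS hp A.zero_mem t

/-- The Lumer–Phillips theorem on a Hilbert space. -/
theorem IsMaximalDissipative.existsUnique_semigroup {A : Submodule ℝ (H × H)}
    (hA : IsMaximalDissipative A) : ∃! S : C0Semigroup H, IsGenerator A S := by
  obtain ⟨l₀, R, hl₀, hR⟩ := hA.exists_resolvent
  -- `R l` is also a left inverse of `l - A`, again by injectivity from dissipativity.
  have hRA : ∀ l ≥ l₀, ∀ p ∈ A, R l (l • p.1 - p.2) = p.1 := by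
    intro l hl p hp
    have h1 := A.sub_mem ((hR l hl).1 (l • p.1 - p.2)) hp
    have h2 := mul_norm_le_of_dissipative (hA.dissipative _ h1) l
    have h3 : l • ((R l (l • p.1 - p.2), l • R l (l • p.1 - p.2) - (l • p.1 - p.2)) - p).1
        - ((R l (l • p.1 - p.2), l • R l (l • p.1 - p.2) - (l • p.1 - p.2)) - p).2 = 0 := by
      simp only [Prod.fst_sub, Prod.snd_sub, smul_sub]
      abel
    rw [h3, norm_zero] at h2
    have h4 : ‖R l (l • p.1 - p.2) - p.1‖ ≤ 0 := by
      have : 0 < l := lt_of_lt_of_le hl₀ hl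
      by_contra hcon
      push Not at hcon
      have h5 : l * ‖R l (l • p.1 - p.2) - p.1‖ ≤ 0 := h2
      nlinarith
    exact sub_eq_zero.1 (norm_le_zero_iff.1 h4)
  -- The resolvent identity; exchanging `l` and `m` in it shows that resolvents commute.
  have hRsub : ∀ l ≥ l₀, ∀ m ≥ l₀, ∀ y, R l y - R m y = (m - l) • R l (R m y) := by
    intro l hl m hm y
    have h1 := hRA l hl _ ((hR m hm).1 y)
    have h2 : l • R m y - (m • R m y - y) = y - (m - l) • R m y := by module
    simp only [h2] at h1
    rw [map_sub, map_smul] at h1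
    rw [sub_eq_iff_eq_add, ← sub_eq_iff_eq_add', h1]
  have hRcomm : ∀ l ≥ l₀, ∀ m ≥ l₀, Commute (R l) (R m) := by
    intro l hl m hm
    rcases eq_or_ne l m with rfl | hlm
    · exact Commute.refl _
    ext y
    have h1 := hRsub l hl m hm y
    have h2 := hRsub m hm l hl y
    have h3 : (m - l) • (R l (R m y) - R m (R l y)) = 0 := by
      rw [smul_sub, ← h1, ← neg_sub l m, neg_smul, ← h2]; abel
    exact sub_eq_zero.1 ((smul_eq_zero.1 h3).resolve_left (sub_ne_zero.2 hlm.symm))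
  let l : ℕ → ℝ := fun n => l₀ + n
  have hl : ∀ n, l n ≥ l₀ := fun n => by simp [l]
  have hlpos : ∀ n, 0 < l n := fun n => lt_of_lt_of_le hl₀ (hl n)
  have hltop : Tendsto l atTop atTop :=
    tendsto_atTop_add_const_left _ _ tendsto_natCast_atTop_atTop
  -- The Yosida approximations `l² R(l) - l = l A R(l)`. They are dissipative since `‖l R(l)‖ ≤ 1`,
  -- and on the domain they converge to `A`, since there `B p.1 = l R(l) p.2`.
  let B : ℕ → H →L[ℝ] H := fun n => (l n) ^ 2 • R (l n) - (l n) • (1 : H →L[ℝ] H)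
  have hBapp : ∀ n x, B n x = l n • (l n • R (l n) x - x) := by
    intro n x
    simp only [B, sub_apply, smul_apply,
      one_apply_eq_self]
    module
  have hBdiss : ∀ n x, inner ℝ x (B n x) ≤ 0 := by
    intro n x
    rw [hBapp, inner_smul_right, inner_sub_right, inner_smul_right,
      real_inner_self_eq_norm_mul_norm]
    have h1 := real_inner_le_norm x (R (l n) x)
    have h2 := (hR (l n) (hl n)).2 x
    have h3 : l n * inner ℝ x (R (l n) x) ≤ ‖x‖ * ‖x‖ := by
      calc l n * inner ℝ x (R (l n) x) ≤ l n * (‖x‖ * ‖R (l n) x‖) := by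
            gcongr
        _ = ‖x‖ * (l n * ‖R (l n) x‖) := by ring
        _ ≤ ‖x‖ * ‖x‖ := by gcongr
    exact mul_nonpos_of_nonneg_of_nonpos (hlpos n).le (by linarith)
  have hBcomm : ∀ m n, Commute (B m) (B n) := by
    intro m n
    have h := hRcomm (l m) (hl m) (l n) (hl n)
    refine Commute.sub_left (Commute.sub_right ?_ ?_) (Commute.sub_right ?_ ?_)
    · exact (h.smul_left _).smul_right _
    · exact ((Commute.one_right _).smul_left _).smul_right _
    · exact ((Commute.one_left _).smul_left _).smul_right _
    · exact ((Commute.one_left _).smul_left _).smul_right _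
  -- On the domain `l R(l) p.1 - p.1 = R(l) p.2`, of norm at most `‖p.2‖ / l`; density and `‖l R(l)‖
  -- ≤ 1` do the rest.
  have hJ : ∀ x, Tendsto (fun n => l n • R (l n) x) atTop (𝓝 x) := by
    intro x
    rw [Metric.tendsto_nhds]
    intro ε hε
    obtain ⟨_, ⟨p, hp, rfl⟩, hpx⟩ := hA.dense_domain.exists_dist_lt x
      (show 0 < ε / 3 by linarith)
    filter_upwards [hltop.eventually_gt_atTop (‖p.2‖ / (ε / 3))] with n hn
    have hn' : ‖p.2‖ < l n * (ε / 3) := (div_lt_iff₀ (by linarith)).1 hn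
    have h1 : l n • R (l n) p.1 - p.1 = R (l n) p.2 := by
      have := hRA (l n) (hl n) p hp
      rw [map_sub, map_smul] at this
      rw [← sub_eq_zero, sub_right_comm, this, sub_self]
    have h2 : ‖R (l n) p.2‖ < ε / 3 := by
      have := (hR (l n) (hl n)).2 p.2
      have := hlpos n
      by_contra hcon
      push Not at hcon
      nlinarith
    have h3 : ‖l n • R (l n) (x - p.1)‖ ≤ ‖x - p.1‖ := by
      rw [norm_smul, Real.norm_of_nonneg (hlpos n).le]
      exact (hR (l n) (hl n)).2 _
    rw [dist_eq_norm] at hpx ⊢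
    calc ‖l n • R (l n) x - x‖
        = ‖l n • R (l n) (x - p.1) + (l n • R (l n) p.1 - p.1) - (x - p.1)‖ := by
          rw [map_sub, smul_sub]; congr 1; abel
      _ ≤ ‖x - p.1‖ + ‖R (l n) p.2‖ + ‖x - p.1‖ := by
          refine (norm_sub_le _ _).trans (add_le_add ((norm_add_le _ _).trans ?_) le_rfl)
          rw [h1]
          exact add_le_add h3 le_rfl
      _ < ε := by linarith
  have hBlim : ∀ p ∈ A, Tendsto (fun n => B n p.1) atTop (𝓝 p.2) := by
    intro p hp
    refine (hJ p.2).congr fun n => ?_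
    have := hRA (l n) (hl n) p hp
    rw [map_sub, map_smul] at this
    rw [hBapp]
    congr 1
    rw [← sub_eq_zero, ← neg_sub, sub_right_comm, this, sub_self, neg_zero]
  obtain ⟨S, hSn, hS⟩ := exists_semigroup_of_approx B hBdiss hBcomm hA.dense_domain hBlim
  -- Maximality: the generator of the contraction semigroup `S` is dissipative and extends `A`. If
  -- `(x, y)` belongs to it, then `w = x - R(l₀)(l₀ x - y)` lies in its domain with image `l₀ w`, so
  -- `l₀ ‖w‖² ≤ 0` and `x` is in the domain of `A`.
  have hgen : IsGenerator A S := by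
    refine fun x y => ⟨fun h => hS _ h, fun h => ?_⟩
    have h1 := (hR l₀ le_rfl).1 (l₀ • x - y)
    have h2 := h.sub (hS _ h1)
    have h3 : ∀ t : ℝ, 0 < t → inner ℝ (x - R l₀ (l₀ • x - y))
        (t⁻¹ • (S.toFun t.toNNReal x - x) - t⁻¹ • (S.toFun t.toNNReal (R l₀ (l₀ • x - y))
          - R l₀ (l₀ • x - y))) ≤ 0 := by
      intro t ht
      set w := x - R l₀ (l₀ • x - y) with hw
      have h4 : t⁻¹ • (S.toFun t.toNNReal x - x) - t⁻¹ • (S.toFun t.toNNReal (R l₀ (l₀ • x - y))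
          - R l₀ (l₀ • x - y)) = t⁻¹ • (S.toFun t.toNNReal w - w) := by
        rw [hw, map_sub (S.toFun t.toNNReal), ← smul_sub, sub_sub_sub_comm]
      rw [h4, inner_smul_right, inner_sub_right, real_inner_self_eq_norm_mul_norm]
      have h5 := real_inner_le_norm w (S.toFun t.toNNReal w)
      have h6 : ‖w‖ * ‖S.toFun t.toNNReal w‖ ≤ ‖w‖ * ‖w‖ := by gcongr; exact hSn _ _
      exact mul_nonpos_of_nonneg_of_nonpos (inv_pos.2 ht).le (by linarith)
    have h4 := le_of_tendsto ((tendsto_const_nhds (x := x - R l₀ (l₀ • x - y))).inner h2)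
      (by filter_upwards [self_mem_nhdsWithin] with t ht using h3 t ht)
    have h5 : y - (l₀ • R l₀ (l₀ • x - y) - (l₀ • x - y)) = l₀ • (x - R l₀ (l₀ • x - y)) := by
      module
    rw [h5, inner_smul_right, real_inner_self_eq_norm_mul_norm] at h4
    have h6 : x - R l₀ (l₀ • x - y) = 0 := by
      rw [← norm_le_zero_iff]
      by_contra hcon
      push Not at hcon
      nlinarith [mul_pos hcon hcon]
    have h7 : R l₀ (l₀ • x - y) = x := (sub_eq_zero.1 h6).symm
    rw [h7] at h1
    simpa using h1
  exact ⟨S, hgen, fun S' hS' => hS'.eq hA.dissipative hA.dense_domain hgen⟩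

end Generation

/-! ### The adjoint semigroup and the extrapolation space -/

section AdjointDomain

variable {H : Type*} [NormedAddCommGroup H] [InnerProductSpace ℝ H] {A : Submodule ℝ (H × H)}

theorem AdjDomain.norm_eq (z : AdjDomain A) : ‖z‖ = ‖AdjDomain.incl A z‖ := rfl

theorem AdjDomain.incl_mem (z : AdjDomain A) : AdjDomain.incl A z ∈ A.adjoint := z.2

end AdjointDomain

section AdjointSemigroup

variable {H : Type*} [NormedAddCommGroup H] [InnerProductSpace ℝ H] [CompleteSpace H]
  {A : Submodule ℝ (H × H)} {S : C0Semigroup H}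

theorem C0Semigroup.adjoint_add (S : C0Semigroup H) (s t : ℝ≥0) (z : H) :
    (S.toFun (s + t)).adjoint z = (S.toFun s).adjoint ((S.toFun t).adjoint z) := by
  rw [add_comm, S.map_add, ContinuousLinearMap.adjoint_comp]
  rfl

theorem norm_adjoint_apply_le (hc : ∀ t x, ‖S.toFun t x‖ ≤ ‖x‖) (t : ℝ≥0) (z : H) :
    ‖(S.toFun t).adjoint z‖ ≤ ‖z‖ := by
  have h1 : ‖S.toFun t‖ ≤ 1 :=
    ContinuousLinearMap.opNorm_le_bound _ zero_le_one (by simpa using hc t)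
  calc ‖(S.toFun t).adjoint z‖ ≤ ‖(S.toFun t).adjoint‖ * ‖z‖ := ContinuousLinearMap.le_opNorm _ _
    _ ≤ 1 * ‖z‖ := by
        gcongr
        rwa [LinearIsometryEquiv.norm_map]
    _ = ‖z‖ := one_mul _

/-- The adjoint of a contraction semigroup is strongly continuous. -/
theorem continuous_adjoint_apply (hc : ∀ t x, ‖S.toFun t x‖ ≤ ‖x‖) (z : H) :
    Continuous fun t : ℝ => (S.toFun t.toNNReal).adjoint z := by
  -- Contractivity turns weak continuity at zero into strong continuity: expanding the square leaves
  -- only a pairing with `S(t) z`.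
  have hsq : ∀ t : ℝ≥0, ‖(S.toFun t).adjoint z - z‖ ^ 2 ≤ 2 * inner ℝ z (z - S.toFun t z) := by
    intro t
    have h1 := norm_adjoint_apply_le hc t z
    have h2 : ‖(S.toFun t).adjoint z‖ ^ 2 ≤ ‖z‖ ^ 2 := by gcongr
    rw [norm_sub_sq_real, inner_sub_right, real_inner_self_eq_norm_sq,
      ContinuousLinearMap.adjoint_inner_left]
    linarith
  have hmono : ∀ s t : ℝ≥0, s ≤ t → ‖(S.toFun t).adjoint z - (S.toFun s).adjoint z‖
      ≤ ‖(S.toFun (t - s)).adjoint z - z‖ := by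
    intro s t hst
    have h : t = s + (t - s) := (add_tsub_cancel_of_le hst).symm
    conv_lhs => rw [h, S.adjoint_add, ← map_sub]
    exact norm_adjoint_apply_le hc _ _
  -- With truncated subtraction, `(t - s) + (s - t)` is `|t - s|`.
  have hbound : ∀ s t : ℝ≥0, ‖(S.toFun t).adjoint z - (S.toFun s).adjoint z‖ ^ 2
      ≤ 2 * inner ℝ z (z - S.toFun ((t - s) + (s - t)) z) := by
    intro s t
    refine le_trans ?_ (hsq _)
    rcases le_total s t with h | h
    · rw [tsub_eq_zero_of_le h, add_zero]
      gcongr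
      exact hmono s t h
    · rw [tsub_eq_zero_of_le h, zero_add, norm_sub_rev]
      gcongr
      exact hmono t s h
  suffices h : Continuous fun t : ℝ≥0 => (S.toFun t).adjoint z from
    h.comp continuous_real_toNNReal
  refine continuous_iff_continuousAt.2 fun s => ?_
  rw [ContinuousAt, tendsto_iff_norm_sub_tendsto_zero]
  have h0 : Tendsto (fun t : ℝ≥0 => 2 * inner ℝ z (z - S.toFun ((t - s) + (s - t)) z)) (𝓝 s)
      (𝓝 0) := by
    have hcont : Continuous fun t : ℝ≥0 => 2 * inner ℝ z (z - S.toFun ((t - s) + (s - t)) z) := by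
      refine continuous_const.mul (continuous_const.inner (continuous_const.sub ?_))
      exact (S.strongly_continuous z).comp
        ((continuous_id.sub continuous_const).add (continuous_const.sub continuous_id))
    have := hcont.tendsto s
    simpa [S.map_zero] using this
  have h1 : Tendsto (fun t : ℝ≥0 => ‖(S.toFun t).adjoint z - (S.toFun s).adjoint z‖ ^ 2) (𝓝 s)
      (𝓝 0) := squeeze_zero (fun _ => sq_nonneg _) (hbound s) h0
  have h2 := h1.sqrt
  simpa using h2

/-- `A†` is not known here to generate the adjoint semigroup. Pairing with the dense domain of `A`
and integrating the derivative of `⟨S(s) q, p.1⟩` gives `S(t)† p.1 = p.1 + ∫₀ᵗ S(s)† p.2`, whose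
integrand is continuous by `continuous_adjoint_apply`. -/
theorem hasDerivWithinAt_adjoint (hS : IsGenerator A S) (hc : ∀ t x, ‖S.toFun t x‖ ≤ ‖x‖)
    (hdense : Dense (Prod.fst '' (A : Set (H × H)))) {p : H × H} (hp : p ∈ A.adjoint) {t : ℝ}
    (ht : 0 ≤ t) : HasDerivWithinAt (fun s : ℝ => (S.toFun s.toNNReal).adjoint p.1)
      ((S.toFun t.toNNReal).adjoint p.2) (Set.Ici t) t := by
  have hcont := continuous_adjoint_apply hc p.2
  have key : ∀ t : ℝ, 0 ≤ t → (S.toFun t.toNNReal).adjoint p.1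
      = p.1 + ∫ s in (0 : ℝ)..t, (S.toFun s.toNNReal).adjoint p.2 := by
    intro t ht
    refine hdense.eq_of_inner_right ℝ ?_
    rintro _ ⟨q, hq, rfl⟩
    have h1 : ∀ s, 0 ≤ s → HasDerivWithinAt (fun s : ℝ => inner ℝ (S.toFun s.toNNReal q.1) p.1)
        (inner ℝ q.1 ((S.toFun s.toNNReal).adjoint p.2)) (Set.Ici s) s := by
      intro s hs
      have h2 := (hS.hasDerivWithinAt hq hs).inner ℝ (hasDerivWithinAt_const s (Set.Ici s) p.1)
      rw [inner_zero_right, zero_add] at h2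
      have h3 := (Submodule.mem_adjoint_iff _ _).1 hp _ _ (hS.map_mem s.toNNReal hq)
      rw [ContinuousLinearMap.adjoint_inner_right, ← sub_eq_zero.1 h3]
      exact h2
    have h2 := intervalIntegral.integral_eq_sub_of_hasDeriv_right_of_le_real ht
      ((S.continuous_real q.1).inner continuous_const).continuousOn
      (fun s hs => (h1 s hs.1.le).mono Set.Ioi_subset_Ici_self)
      ((continuous_const.inner hcont).continuousOn.integrableOn_Icc)
    have h3 := (innerSL ℝ q.1).intervalIntegral_comp_comm
      (hcont.intervalIntegrable (μ := volume) 0 t)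
    simp only [innerSL_apply_apply] at h3
    rw [inner_add_right, ← h3, h2, ContinuousLinearMap.adjoint_inner_right, Real.toNNReal_zero,
      S.map_zero]
    simp
  have hd : HasDerivAt (fun t : ℝ => p.1 + ∫ s in (0 : ℝ)..t, (S.toFun s.toNNReal).adjoint p.2)
      ((S.toFun t.toNNReal).adjoint p.2) t :=
    (intervalIntegral.integral_hasDerivAt_right (hcont.intervalIntegrable _ _)
      (hcont.stronglyMeasurableAtFilter _ _) hcont.continuousAt).const_add _
  refine hd.hasDerivWithinAt.congr (fun s hs => key s (ht.trans hs)) (key t ht)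

/-- The energy balance for the adjoint semigroup. -/
theorem integral_energy_adjoint (hS : IsGenerator A S) (hc : ∀ t x, ‖S.toFun t x‖ ≤ ‖x‖)
    (hdense : Dense (Prod.fst '' (A : Set (H × H)))) {p : H × H} (hp : p ∈ A.adjoint) {T : ℝ}
    (hT : 0 ≤ T) :
    ∫ s in (0 : ℝ)..T, -inner ℝ ((S.toFun s.toNNReal).adjoint p.1)
      ((S.toFun s.toNNReal).adjoint p.2) ≤ ‖p.1‖ ^ 2 / 2 := by
  have h1 := intervalIntegral.integral_eq_sub_of_hasDeriv_right_of_le_real hT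
    (((continuous_adjoint_apply hc p.1).norm.pow 2).continuousOn)
    (fun s hs => ((hasDerivWithinAt_adjoint hS hc hdense hp hs.1.le).norm_sq).mono
      Set.Ioi_subset_Ici_self)
    ((continuous_const.mul ((continuous_adjoint_apply hc p.1).inner
      (continuous_adjoint_apply hc p.2))).continuousOn.integrableOn_Icc)
  rw [intervalIntegral.integral_const_mul, Pi.pow_apply, Pi.pow_apply] at h1
  rw [intervalIntegral.integral_neg]
  have h2 : ‖(S.toFun (Real.toNNReal 0)).adjoint p.1‖ ≤ ‖p.1‖ := norm_adjoint_apply_le hc _ _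
  have h3 : ‖(S.toFun (Real.toNNReal 0)).adjoint p.1‖ ^ 2 ≤ ‖p.1‖ ^ 2 := by gcongr
  -- The energy remaining at time `T` is discarded, leaving half of the initial energy.
  nlinarith [sq_nonneg ‖(S.toFun T.toNNReal).adjoint p.1‖]

theorem IsGenerator.incl_adjSemigroup (hS : IsGenerator A S) (t : ℝ≥0) (z : AdjDomain A) :
    AdjDomain.incl A (hS.adjSemigroup t z) =
      ((S.toFun t).adjoint (AdjDomain.incl A z).1, (S.toFun t).adjoint (AdjDomain.incl A z).2) :=
  rfl

theorem continuous_adjSemigroup_apply (hS : IsGenerator A S) (hc : ∀ t x, ‖S.toFun t x‖ ≤ ‖x‖)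
    (z : AdjDomain A) : Continuous fun t : ℝ => hS.adjSemigroup t.toNNReal z := by
  have h : Continuous fun t : ℝ => ((S.toFun t.toNNReal).adjoint (AdjDomain.incl A z).1,
      (S.toFun t.toNNReal).adjoint (AdjDomain.incl A z).2) :=
    (continuous_adjoint_apply hc _).prodMk (continuous_adjoint_apply hc _)
  exact h.subtype_mk fun t => (AdjDomain.incl_mem (hS.adjSemigroup t.toNNReal z))

theorem norm_adjSemigroup_le (hS : IsGenerator A S) (hc : ∀ t x, ‖S.toFun t x‖ ≤ ‖x‖)
    (t : ℝ≥0) : ‖hS.adjSemigroup t‖ ≤ 1 := by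
  refine ContinuousLinearMap.opNorm_le_bound _ zero_le_one fun z => ?_
  rw [one_mul, AdjDomain.norm_eq, AdjDomain.norm_eq, hS.incl_adjSemigroup]
  exact max_le_max (norm_adjoint_apply_le hc _ _) (norm_adjoint_apply_le hc _ _)

theorem norm_extrapSemigroup_apply_le (hS : IsGenerator A S)
    (hc : ∀ t x, ‖S.toFun t x‖ ≤ ‖x‖) (t : ℝ≥0) (ℓ : Extrap A) :
    ‖hS.extrapSemigroup t ℓ‖ ≤ ‖ℓ‖ := by
  have h : hS.extrapSemigroup t ℓ = ℓ.comp (hS.adjSemigroup t) := rfl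
  rw [h]
  refine (ContinuousLinearMap.opNorm_comp_le _ _).trans ?_
  exact mul_le_of_le_one_right (norm_nonneg _) (norm_adjSemigroup_le hS hc t)

/-- Every element of the extrapolation space has the form `a + A b`. -/
theorem exists_extrap_repr (ℓ : Extrap A) : ∃ a b : H, ∀ z : AdjDomain A,
    ℓ z = inner ℝ a (AdjDomain.incl A z).1 + inner ℝ b (AdjDomain.incl A z).2 := by
  -- Hahn–Banach extends `ℓ` from the graph of `A†` to `H × H`, where the Riesz theorem applies in
  -- each factor.
  obtain ⟨g, hg, -⟩ := exists_extension_norm_eq (𝕜 := ℝ) (E := H × H) A.adjoint ℓ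
  refine ⟨(InnerProductSpace.toDual ℝ H).symm (g.comp (ContinuousLinearMap.inl ℝ H H)),
    (InnerProductSpace.toDual ℝ H).symm (g.comp (ContinuousLinearMap.inr ℝ H H)), fun z => ?_⟩
  rw [InnerProductSpace.toDual_symm_apply, InnerProductSpace.toDual_symm_apply]
  have h := hg z
  refine h.symm.trans ?_
  change g (AdjDomain.incl A z) = _
  conv_lhs => rw [← Prod.fst_add_snd (AdjDomain.incl A z), map_add]
  rfl

/-- A dual semigroup need not be strongly continuous in general. Here the representation `ℓ = a + A
b` reduces the claim to the orbits of `a` and `b` in `H`. -/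
theorem continuous_extrapSemigroup_apply (hS : IsGenerator A S) (ℓ : Extrap A) :
    Continuous fun t : ℝ => hS.extrapSemigroup t.toNNReal ℓ := by
  obtain ⟨a, b, hab⟩ := exists_extrap_repr ℓ
  let E : H →L[ℝ] Extrap A := (ContinuousLinearMap.precomp ℝ
    ((ContinuousLinearMap.snd ℝ H H).comp (AdjDomain.incl A))).comp (innerSL ℝ)
  have h : ∀ t : ℝ, hS.extrapSemigroup t.toNNReal ℓ
      = toExtrap A (S.toFun t.toNNReal a) + E (S.toFun t.toNNReal b) := by
    intro t
    ext z
    have h1 : hS.extrapSemigroup t.toNNReal ℓ z = ℓ (hS.adjSemigroup t.toNNReal z) := rfl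
    have h2 : E (S.toFun t.toNNReal b) z = inner ℝ (S.toFun t.toNNReal b) (AdjDomain.incl A z).2 :=
      rfl
    rw [h1, hab, hS.incl_adjSemigroup, add_apply, toExtrap_apply, h2,
      ContinuousLinearMap.adjoint_inner_right, ContinuousLinearMap.adjoint_inner_right]
  simp_rw [h]
  exact ((toExtrap A).continuous.comp (S.continuous_real a)).add
    (E.continuous.comp (S.continuous_real b))

theorem continuous_extrapSemigroup_comp (hS : IsGenerator A S)
    (hc : ∀ t x, ‖S.toFun t x‖ ≤ ‖x‖) {X : Type*} [TopologicalSpace X] {τ : X → ℝ}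
    (hτ : Continuous τ) {ℓ : X → Extrap A} (hℓ : Continuous ℓ) :
    Continuous fun s => hS.extrapSemigroup (τ s).toNNReal (ℓ s) := by
  refine continuous_iff_continuousAt.2 fun s => ?_
  rw [ContinuousAt, tendsto_iff_norm_sub_tendsto_zero]
  have h1 := tendsto_iff_norm_sub_tendsto_zero.1 (hℓ.tendsto s)
  have h2 := tendsto_iff_norm_sub_tendsto_zero.1
    (((continuous_extrapSemigroup_apply hS (ℓ s)).comp hτ).tendsto s)
  refine squeeze_zero (fun _ => norm_nonneg _) (fun r => ?_) (by simpa using h1.add h2)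
  calc ‖hS.extrapSemigroup (τ r).toNNReal (ℓ r) - hS.extrapSemigroup (τ s).toNNReal (ℓ s)‖
      = ‖hS.extrapSemigroup (τ r).toNNReal (ℓ r - ℓ s)
        + (hS.extrapSemigroup (τ r).toNNReal (ℓ s) - hS.extrapSemigroup (τ s).toNNReal (ℓ s))‖ := by
          rw [map_sub]; congr 1; abel
    _ ≤ _ := (norm_add_le _ _).trans
          (add_le_add (norm_extrapSemigroup_apply_le hS hc _ _) le_rfl)

end AdjointSemigroup

/-! ### Volterra equations in an exponentially weighted norm -/

section Volterra

variable {H : Type*} [NormedAddCommGroup H] [InnerProductSpace ℝ H]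

/-- The input map integrates over the fixed window `(0, T)`. For inputs vanishing at negative times
this is the convolution integral over `(0, t)`. -/
theorem integral_sub_left_of_forall_nonpos {E : Type*} [NormedAddCommGroup E] [NormedSpace ℝ E]
    {f : ℝ → E} (hf : ∀ s ≤ 0, f s = 0) {t T : ℝ} (ht : t ∈ Set.Icc 0 T) :
    ∫ r in (0 : ℝ)..T, f (t - r) = ∫ s in (0 : ℝ)..t, f s := by
  rw [intervalIntegral.integral_comp_sub_left, sub_zero,
    intervalIntegral.integral_of_le (by linarith [ht.1, ht.2]),
    intervalIntegral.integral_of_le ht.1]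
  refine setIntegral_eq_of_subset_of_forall_sdiff_eq_zero measurableSet_Ioc
    (Set.Ioc_subset_Ioc_left (by linarith [ht.2])) fun s hs => hf s ?_
  by_contra hcon
  exact hs.2 ⟨not_le.1 hcon, hs.1.2⟩

/-- Exponentially weighted averages of an integrable function are uniformly small. -/
theorem exists_exp_weight_integral_le {w : ℝ → ℝ} {T : ℝ}
    (hw : IntegrableOn w (Set.Ioc 0 T)) {ε : ℝ} (hε : 0 < ε) :
    ∃ k : ℝ, 0 < k ∧ ∀ t ∈ Set.Icc 0 T, ∫ s in (0 : ℝ)..t, w s * Real.exp (-(k * (t - s))) ≤ ε := by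
  -- Half of `ε` is spent on replacing `w` by a bounded continuous function in `L¹`, where the
  -- weight is at most `1`.
  obtain ⟨g, hgs, hg, hgc, hgi⟩ := Integrable.exists_hasCompactSupport_integral_sub_le hw
    (half_pos hε)
  obtain ⟨B, hB⟩ := hgc.bounded_above_of_compact_support hgs
  -- For the bounded part the weight integrates to at most `1 / k`, and this `k` makes `(|B| + 1) /
  -- k` equal to `ε / 2`.
  refine ⟨2 * (|B| + 1) / ε, by positivity, fun t ht => ?_⟩
  set k := 2 * (|B| + 1) / ε with hk
  have hkpos : 0 < k := by positivity
  have hsub : Set.Ioc 0 t ⊆ Set.Ioc 0 T := Set.Ioc_subset_Ioc_right ht.2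
  have hce : Continuous fun s : ℝ => Real.exp (-(k * (t - s))) := by fun_prop
  have hwt : IntegrableOn w (Set.Ioc 0 t) := hw.mono_set hsub
  have hi1 : IntervalIntegrable (fun s => w s - g s) volume 0 t :=
    (intervalIntegrable_iff_integrableOn_Ioc_of_le ht.1).2
      (hwt.sub (hgc.integrableOn_Ioc))
  have e1 : ∫ s in (0 : ℝ)..t, (w s - g s) * Real.exp (-(k * (t - s))) ≤ ε / 2 := by
    refine le_trans ?_ hg
    rw [intervalIntegral.integral_of_le ht.1]
    refine le_trans (setIntegral_mono_on (g := fun s => ‖w s - g s‖) ?_ ?_ measurableSet_Ioc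
      fun s hs => ?_) (setIntegral_mono_set ?_ ?_ hsub.eventuallyLE)
    · exact (intervalIntegrable_iff_integrableOn_Ioc_of_le ht.1).1
        (hi1.mul_continuousOn hce.continuousOn)
    · exact (hwt.sub hgc.integrableOn_Ioc).norm
    · refine (le_abs_self _).trans ?_
      rw [abs_mul, Real.abs_exp, Real.norm_eq_abs]
      refine mul_le_of_le_one_right (abs_nonneg _) (Real.exp_le_one_iff.2 ?_)
      nlinarith [hs.1, hs.2]
    · exact (hw.sub hgi).norm
    · exact Eventually.of_forall fun s => norm_nonneg _
  have e2 : ∫ s in (0 : ℝ)..t, g s * Real.exp (-(k * (t - s))) ≤ ε / 2 := by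
    have hd : ∀ s ∈ Set.uIcc 0 t, HasDerivAt (fun s : ℝ => (|B| + 1) * k⁻¹
        * Real.exp (-(k * (t - s)))) ((|B| + 1) * Real.exp (-(k * (t - s)))) s := by
      intro s _
      have h := ((((hasDerivAt_id s).const_sub t).const_mul k).neg.exp).const_mul
        ((|B| + 1) * k⁻¹)
      convert! h using 1
      simp only [id, Pi.neg_apply]
      field_simp
    have h := intervalIntegral.integral_eq_sub_of_hasDerivAt hd
      ((continuous_const.mul hce).intervalIntegrable _ _)
    calc ∫ s in (0 : ℝ)..t, g s * Real.exp (-(k * (t - s)))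
        ≤ ∫ s in (0 : ℝ)..t, (|B| + 1) * Real.exp (-(k * (t - s))) := by
          refine intervalIntegral.integral_mono_on ht.1
            ((hgc.mul hce).intervalIntegrable _ _)
            ((continuous_const.mul hce).intervalIntegrable _ _) fun s _ => ?_
          gcongr
          have := hB s
          rw [Real.norm_eq_abs] at this
          linarith [le_abs_self (g s), le_abs_self B]
      _ ≤ (|B| + 1) * k⁻¹ := by
          rw [h]
          simp only [sub_self, mul_zero, neg_zero, Real.exp_zero, mul_one]
          have : 0 ≤ (|B| + 1) * k⁻¹ * Real.exp (-(k * (t - 0))) := by positivity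
          linarith
      _ = ε / 2 := by
          rw [hk]
          have : |B| + 1 ≠ 0 := by positivity
          field_simp
  have hsplit : ∫ s in (0 : ℝ)..t, w s * Real.exp (-(k * (t - s)))
      = (∫ s in (0 : ℝ)..t, (w s - g s) * Real.exp (-(k * (t - s))))
        + ∫ s in (0 : ℝ)..t, g s * Real.exp (-(k * (t - s))) := by
    rw [← intervalIntegral.integral_add (hi1.mul_continuousOn hce.continuousOn)
      (hgc.intervalIntegrable _ _ |>.mul_continuousOn hce.continuousOn)]
    congr 1; ext s; ring
  linarith

/-- Linear Volterra equations with a square-integrable kernel bound are uniquely solvable. -/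
theorem existsUnique_volterra [CompleteSpace H] {T : ℝ} (hT : 0 ≤ T) {w : ℝ → ℝ}
    (hw0 : ∀ s, 0 ≤ w s) (hw : IntegrableOn w (Set.Ioc 0 T))
    (K : C(Set.Icc (0 : ℝ) T, H) → C(Set.Icc (0 : ℝ) T, H))
    (hsub : ∀ y y', K y - K y' = K (y - y'))
    (hK : ∀ y (t : Set.Icc (0 : ℝ) T), ‖K y t‖ ^ 2
      ≤ ∫ s in (0 : ℝ)..t.1, w s * ‖Set.IccExtend hT y s‖ ^ 2)
    (y₁ : C(Set.Icc (0 : ℝ) T, H)) : ∃! y, y = y₁ + K y := by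
  -- The bound on `K` concerns squared norms, so `1 / 4` yields the contraction constant `1 / 2`.
  obtain ⟨k, hk, hsmall⟩ := exists_exp_weight_integral_le hw (show (0 : ℝ) < 1 / 4 by norm_num)
  let e : ℝ → C(Set.Icc (0 : ℝ) T, ℝ) := fun c => ⟨fun t => Real.exp (c * t.1), by fun_prop⟩
  have he : ∀ c y, e c • (e (-c) • y) = (y : C(Set.Icc (0 : ℝ) T, H)) := by
    intro c y
    ext t
    change Real.exp (c * t.1) • Real.exp (-c * t.1) • y t = y t
    rw [smul_smul, ← Real.exp_add, neg_mul, add_neg_cancel, Real.exp_zero, one_smul]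
  -- The fixed-point map conjugated by `e^{-kt/2}`; squaring produces the kernel `e^{-k(t-s)}` of
  -- the previous lemma.
  let F : C(Set.Icc (0 : ℝ) T, H) → C(Set.Icc (0 : ℝ) T, H) := fun z =>
    e (-(k / 2)) • (y₁ + K (e (k / 2) • z))
  have hbound : ∀ z, ‖e (-(k / 2)) • K (e (k / 2) • z)‖ ≤ 1 / 2 * ‖z‖ := by
    intro z
    refine (ContinuousMap.norm_le _ (by positivity)).2 fun t => ?_
    have h1 := hK (e (k / 2) • z) t
    have h2 : ∫ s in (0 : ℝ)..t.1, w s * ‖Set.IccExtend hT (e (k / 2) • z) s‖ ^ 2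
        ≤ (∫ s in (0 : ℝ)..t.1, w s * Real.exp (-(k * (t.1 - s))))
          * (Real.exp (k * t.1) * ‖z‖ ^ 2) := by
      rw [← intervalIntegral.integral_mul_const]
      have hwt : IntervalIntegrable w volume 0 t.1 :=
        (intervalIntegrable_iff_integrableOn_Ioc_of_le t.2.1).2
          (hw.mono_set (Set.Ioc_subset_Ioc_right t.2.2))
      refine intervalIntegral.integral_mono_on t.2.1 ?_ ?_ fun s hs => ?_
      · exact hwt.mul_continuousOn
          ((((e (k / 2) • z).continuous.Icc_extend' ).norm.pow 2).continuousOn)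
      · refine (hwt.mul_continuousOn (Continuous.continuousOn ?_)).mul_const _
        fun_prop
      · have hs' : s ∈ Set.Icc 0 T := ⟨hs.1, hs.2.trans t.2.2⟩
        rw [Set.IccExtend_of_mem hT _ hs']
        have h3 : ‖(e (k / 2) • z) ⟨s, hs'⟩‖ ^ 2 ≤ Real.exp (k * s) * ‖z‖ ^ 2 := by
          simp only [ContinuousMap.smul_apply', e, ContinuousMap.coe_mk, norm_smul,
            Real.norm_eq_abs, Real.abs_exp, mul_pow, ← Real.exp_nat_mul]
          have : (2 : ℕ) * (k / 2 * s) = k * s := by push_cast; ring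
          rw [this]
          gcongr
          exact z.norm_coe_le_norm _
        calc w s * ‖(e (k / 2) • z) ⟨s, hs'⟩‖ ^ 2 ≤ w s * (Real.exp (k * s) * ‖z‖ ^ 2) := by
              gcongr
              exact hw0 s
          _ = w s * Real.exp (-(k * (t.1 - s))) * (Real.exp (k * t.1) * ‖z‖ ^ 2) := by
              have : Real.exp (k * s) = Real.exp (-(k * (t.1 - s))) * Real.exp (k * t.1) := by
                rw [← Real.exp_add]; congr 1; ring
              rw [this]; ring
    have h3 : ‖K (e (k / 2) • z) t‖ ^ 2 ≤ 1 / 4 * (Real.exp (k * t.1) * ‖z‖ ^ 2) :=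
      (h1.trans h2).trans (by gcongr; exact hsmall t.1 t.2)
    have h4 : ‖(e (-(k / 2)) • K (e (k / 2) • z)) t‖ ^ 2 ≤ (1 / 2 * ‖z‖) ^ 2 := by
      simp only [ContinuousMap.smul_apply', e, ContinuousMap.coe_mk, norm_smul,
        Real.norm_eq_abs, Real.abs_exp, mul_pow, ← Real.exp_nat_mul]
      have : (2 : ℕ) * (-(k / 2) * t.1) = -(k * t.1) := by push_cast; ring
      rw [this]
      calc Real.exp (-(k * t.1)) * ‖K (e (k / 2) • z) t‖ ^ 2
          ≤ Real.exp (-(k * t.1)) * (1 / 4 * (Real.exp (k * t.1) * ‖z‖ ^ 2)) := by gcongr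
        _ = (1 / 2) ^ 2 * ‖z‖ ^ 2 := by
            rw [Real.exp_neg]
            field_simp
            ring
    exact (sq_le_sq₀ (norm_nonneg _) (by positivity)).1 h4
  have hF : ContractingWith (1 / 2) F := by
    refine ⟨by rw [← NNReal.coe_lt_coe]; norm_num, LipschitzWith.of_dist_le_mul fun z z' => ?_⟩
    rw [dist_eq_norm, dist_eq_norm]
    have h1 : F z - F z' = e (-(k / 2)) • K (e (k / 2) • (z - z')) := by
      rw [smul_sub (e (k / 2)) z z', ← hsub, ← smul_sub]
      congr 1
      abel
    rw [h1]
    simpa using hbound (z - z')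
  have hiff : ∀ y, y = y₁ + K y ↔ F (e (-(k / 2)) • y) = e (-(k / 2)) • y := by
    intro y
    simp only [F, he]
    refine ⟨fun h => by rw [← h], fun h => ?_⟩
    have := congrArg (fun x => e (k / 2) • x) h
    simp only [he] at this
    exact this.symm
  refine ⟨e (k / 2) • ContractingWith.fixedPoint F hF, ?_, fun y hy => ?_⟩
  · have h1 : e (-(k / 2)) • (e (k / 2) • ContractingWith.fixedPoint F hF)
        = ContractingWith.fixedPoint F hF := by
      have := he (-(k / 2)) (ContractingWith.fixedPoint F hF)
      rwa [neg_neg] at this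
    exact (hiff _).2 (by rw [h1]; exact hF.fixedPoint_isFixedPt)
  · have h1 := hF.fixedPoint_unique ((hiff y).1 hy)
    rw [← h1, he]

end Volterra

/-! ### Admissibility of the control operator and mild solutions -/

section MildSolution

variable {H : Type*} [NormedAddCommGroup H] [InnerProductSpace ℝ H] [CompleteSpace H]
  {A : Submodule ℝ (H × H)} {S : C0Semigroup H}

/-- The observation map `z ↦ (r ↦ M S(r)† z)` extends to a bounded operator into `L²(0, T; H)`. -/
theorem exists_observationMap (hS : IsGenerator A S) (hc : ∀ t x, ‖S.toFun t x‖ ≤ ‖x‖)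
    (hdense : Dense (Prod.fst '' (A : Set (H × H))))
    (hadj : DenseRange fun z : AdjDomain A => (AdjDomain.incl A z).1)
    (M : AdjDomain A →L[ℝ] H) {C : ℝ} (hC : 0 ≤ C)
    (hM : ∀ z, ‖M z‖ ^ 2 ≤ C * -inner ℝ (AdjDomain.incl A z).1 (AdjDomain.incl A z).2)
    {T : ℝ} (hT : 0 ≤ T) :
    ∃ Ψ : H →L[ℝ] Lp H 2 (volume.restrict (Set.Ioc 0 T)),
      (∀ z, Ψ (AdjDomain.incl A z).1 =ᵐ[volume.restrict (Set.Ioc 0 T)]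
        fun r => M (hS.adjSemigroup r.toNNReal z)) ∧ ∀ x, ‖Ψ x‖ ≤ √(C / 2) * ‖x‖ := by
  have hcont : ∀ z, Continuous fun r : ℝ => M (hS.adjSemigroup r.toNNReal z) := fun z =>
    M.continuous.comp (continuous_adjSemigroup_apply hS hc z)
  have hmem : ∀ z, MemLp (fun r : ℝ => M (hS.adjSemigroup r.toNNReal z)) 2
      (volume.restrict (Set.Ioc 0 T)) := by
    intro z
    have h1 : MemLp (fun r : ℝ => M (hS.adjSemigroup r.toNNReal z)) ⊤
        (volume.restrict (Set.Ioc 0 T)) := by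
      refine memLp_top_of_bound (hcont z).aestronglyMeasurable (‖M‖ * ‖z‖)
        (Eventually.of_forall fun r => (M.le_opNorm _).trans ?_)
      gcongr
      refine ((hS.adjSemigroup r.toNNReal).le_opNorm z).trans ?_
      exact mul_le_of_le_one_left (norm_nonneg _) (norm_adjSemigroup_le hS hc _)
    exact h1.mono_exponent le_top
  let f : AdjDomain A →ₗ[ℝ] Lp H 2 (volume.restrict (Set.Ioc 0 T)) :=
    { toFun := fun z => (hmem z).toLp _
      map_add' := fun z z' => by
        rw [← MemLp.toLp_add]
        congr 1
        ext r
        simp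
      map_smul' := fun c z => by
        rw [RingHom.id_apply, ← MemLp.toLp_const_smul]
        congr 1
        ext r
        simp }
  let e : AdjDomain A →ₗ[ℝ] H :=
    ((ContinuousLinearMap.fst ℝ H H).comp (AdjDomain.incl A)).toLinearMap
  -- The form bound integrated along the adjoint orbit is controlled by the energy balance. The
  -- right-hand side involves the norm of `z` in `H` alone, not the graph norm, so the map extends
  -- from `D(A†)` to `H`.
  have hnorm : ∀ z, ‖f z‖ ≤ √(C / 2) * ‖e z‖ := by
    intro z
    have h1 : ‖f z‖ ^ 2 = ∫ r in (0 : ℝ)..T, ‖M (hS.adjSemigroup r.toNNReal z)‖ ^ 2 := by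
      rw [← real_inner_self_eq_norm_sq, L2.inner_def, intervalIntegral.integral_of_le hT]
      refine integral_congr_ae ?_
      filter_upwards [(hmem z).coeFn_toLp] with r hr
      have hr' : f z r = M (hS.adjSemigroup r.toNNReal z) := hr
      rw [hr', real_inner_self_eq_norm_sq]
    have h2 : ‖f z‖ ^ 2 ≤ C * (‖(AdjDomain.incl A z).1‖ ^ 2 / 2) := by
      rw [h1]
      have hci : Continuous fun r : ℝ => -inner ℝ
          ((S.toFun r.toNNReal).adjoint (AdjDomain.incl A z).1)
          ((S.toFun r.toNNReal).adjoint (AdjDomain.incl A z).2) :=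
        ((continuous_adjoint_apply hc _).inner (continuous_adjoint_apply hc _)).neg
      refine le_trans (intervalIntegral.integral_mono_on hT
        (((hcont z).norm.pow 2).intervalIntegrable _ _)
        ((hci.intervalIntegrable _ _).const_mul C)
        fun r _ => hM (hS.adjSemigroup r.toNNReal z)) ?_
      rw [intervalIntegral.integral_const_mul]
      gcongr
      exact integral_energy_adjoint hS hc hdense (AdjDomain.incl_mem z) hT
    have h3 : ‖f z‖ ^ 2 ≤ (√(C / 2) * ‖e z‖) ^ 2 := by
      rw [mul_pow, Real.sq_sqrt (by positivity)]
      refine h2.trans (le_of_eq ?_)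
      change C * (‖(AdjDomain.incl A z).1‖ ^ 2 / 2) = C / 2 * ‖(AdjDomain.incl A z).1‖ ^ 2
      ring
    exact (sq_le_sq₀ (norm_nonneg _) (by positivity)).1 h3
  refine ⟨f.extendOfNorm e, fun z => ?_, fun x => ?_⟩
  · have h := LinearMap.extendOfNorm_eq (f := f) (e := e) hadj ⟨_, hnorm⟩ z
    have h' : f.extendOfNorm e (AdjDomain.incl A z).1 = f z := h
    rw [h']
    exact (hmem z).coeFn_toLp
  · exact LinearMap.norm_extendOfNorm_apply_le hadj _ hnorm x

/-- The input map of an admissible control operator, for square-integrable inputs. -/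
theorem exists_inputMap (hS : IsGenerator A S) (hc : ∀ t x, ‖S.toFun t x‖ ≤ ‖x‖)
    (hdense : Dense (Prod.fst '' (A : Set (H × H))))
    (hadj : DenseRange fun z : AdjDomain A => (AdjDomain.incl A z).1)
    (M : AdjDomain A →L[ℝ] H) {C : ℝ} (hC : 0 ≤ C)
    (hM : ∀ z, ‖M z‖ ^ 2 ≤ C * -inner ℝ (AdjDomain.incl A z).1 (AdjDomain.incl A z).2)
    {T : ℝ} (hT : 0 ≤ T) {g : ℝ → H} (hg : MemLp g 2 volume) :
    ∃ Φ : ℝ → H, Continuous Φ ∧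
      (∀ t z, inner ℝ (Φ t) (AdjDomain.incl A z).1
        = ∫ r in (0 : ℝ)..T, inner ℝ (g (t - r)) (M (hS.adjSemigroup r.toNNReal z))) ∧
      ∀ t, ‖Φ t‖ ^ 2 ≤ C / 2 * ∫ r in (0 : ℝ)..T, ‖g (t - r)‖ ^ 2 := by
  obtain ⟨Ψ, hΨ, hΨn⟩ := exists_observationMap hS hc hdense hadj M hC hM hT
  have hmp : ∀ t : ℝ, MeasurePreserving (fun r : ℝ => t - r) volume volume := fun t =>
    Measure.measurePreserving_sub_left volume t
  -- The reflected translate `r ↦ g (t - r)`, restricted to the observation window; it depends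
  -- continuously on `t` in `L²`.
  let τ : ℝ → Lp H 2 (volume.restrict (Set.Ioc (0 : ℝ) T)) := fun t =>
    LpToLpRestrictCLM ℝ H ℝ volume 2 (Set.Ioc 0 T)
      (Lp.compMeasurePreserving (fun r : ℝ => t - r) (hmp t) (hg.toLp g))
  have hτ : ∀ t, τ t =ᵐ[volume.restrict (Set.Ioc 0 T)] fun r => g (t - r) := by
    intro t
    refine (LpToLpRestrictCLM_coeFn ℝ _ _).trans (ae_restrict_of_ae ?_)
    exact (Lp.coeFn_compMeasurePreserving _ (hmp t)).trans
      ((hmp t).quasiMeasurePreserving.ae_eq_comp hg.coeFn_toLp)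
  have hτc : Continuous τ := by
    refine (LpToLpRestrictCLM ℝ H ℝ volume 2 (Set.Ioc 0 T)).continuous.comp ?_
    let c : ℝ → C(ℝ, ℝ) := fun t => ⟨fun r => t - r, by fun_prop⟩
    have hcc : Continuous c := ContinuousMap.continuous_of_continuous_uncurry _ (by
      change Continuous fun p : ℝ × ℝ => p.1 - p.2
      fun_prop)
    exact Continuous.compMeasurePreservingLp (f := fun _ : ℝ => hg.toLp g) (g := c)
      continuous_const hcc hmp (by norm_num)
  -- The input map is the Hilbert space adjoint of the observation map.
  refine ⟨fun t => Ψ.adjoint (τ t), Ψ.adjoint.continuous.comp hτc, fun t z => ?_, fun t => ?_⟩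
  · rw [ContinuousLinearMap.adjoint_inner_left, L2.inner_def, intervalIntegral.integral_of_le hT]
    refine integral_congr_ae ?_
    filter_upwards [hτ t, hΨ z] with r h1 h2
    rw [h1, h2]
  · have h1 : ‖τ t‖ ^ 2 = ∫ r in (0 : ℝ)..T, ‖g (t - r)‖ ^ 2 := by
      rw [← real_inner_self_eq_norm_sq, L2.inner_def, intervalIntegral.integral_of_le hT]
      refine integral_congr_ae ?_
      filter_upwards [hτ t] with r hr
      rw [hr, real_inner_self_eq_norm_sq]
    have h2 : ‖Ψ‖ ≤ √(C / 2) := Ψ.opNorm_le_bound (by positivity) hΨn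
    have h3 : ‖Ψ.adjoint (τ t)‖ ≤ √(C / 2) * ‖τ t‖ := by
      refine (Ψ.adjoint.le_opNorm _).trans ?_
      rw [LinearIsometryEquiv.norm_map]
      gcongr
    calc ‖Ψ.adjoint (τ t)‖ ^ 2 ≤ (√(C / 2) * ‖τ t‖) ^ 2 := by gcongr
      _ = C / 2 * ∫ r in (0 : ℝ)..T, ‖g (t - r)‖ ^ 2 := by
          rw [mul_pow, Real.sq_sqrt (by positivity), h1]

/-- Well-posedness of the bilinear control system: if the control operator is form-bounded by the
dissipation of `A†`, then for every `u ∈ L²(0,T)` there is exactly one mild solution. -/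
theorem existsUnique_isMildSolution (hA : ∀ p ∈ A, inner ℝ p.1 p.2 ≤ 0)
    (hdense : Dense (Prod.fst '' (A : Set (H × H))))
    (hadj : DenseRange fun z : AdjDomain A => (AdjDomain.incl A z).1) (hS : IsGenerator A S)
    (N : H →L[ℝ] Extrap A) (M : AdjDomain A →L[ℝ] H) (hNM : ∀ y z, N y z = inner ℝ y (M z))
    {C : ℝ} (hC : 0 ≤ C)
    (hM : ∀ z, ‖M z‖ ^ 2 ≤ C * -inner ℝ (AdjDomain.incl A z).1 (AdjDomain.incl A z).2)
    {T : ℝ} (hT : 0 ≤ T) (y₀ : H) {u : ℝ → ℝ} (hu : MemLp u 2 (volume.restrict (Set.Ioo 0 T))) :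
    ∃! y : C(Set.Icc (0 : ℝ) T, H), IsMildSolution hS N hT y₀ u y := by
  have hc := hS.norm_apply_le hA hdense
  -- Since `D(A†)` is dense, identities in the extrapolation space can be read back in `H`.
  have hinj : Function.Injective (toExtrap A) := fun x y hxy =>
    hadj.eq_of_inner_left ℝ fun z => congrArg (fun ℓ : Extrap A => ℓ z) hxy
  rw [restrict_Ioo_eq_restrict_Ioc] at hu
  have hu1 : IntegrableOn u (Set.Ioc 0 T) := hu.integrable (by norm_num)
  have hycont : ∀ y : C(Set.Icc (0 : ℝ) T, H), Continuous (Set.IccExtend hT y) := fun y =>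
    y.continuous.Icc_extend'
  have hint : ∀ (y : C(Set.Icc (0 : ℝ) T, H)) (t : Set.Icc (0 : ℝ) T), IntervalIntegrable
      (fun s => u s • hS.extrapSemigroup (t.1 - s).toNNReal (N (Set.IccExtend hT y s)))
      volume 0 t.1 := by
    intro y t
    have h1 : Continuous fun s : ℝ =>
        hS.extrapSemigroup (t.1 - s).toNNReal (N (Set.IccExtend hT y s)) :=
      continuous_extrapSemigroup_comp hS hc (continuous_const.sub continuous_id)
        (N.continuous.comp (hycont y))
    rw [intervalIntegrable_iff_integrableOn_Ioc_of_le t.2.1]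
    refine IntegrableOn.smul_continuousOn_of_subset (hu1.mono_set
      (Set.Ioc_subset_Ioc_right t.2.2)) h1.continuousOn measurableSet_Ioc
      (isCompact_Icc (a := 0) (b := t.1)) Set.Ioc_subset_Icc_self
  -- The Bochner integral in the extrapolation space is represented by a continuous `H`-valued
  -- function with an `L²`-type bound; this is where admissibility enters.
  have hexK : ∀ y : C(Set.Icc (0 : ℝ) T, H), ∃ k : C(Set.Icc (0 : ℝ) T, H),
      ∀ t : Set.Icc (0 : ℝ) T, (toExtrap A (k t) = ∫ s in (0 : ℝ)..t.1,
          u s • hS.extrapSemigroup (t.1 - s).toNNReal (N (Set.IccExtend hT y s))) ∧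
        ‖k t‖ ^ 2 ≤ ∫ s in (0 : ℝ)..t.1, C / 2 * u s ^ 2 * ‖Set.IccExtend hT y s‖ ^ 2 := by
    intro y
    -- Extension of the input by zero to the line, so that translations act on it.
    set g : ℝ → H := (Set.Ioc 0 T).indicator fun s => u s • Set.IccExtend hT y s with hg
    have hg0 : ∀ s ≤ 0, g s = 0 := fun s hs =>
      Set.indicator_of_notMem (fun h => absurd h.1 (not_lt.2 hs)) _
    have hg1 : ∀ t ∈ Set.Icc 0 T, ∀ s ∈ Set.Ioc 0 t, g s = u s • Set.IccExtend hT y s :=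
      fun t ht s hs => Set.indicator_of_mem (show s ∈ Set.Ioc 0 T from ⟨hs.1, hs.2.trans ht.2⟩) _
    have hgm : MemLp g 2 volume := by
      rw [hg, memLp_indicator_iff_restrict measurableSet_Ioc]
      have hy : MemLp (Set.IccExtend hT y) ⊤ (volume.restrict (Set.Ioc 0 T)) := by
        refine memLp_top_of_bound (hycont y).aestronglyMeasurable ‖y‖
          (Eventually.of_forall fun s => y.norm_coe_le_norm _)
      exact hy.smul hu
    obtain ⟨Φ, hΦc, hΦ, hΦn⟩ := exists_inputMap hS hc hdense hadj M hC hM hT hgm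
    let k : C(Set.Icc (0 : ℝ) T, H) := ⟨fun t => Φ t.1, hΦc.comp continuous_subtype_val⟩
    have hk : ∀ t, k t = Φ t.1 := fun _ => rfl
    refine ⟨k, fun t => ⟨?_, ?_⟩⟩
    · ext z
      rw [toExtrap_apply, hk, hΦ, ContinuousLinearMap.intervalIntegral_apply
        (hint y t)]
      have h1 := integral_sub_left_of_forall_nonpos
        (f := fun s => inner ℝ (g s) (M (hS.adjSemigroup (t.1 - s).toNNReal z)))
        (fun s hs => by rw [hg0 s hs, inner_zero_left]) t.2
      simp only [sub_sub_cancel] at h1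
      rw [h1]
      refine intervalIntegral.integral_congr_ae (Eventually.of_forall fun s hs => ?_)
      rw [Set.uIoc_of_le t.2.1] at hs
      rw [hg1 t.1 t.2 s hs, real_inner_smul_left, ← hNM]
      rfl
    · rw [hk]
      refine (hΦn t.1).trans (le_of_eq ?_)
      rw [integral_sub_left_of_forall_nonpos (f := fun s => ‖g s‖ ^ 2)
        (fun s hs => by rw [hg0 s hs]; simp) t.2, ← intervalIntegral.integral_const_mul]
      refine intervalIntegral.integral_congr_ae (Eventually.of_forall fun s hs => ?_)
      rw [Set.uIoc_of_le t.2.1] at hs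
      simp only [hg1 t.1 t.2 s hs, norm_smul, mul_pow, Real.norm_eq_abs, sq_abs]
      ring
  choose K hK hKn using hexK
  have hKsub : ∀ y y', K y - K y' = K (y - y') := by
    intro y y'
    ext t
    refine hinj ?_
    rw [hK (y - y') t, ContinuousMap.sub_apply, map_sub, hK y t, hK y' t,
      ← intervalIntegral.integral_sub (hint y t) (hint y' t)]
    congr 1
    ext1 s
    have : Set.IccExtend hT (y - y') s = Set.IccExtend hT y s - Set.IccExtend hT y' s := rfl
    rw [this, map_sub, map_sub, smul_sub]
  have hw : IntegrableOn (fun s => C / 2 * u s ^ 2) (Set.Ioc 0 T) :=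
    (hu.integrable_sq).const_mul _
  let y₁ : C(Set.Icc (0 : ℝ) T, H) :=
    ⟨fun t => S.toFun t.1.toNNReal y₀, (S.continuous_real y₀).comp continuous_subtype_val⟩
  have hmain := existsUnique_volterra hT (w := fun s => C / 2 * u s ^ 2)
    (fun s => by positivity) hw K hKsub hKn y₁
  have hiff : ∀ y, IsMildSolution hS N hT y₀ u y ↔ y = y₁ + K y := by
    intro y
    constructor
    · intro h
      ext t
      refine hinj ?_
      rw [(h t).2, ContinuousMap.add_apply, map_add, hK y t]
      rfl
    · intro h t
      refine ⟨hint y t, ?_⟩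
      rw [← hK y t, ← map_add]
      exact congrArg (toExtrap A) (congrArg (fun y : C(Set.Icc (0 : ℝ) T, H) => y t) h)
  simpa only [hiff] using hmain

end MildSolution

/-! ### Test functions and integration by parts -/

section TestFunctions

variable {E : Type*} [NormedAddCommGroup E] [NormedSpace ℝ E] {φ ψ : E → ℝ}

theorem IsTestFunction.contDiff_fderiv_apply (hφ : ContDiff ℝ ∞ φ) (e : E) :
    ContDiff ℝ ∞ fun p => fderiv ℝ φ p e :=
  (hφ.fderiv_right (m := ∞) (by simp)).clm_apply contDiff_const

theorem IsTestFunction.fderiv_apply (hφ : IsTestFunction φ) (e : E) :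
    IsTestFunction fun p => fderiv ℝ φ p e :=
  ⟨IsTestFunction.contDiff_fderiv_apply hφ.1 e, hφ.2.fderiv_apply (𝕜 := ℝ) e⟩

theorem IsTestFunction.mul_left (hφ : IsTestFunction φ) (hψ : ContDiff ℝ ∞ ψ) :
    IsTestFunction fun p => ψ p * φ p :=
  ⟨hψ.mul hφ.1, hφ.2.mul_left⟩

theorem IsTestFunction.differentiable (hφ : IsTestFunction φ) : Differentiable ℝ φ :=
  hφ.1.differentiable (by simp)

theorem IsTestFunction.continuous (hφ : IsTestFunction φ) : Continuous φ := hφ.1.continuous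

theorem IsTestFunction.exists_bound (hφ : IsTestFunction φ) : ∃ C, ∀ p, ‖φ p‖ ≤ C :=
  hφ.2.exists_bound_of_continuous hφ.continuous

theorem fderiv_mul_apply (hφ : Differentiable ℝ φ) (hψ : Differentiable ℝ ψ) (p e : E) :
    fderiv ℝ (fun q => φ q * ψ q) p e = φ p * fderiv ℝ ψ p e + ψ p * fderiv ℝ φ p e := by
  rw [fderiv_fun_mul (hφ p) (hψ p)]
  simp

variable [MeasurableSpace E] [BorelSpace E] {μ : Measure E}

theorem IsTestFunction.integrable [IsFiniteMeasureOnCompacts μ] (hφ : IsTestFunction φ) :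
    Integrable φ μ :=
  hφ.continuous.integrable_of_hasCompactSupport hφ.2

theorem IsTestFunction.memLp [IsFiniteMeasureOnCompacts μ] (hφ : IsTestFunction φ)
    (p : ℝ≥0∞) : MemLp φ p μ :=
  hφ.continuous.memLp_of_hasCompactSupport hφ.2

/-- Integration by parts. -/
theorem IsTestFunction.integral_mul_fderiv [FiniteDimensional ℝ E] [μ.IsAddHaarMeasure]
    (hψ : ContDiff ℝ ∞ ψ) (hφ : IsTestFunction φ) (e : E) :
    ∫ p, ψ p * fderiv ℝ φ p e ∂μ = -∫ p, fderiv ℝ ψ p e * φ p ∂μ := by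
  refine integral_mul_fderiv_eq_neg_fderiv_mul_of_integrable
    (hφ.mul_left (IsTestFunction.contDiff_fderiv_apply hψ e)).integrable
    ((hφ.fderiv_apply e).mul_left hψ).integrable (hφ.mul_left hψ).integrable
    (fun x _ => hψ.differentiable (by simp) x) (fun x _ => hφ.differentiable x)

end TestFunctions

/-! ### Cauchy–Schwarz and Minkowski inequalities in `L²` -/

section CauchySchwarz

variable {α β : Type*} [MeasurableSpace α] [MeasurableSpace β] {μ : Measure α} {ν : Measure β}

theorem eLpNorm_two_sq (f : α → ℝ) : eLpNorm f 2 μ ^ 2 = ∫⁻ x, ‖f x‖ₑ ^ 2 ∂μ := by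
  have := eLpNorm_nnreal_pow_eq_lintegral (f := f) (p := 2) (μ := μ) (by norm_num)
  simpa using this

/-- Cauchy–Schwarz for the measure with density `a`, through the factorisation `a b = a^{1/2}
(a^{1/2} b)`. -/
theorem sq_lintegral_mul_le {a b : α → ℝ≥0∞} (ha : AEMeasurable a μ) (hb : AEMeasurable b μ) :
    (∫⁻ x, a x * b x ∂μ) ^ 2 ≤ (∫⁻ x, a x ∂μ) * ∫⁻ x, a x * b x ^ 2 ∂μ := by
  have hpq : (2 : ℝ).HolderConjugate 2 := Real.HolderConjugate.two_two
  have h := ENNReal.lintegral_mul_le_Lp_mul_Lq μ hpq (f := fun x => a x ^ (1 / 2 : ℝ))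
    (g := fun x => a x ^ (1 / 2 : ℝ) * b x) (ha.pow_const _) ((ha.pow_const _).mul hb)
  have e1 : ∀ x, ((fun x => a x ^ (1 / 2 : ℝ)) * fun x => a x ^ (1 / 2 : ℝ) * b x) x
      = a x * b x := by
    intro x
    simp only [Pi.mul_apply]
    rw [← mul_assoc, ← ENNReal.rpow_add_of_nonneg _ _ (by norm_num) (by norm_num)]
    norm_num
  have e2 : ∀ x, (a x ^ (1 / 2 : ℝ)) ^ (2 : ℝ) = a x := by
    intro x
    rw [← ENNReal.rpow_mul]
    norm_num
  have e3 : ∀ x, (a x ^ (1 / 2 : ℝ) * b x) ^ (2 : ℝ) = a x * b x ^ 2 := by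
    intro x
    rw [ENNReal.mul_rpow_of_nonneg _ _ (by norm_num), e2, ENNReal.rpow_two]
  simp only [e1, e2, e3] at h
  calc (∫⁻ x, a x * b x ∂μ) ^ 2
      ≤ ((∫⁻ x, a x ∂μ) ^ (1 / 2 : ℝ) * (∫⁻ x, a x * b x ^ 2 ∂μ) ^ (1 / 2 : ℝ)) ^ 2 := by
        gcongr
    _ = _ := by
        rw [mul_pow, ← ENNReal.rpow_two, ← ENNReal.rpow_two, ← ENNReal.rpow_mul,
          ← ENNReal.rpow_mul]
        norm_num

/-- Minkowski's integral inequality in `L²`. -/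
theorem eLpNorm_integral_mul_le [SFinite μ] [SFinite ν] {k : α → ℝ}
    (hk : AEStronglyMeasurable k μ) {F : α → β → ℝ}
    (hF : AEStronglyMeasurable (Function.uncurry F) (μ.prod ν)) {B : ℝ≥0∞}
    (hB : ∀ z, k z ≠ 0 → eLpNorm (F z) 2 ν ≤ B) :
    eLpNorm (fun p => ∫ z, k z * F z p ∂μ) 2 ν ≤ (∫⁻ z, ‖k z‖ₑ ∂μ) * B := by
  set K := ∫⁻ z, ‖k z‖ₑ ∂μ
  have hsw : AEStronglyMeasurable (fun q : β × α => F q.2 q.1) (ν.prod μ) := hF.prod_swap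
  have hmeas : AEMeasurable (Function.uncurry fun (p : β) (z : α) => ‖k z‖ₑ * ‖F z p‖ₑ ^ 2)
      (ν.prod μ) :=
    (hk.comp_snd.enorm).mul (hsw.enorm.pow_const 2)
  have h1 : ∀ᵐ p ∂ν, ‖∫ z, k z * F z p ∂μ‖ₑ ^ 2 ≤ K * ∫⁻ z, ‖k z‖ₑ * ‖F z p‖ₑ ^ 2 ∂μ := by
    filter_upwards [hsw.prodMk_left] with p hp
    calc ‖∫ z, k z * F z p ∂μ‖ₑ ^ 2 ≤ (∫⁻ z, ‖k z‖ₑ * ‖F z p‖ₑ ∂μ) ^ 2 := by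
          gcongr
          refine (enorm_integral_le_lintegral_enorm _).trans (le_of_eq ?_)
          simp only [enorm_mul]
      _ ≤ _ := sq_lintegral_mul_le hk.enorm hp.enorm
  have h2 : eLpNorm (fun p => ∫ z, k z * F z p ∂μ) 2 ν ^ 2 ≤ (K * B) ^ 2 := by
    rw [eLpNorm_two_sq]
    calc ∫⁻ p, ‖∫ z, k z * F z p ∂μ‖ₑ ^ 2 ∂ν
        ≤ ∫⁻ p, K * ∫⁻ z, ‖k z‖ₑ * ‖F z p‖ₑ ^ 2 ∂μ ∂ν := lintegral_mono_ae h1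
      _ = K * ∫⁻ p, ∫⁻ z, ‖k z‖ₑ * ‖F z p‖ₑ ^ 2 ∂μ ∂ν :=
          lintegral_const_mul'' _ hmeas.lintegral_prod_right'
      _ = K * ∫⁻ z, ∫⁻ p, ‖k z‖ₑ * ‖F z p‖ₑ ^ 2 ∂ν ∂μ := by
          rw [lintegral_lintegral_swap hmeas]
      _ ≤ K * ∫⁻ z, ‖k z‖ₑ * B ^ 2 ∂μ := by
          gcongr with z
          rw [lintegral_const_mul' _ _ enorm_ne_top, ← eLpNorm_two_sq]
          -- The bound on `F z` is asked only where the kernel is nonzero: translates of `f` are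
          -- close to `f` only for `z` in the support of the mollifier.
          rcases eq_or_ne (k z) 0 with h | h
          · simp [h]
          · gcongr
            exact hB z h
      _ = (K * B) ^ 2 := by
          rw [lintegral_mul_const'' _ hk.enorm]
          ring
  exact (ENNReal.pow_le_pow_left_iff two_ne_zero).1 h2

end CauchySchwarz

/-! ### Mollification and convergence in `L²` -/

section Mollify

variable {E : Type*} [NormedAddCommGroup E] [NormedSpace ℝ E] [FiniteDimensional ℝ E]
  [MeasureSpace E] [BorelSpace E] [(volume : Measure E).IsAddHaarMeasure]

/-- Convolution of `f` with the kernel `κ`. -/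
def mollify (f κ : E → ℝ) : E → ℝ :=
  convolution f κ (ContinuousLinearMap.mul ℝ ℝ) volume

theorem mollify_apply (f κ : E → ℝ) (p : E) : mollify f κ p = ∫ q, f q * κ (p - q) := rfl

theorem mollify_apply_swap (f κ : E → ℝ) (p : E) : mollify f κ p = ∫ z, κ z * f (p - z) := by
  rw [mollify, convolution_mul_swap]
  simp_rw [mul_comm]

theorem mollify_comm (f κ : E → ℝ) : mollify f κ = mollify κ f := by
  ext p
  rw [mollify_apply_swap, mollify_apply]

variable {f κ w : E → ℝ}

theorem contDiff_mollify (hf : LocallyIntegrable f) (hκ : IsTestFunction κ) :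
    ContDiff ℝ ∞ (mollify f κ) :=
  hκ.2.contDiff_convolution_right (n := ⊤) _ hf hκ.1

theorem isTestFunction_mollify (hw : IsTestFunction w) (hκ : IsTestFunction κ) :
    IsTestFunction (mollify w κ) :=
  ⟨contDiff_mollify hw.integrable.locallyIntegrable hκ, hw.2.convolution _ hκ.2⟩

theorem fderiv_mollify_apply (hf : LocallyIntegrable f) (hκ : IsTestFunction κ) (p e : E) :
    fderiv ℝ (mollify f κ) p e = mollify f (fun q => fderiv ℝ κ q e) p := by
  have h := hκ.2.hasFDerivAt_convolution_right (ContinuousLinearMap.mul ℝ ℝ) hf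
    (hκ.1.of_le (by norm_cast)) p
  rw [mollify, h.fderiv, convolution_precompR_apply _ hf (hκ.2.fderiv ℝ)
    (hκ.1.continuous_fderiv (by simp))]
  rfl

theorem fderiv_mollify_apply_left (hw : IsTestFunction w) (hκ : IsTestFunction κ) (p e : E) :
    fderiv ℝ (mollify w κ) p e = mollify (fun q => fderiv ℝ w q e) κ p := by
  rw [mollify_comm, fderiv_mollify_apply hκ.integrable.locallyIntegrable hw, mollify_comm]

theorem integrable_mollify_integrand (hf : LocallyIntegrable f) (hκ : Continuous κ)
    (hκs : HasCompactSupport κ) (p : E) : Integrable fun q => f q * κ (p - q) :=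
  hκs.convolutionExists_right (ContinuousLinearMap.mul ℝ ℝ) hf hκ p

/-- Moving an even kernel from one factor to the other. -/
theorem integral_mul_mollify (hf : Integrable f) (hw : IsTestFunction w)
    (hκ : IsTestFunction κ) (heven : ∀ z, κ (-z) = κ z) :
    ∫ p, f p * mollify w κ p = ∫ q, mollify f κ q * w q := by
  have hint : Integrable (Function.uncurry fun p q : E => f p * (w q * κ (p - q)))
      (volume.prod volume) := by
    obtain ⟨C, hC⟩ := hκ.exists_bound
    have h1 : Integrable (fun z : E × E => f z.1 * w z.2) (volume.prod volume) :=
      hf.mul_prod hw.integrable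
    have h2 := h1.mul_bdd (c := C) (g := fun z : E × E => κ (z.1 - z.2))
      (hκ.continuous.comp (continuous_fst.sub continuous_snd)).aestronglyMeasurable
      (Eventually.of_forall fun z => hC _)
    refine h2.congr (Eventually.of_forall fun z => ?_)
    simp only [Function.uncurry]
    ring
  calc ∫ p, f p * mollify w κ p = ∫ p, ∫ q, f p * (w q * κ (p - q)) := by
        simp_rw [mollify_apply, integral_const_mul]
    _ = ∫ q, ∫ p, f p * (w q * κ (p - q)) := integral_integral_swap hint
    _ = ∫ q, mollify f κ q * w q := by
        congr 1
        ext q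
        rw [mollify_apply, ← integral_mul_const]
        congr 1
        ext p
        rw [← heven (p - q), neg_sub]
        ring

/-- Writing `ℓ q = ℓ p - ℓ (p - q)`, the commutator of mollification with a linear factor is
mollification by the kernel `ℓ κ`. It produces the commutator with `v·∇ₓ`. -/
theorem mollify_linear_mul (hf : LocallyIntegrable f) (hκ : IsTestFunction κ) (ℓ : E →L[ℝ] ℝ)
    (p : E) :
    mollify (fun q => ℓ q * f q) κ p = ℓ p * mollify f κ p - mollify f (fun z => ℓ z * κ z) p := by
  have hℓκ : IsTestFunction fun z => ℓ z * κ z := hκ.mul_left ℓ.contDiff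
  rw [mollify_apply, mollify_apply, mollify_apply, ← integral_const_mul,
    ← integral_sub ((integrable_mollify_integrand hf hκ.continuous hκ.2 p).const_mul _)
      (integrable_mollify_integrand hf hℓκ.continuous hℓκ.2 p)]
  congr 1
  ext q
  rw [map_sub]
  ring

theorem eLpNorm_mollify_le (hf : AEStronglyMeasurable f) (hκ : AEStronglyMeasurable κ) :
    eLpNorm (mollify f κ) 2 ≤ (∫⁻ z, ‖κ z‖ₑ) * eLpNorm f 2 := by
  have h : mollify f κ = fun p => ∫ z, κ z * f (p - z) := funext fun p => mollify_apply_swap f κ p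
  rw [h]
  refine eLpNorm_integral_mul_le hκ (F := fun z p => f (p - z)) ?_ fun z _ => le_of_eq ?_
  · have h1 : AEStronglyMeasurable (fun q : E × E => f (q.1 - q.2)) (volume.prod volume) :=
      hf.comp_quasiMeasurePreserving (quasiMeasurePreserving_sub volume volume)
    exact h1.prod_swap
  · exact eLpNorm_comp_measurePreserving hf (measurePreserving_sub_right volume z)

theorem tendsto_eLpNorm_translate (hf : MemLp f 2) :
    Tendsto (fun z => eLpNorm (fun p => f (p - z) - f p) 2) (𝓝 0) (𝓝 0) := by
  have hmp : ∀ z : E, MeasurePreserving (fun p : E => p - z) volume volume := fun z =>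
    measurePreserving_sub_right volume z
  let c : E → C(E, E) := fun z => ⟨fun p => p - z, by fun_prop⟩
  have hcc : Continuous c := ContinuousMap.continuous_of_continuous_uncurry _ (by
    change Continuous fun p : E × E => p.2 - p.1
    fun_prop)
  have h : Continuous fun z => Lp.compMeasurePreserving (fun p : E => p - z) (hmp z) (hf.toLp f) :=
    Continuous.compMeasurePreservingLp (f := fun _ : E => hf.toLp f) (g := c)
      continuous_const hcc hmp (by norm_num)
  have h0 := (tendsto_iff_edist_tendsto_0).1 (h.tendsto 0)
  refine h0.congr fun z => ?_
  have e0 : Lp.compMeasurePreserving (fun p : E => p - 0) (hmp 0) (hf.toLp f) = hf.toLp f := by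
    rw [Lp.toLp_compMeasurePreserving]
    congr 1
    ext p
    simp
  rw [e0, Lp.toLp_compMeasurePreserving, Lp.edist_toLp_toLp]
  rfl

/-- Approximate identities converge in `L²`. -/
theorem tendsto_eLpNorm_mollify_sub (hf : MemLp f 2) {κ : ℕ → E → ℝ}
    (hκ : ∀ n, IsTestFunction (κ n)) (hpos : ∀ n z, 0 ≤ κ n z) (hone : ∀ n, ∫ z, κ n z = 1)
    {r : ℕ → ℝ} (hr : Tendsto r atTop (𝓝 0)) (hsupp : ∀ n z, κ n z ≠ 0 → ‖z‖ ≤ r n) :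
    Tendsto (fun n => eLpNorm (mollify f (κ n) - f) 2) atTop (𝓝 0) := by
  have hfl : LocallyIntegrable f := hf.locallyIntegrable (by norm_num)
  rw [ENNReal.tendsto_nhds_zero]
  intro ε hε
  have h1 := (ENNReal.tendsto_nhds_zero.1 (tendsto_eLpNorm_translate hf)) ε hε
  obtain ⟨δ, hδ, hδ'⟩ := Metric.eventually_nhds_iff.1 h1
  filter_upwards [hr.eventually (gt_mem_nhds hδ)] with n hn
  have h2 : mollify f (κ n) - f = fun p => ∫ z, κ n z * (f (p - z) - f p) := by
    ext p
    simp only [mul_sub]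
    have hi : Integrable fun z => κ n z * f (p - z) := by
      have := (integrable_mollify_integrand hfl (hκ n).continuous (hκ n).2 p)
      have h3 := this.comp_sub_left p
      refine h3.congr (Eventually.of_forall fun z => ?_)
      simp only [sub_sub_cancel]
      ring
    rw [integral_sub hi ((hκ n).integrable.mul_const _), integral_mul_const, hone,
      ← mollify_apply_swap]
    simp
  rw [h2]
  have hK : ∫⁻ z, ‖κ n z‖ₑ = 1 := by
    rw [← ofReal_integral_norm_eq_lintegral_enorm (hκ n).integrable]
    simp only [Real.norm_of_nonneg (hpos n _), hone, ENNReal.ofReal_one]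
  refine (eLpNorm_integral_mul_le (F := fun z p => f (p - z) - f p) (B := ε)
    (hκ n).continuous.aestronglyMeasurable ?_ fun z hz => ?_).trans (by rw [hK, one_mul])
  · have h1 : AEStronglyMeasurable (fun q : E × E => f (q.1 - q.2)) (volume.prod volume) :=
      hf.1.comp_quasiMeasurePreserving (quasiMeasurePreserving_sub volume volume)
    exact h1.prod_swap.sub hf.1.comp_snd
  · refine hδ' ?_
    rw [dist_zero_right]
    exact (hsupp n z hz).trans_lt hn

end Mollify

section TendstoL2

variable {E : Type*} [MeasureSpace E]

/-- Convergence in `L²` of a sequence of functions. -/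
structure TendstoL2 (F : ℕ → E → ℝ) (f : E → ℝ) : Prop where
  memLp : ∀ n, MemLp (F n) 2
  memLp_lim : MemLp f 2
  tendsto : Tendsto (fun n => eLpNorm (F n - f) 2) atTop (𝓝 0)

variable {F G : ℕ → E → ℝ} {f g c : E → ℝ}

theorem memLp_mul_of_bound {C : ℝ} (hc : AEStronglyMeasurable c) (hC : ∀ᵐ p, ‖c p‖ ≤ C)
    (hf : MemLp f 2) : MemLp (fun p => c p * f p) 2 :=
  MemLp.of_le_mul (c := C) hf (hc.mul hf.1) (by
    filter_upwards [hC] with p hp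
    rw [norm_mul]
    gcongr)

theorem TendstoL2.mul_left {C : ℝ} (hF : TendstoL2 F f) (hc : AEStronglyMeasurable c)
    (hC : ∀ᵐ p, ‖c p‖ ≤ C) : TendstoL2 (fun n p => c p * F n p) (fun p => c p * f p) := by
  refine ⟨fun n => memLp_mul_of_bound hc hC (hF.memLp n), memLp_mul_of_bound hc hC hF.memLp_lim, ?_⟩
  have h : ∀ n, eLpNorm ((fun p => c p * F n p) - fun p => c p * f p) 2
      ≤ ENNReal.ofReal C * eLpNorm (F n - f) 2 := by
    intro n
    refine eLpNorm_le_mul_eLpNorm_of_ae_le_mul ?_ 2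
    filter_upwards [hC] with p hp
    simp only [Pi.sub_apply, ← mul_sub, norm_mul]
    gcongr
  have h0 := ENNReal.Tendsto.const_mul (a := ENNReal.ofReal C) hF.tendsto (Or.inr (by simp))
  rw [mul_zero] at h0
  exact tendsto_of_tendsto_of_tendsto_of_le_of_le tendsto_const_nhds h0 (fun _ => zero_le) h

theorem TendstoL2.sub (hF : TendstoL2 F f) (hG : TendstoL2 G g) :
    TendstoL2 (fun n p => F n p - G n p) (fun p => f p - g p) := by
  refine ⟨fun n => (hF.memLp n).sub (hG.memLp n), hF.memLp_lim.sub hG.memLp_lim, ?_⟩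
  have h : ∀ n, eLpNorm ((fun p => F n p - G n p) - fun p => f p - g p) 2
      ≤ eLpNorm (F n - f) 2 + eLpNorm (G n - g) 2 := by
    intro n
    have : ((fun p => F n p - G n p) - fun p => f p - g p) = (F n - f) - (G n - g) := by
      ext p
      simp only [Pi.sub_apply]
      ring
    rw [this]
    exact eLpNorm_sub_le ((hF.memLp n).sub hF.memLp_lim).1 ((hG.memLp n).sub hG.memLp_lim).1
      (by norm_num)
  have h0 := hF.tendsto.add hG.tendsto
  rw [add_zero] at h0
  exact tendsto_of_tendsto_of_tendsto_of_le_of_le tendsto_const_nhds h0 (fun _ => zero_le) h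

theorem integral_mul_eq_inner (hf : MemLp f 2) (hg : MemLp g 2) :
    ∫ p, f p * g p = inner ℝ (hf.toLp f) (hg.toLp g) := by
  rw [L2.inner_def]
  refine integral_congr_ae ?_
  filter_upwards [hf.coeFn_toLp, hg.coeFn_toLp] with p h1 h2
  rw [h1, h2]
  simp [mul_comm]

theorem TendstoL2.tendsto_integral_mul (hF : TendstoL2 F f) (hG : TendstoL2 G g) :
    Tendsto (fun n => ∫ p, F n p * G n p) atTop (𝓝 (∫ p, f p * g p)) := by
  have h1 := (Lp.tendsto_Lp_iff_tendsto_eLpNorm'' F hF.memLp f hF.memLp_lim).2 hF.tendsto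
  have h2 := (Lp.tendsto_Lp_iff_tendsto_eLpNorm'' G hG.memLp g hG.memLp_lim).2 hG.tendsto
  rw [integral_mul_eq_inner hF.memLp_lim hG.memLp_lim]
  refine (h1.inner h2).congr fun n => ?_
  rw [integral_mul_eq_inner (hF.memLp n) (hG.memLp n)]

end TendstoL2

/-! ### Coordinates on phase space and anisotropic mollifiers -/

section Mollifier

variable {d : ℕ}

/-- The `i`-th position direction in phase space. -/
def xDir (i : Fin d) : Phase d := (EuclideanSpace.single i 1, 0)

/-- The `i`-th velocity direction in phase space. -/
def vDir (i : Fin d) : Phase d := (0, EuclideanSpace.single i 1)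

/-- The `i`-th velocity coordinate. -/
def vCoord (i : Fin d) : Phase d →L[ℝ] ℝ :=
  (EuclideanSpace.proj i : EuclideanSpace ℝ (Fin d) →L[ℝ] ℝ).comp
    (ContinuousLinearMap.snd ℝ (Rd d) (Rd d))

theorem vCoord_apply (i : Fin d) (p : Phase d) : vCoord i p = p.2 i := rfl

theorem vCoord_xDir (i : Fin d) : vCoord i (xDir i) = 0 := rfl

theorem abs_vCoord_le (i : Fin d) (p : Phase d) : |vCoord i p| ≤ ‖p.2‖ :=
  PiLp.norm_apply_le p.2 i

theorem fderiv_comp_fst_mul_comp_snd {ρ η : Rd d → ℝ} (hρ : Differentiable ℝ ρ)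
    (hη : Differentiable ℝ η) (p e : Phase d) :
    fderiv ℝ (fun z : Phase d => ρ z.1 * η z.2) p e
      = fderiv ℝ ρ p.1 e.1 * η p.2 + ρ p.1 * fderiv ℝ η p.2 e.2 := by
  have h1 : HasFDerivAt (fun z : Phase d => ρ z.1)
      ((fderiv ℝ ρ p.1).comp (ContinuousLinearMap.fst ℝ _ _)) p :=
    (hρ p.1).hasFDerivAt.comp p hasFDerivAt_fst
  have h2 : HasFDerivAt (fun z : Phase d => η z.2)
      ((fderiv ℝ η p.2).comp (ContinuousLinearMap.snd ℝ _ _)) p :=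
    (hη p.2).hasFDerivAt.comp p hasFDerivAt_snd
  have h3 : HasFDerivAt (fun z : Phase d => ρ z.1 * η z.2) _ p := h1.mul h2
  rw [h3.fderiv]
  simp only [add_apply, smul_apply, ContinuousLinearMap.comp_apply, smul_eq_mul]
  change ρ p.1 * fderiv ℝ η p.2 e.2 + η p.2 * fderiv ℝ ρ p.1 e.1 = _
  ring

theorem isTestFunction_comp_fst_mul_comp_snd {ρ η : Rd d → ℝ} (hρ : IsTestFunction ρ)
    (hη : IsTestFunction η) : IsTestFunction fun z : Phase d => ρ z.1 * η z.2 := by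
  refine ⟨(hρ.1.comp contDiff_fst).mul (hη.1.comp contDiff_snd), ?_⟩
  refine HasCompactSupport.of_support_subset_isCompact (hρ.2.isCompact.prod hη.2.isCompact) ?_
  intro z hz
  have hz' : ρ z.1 * η z.2 ≠ 0 := hz
  exact ⟨subset_tsupport _ (left_ne_zero_of_mul hz'), subset_tsupport _ (right_ne_zero_of_mul hz')⟩

/-- Even mollifiers on phase space, much more concentrated in velocity than in position. -/
theorem exists_mollifier (d : ℕ) : ∃ κ : ℕ → Phase d → ℝ, (∀ n, IsTestFunction (κ n)) ∧
    (∀ n z, 0 ≤ κ n z) ∧ (∀ n, ∫ z, κ n z = 1) ∧ (∀ n z, κ n (-z) = κ n z) ∧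
    (∀ n z, κ n z ≠ 0 → ‖z‖ ≤ 1 / ((n : ℝ) + 1)) ∧
    ∀ i, Tendsto (fun n => ∫⁻ z, ‖vCoord i z * fderiv ℝ (κ n) z (xDir i)‖ₑ) atTop (𝓝 0) := by
  have key : ∀ n : ℕ, ∃ κ : Phase d → ℝ, IsTestFunction κ ∧ (∀ z, 0 ≤ κ z) ∧ (∫ z, κ z = 1) ∧
      (∀ z, κ (-z) = κ z) ∧ (∀ z, κ z ≠ 0 → ‖z‖ ≤ 1 / ((n : ℝ) + 1)) ∧
      ∀ i, ∫⁻ z, ‖vCoord i z * fderiv ℝ κ z (xDir i)‖ₑ ≤ ENNReal.ofReal (1 / ((n : ℝ) + 1)) := by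
    intro n
    set δ : ℝ := 1 / ((n : ℝ) + 1)
    have hδ : 0 < δ := by positivity
    have hbump : ∀ r : ℝ, 0 < r → ∃ ρ : Rd d → ℝ, IsTestFunction ρ ∧ (∀ x, 0 ≤ ρ x) ∧
        (∫ x, ρ x = 1) ∧ (∀ x, ρ (-x) = ρ x) ∧ ∀ x, ρ x ≠ 0 → ‖x‖ ≤ r := by
      intro r hr
      let b : ContDiffBump (0 : Rd d) := ⟨r / 2, r, by linarith, by linarith⟩
      refine ⟨b.normed volume, ⟨b.contDiff_normed, b.hasCompactSupport_normed⟩,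
        b.nonneg_normed, b.integral_normed, b.normed_neg, fun x hx => ?_⟩
      have : x ∈ Function.support (b.normed volume) := hx
      rw [b.support_normed_eq, mem_ball_zero_iff] at this
      exact this.le
    obtain ⟨ρ, hρ, hρ0, hρ1, hρe, hρs⟩ := hbump δ hδ
    -- `K` collects the `L¹` norms of the derivatives of the position kernel. On the support of the
    -- velocity kernel `|vᵢ| ≤ ε`, so `vᵢ ∂ₓᵢκ` has `L¹` norm at most `ε K`, which is at most `δ`
    -- for `ε = δ / (1 + K)`.
    set K : ℝ := ∑ i, ∫ x, ‖fderiv ℝ ρ x (EuclideanSpace.single i 1)‖ with hK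
    have hK0 : 0 ≤ K := Finset.sum_nonneg fun i _ => integral_nonneg fun x => norm_nonneg _
    set ε : ℝ := δ / (1 + K) with hε
    have hε0 : 0 < ε := by positivity
    have hεδ : ε ≤ δ := div_le_self hδ.le (by linarith)
    obtain ⟨η, hη, hη0, hη1, hηe, hηs⟩ := hbump ε hε0
    have hκ := isTestFunction_comp_fst_mul_comp_snd hρ hη
    refine ⟨fun z => ρ z.1 * η z.2, hκ, fun z => mul_nonneg (hρ0 _) (hη0 _), ?_, fun z => ?_,
      fun z hz => ?_, fun i => ?_⟩
    · rw [Measure.volume_eq_prod, integral_prod_mul, hρ1, hη1, mul_one]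
    · change ρ (-z.1) * η (-z.2) = ρ z.1 * η z.2
      rw [hρe, hηe]
    · exact max_le (hρs _ (left_ne_zero_of_mul hz)) ((hηs _ (right_ne_zero_of_mul hz)).trans hεδ)
    · have hi : Integrable fun z : Phase d => vCoord i z
          * fderiv ℝ (fun z : Phase d => ρ z.1 * η z.2) z (xDir i) :=
        ((hκ.fderiv_apply (xDir i)).mul_left (vCoord i).contDiff).integrable
      rw [← ofReal_integral_norm_eq_lintegral_enorm hi]
      refine ENNReal.ofReal_le_ofReal ?_
      have hg : Integrable fun z : Phase d =>
          ‖fderiv ℝ ρ z.1 (EuclideanSpace.single i 1)‖ * η z.2 :=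
        ((hρ.fderiv_apply (EuclideanSpace.single i 1)).integrable (μ := volume)).norm.mul_prod
          hη.integrable
      calc ∫ z : Phase d, ‖vCoord i z * fderiv ℝ (fun z : Phase d => ρ z.1 * η z.2) z (xDir i)‖
          ≤ ∫ z : Phase d, ε * (‖fderiv ℝ ρ z.1 (EuclideanSpace.single i 1)‖ * η z.2) := by
            refine integral_mono hi.norm (hg.const_mul ε) fun z => ?_
            simp only [fderiv_comp_fst_mul_comp_snd hρ.differentiable hη.differentiable, xDir,
              map_zero, mul_zero, add_zero, norm_mul]
            rw [Real.norm_of_nonneg (hη0 z.2)]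
            rcases eq_or_ne (η z.2) 0 with h0 | h0
            · simp [h0]
            · have h1 : ‖vCoord i z‖ ≤ ε := (abs_vCoord_le i z).trans (hηs _ h0)
              have := hη0 z.2
              gcongr
        _ = ε * ∫ x, ‖fderiv ℝ ρ x (EuclideanSpace.single i 1)‖ := by
            rw [integral_const_mul, Measure.volume_eq_prod,
              integral_prod_mul (fun x => ‖fderiv ℝ ρ x (EuclideanSpace.single i 1)‖) η, hη1,
              mul_one]
        _ ≤ ε * K := by
            gcongr
            exact Finset.single_le_sum
              (f := fun i => ∫ x, ‖fderiv ℝ ρ x (EuclideanSpace.single i 1)‖)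
              (fun i _ => integral_nonneg fun x => norm_nonneg _) (Finset.mem_univ i)
        _ ≤ δ := by
            rw [hε, div_mul_eq_mul_div, div_le_iff₀ (by positivity)]
            nlinarith
  choose κ h1 h2 h3 h4 h5 h6 using key
  refine ⟨κ, h1, h2, h3, h4, h5, fun i => ?_⟩
  have h0 : Tendsto (fun n : ℕ => ENNReal.ofReal (1 / ((n : ℝ) + 1))) atTop (𝓝 0) := by
    have := (ENNReal.continuous_ofReal.tendsto 0).comp
      (tendsto_one_div_add_atTop_nhds_zero_nat (𝕜 := ℝ))
    simpa using! this
  exact tendsto_of_tendsto_of_tendsto_of_le_of_le tendsto_const_nhds h0 (fun _ => zero_le)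
    fun n => h6 n i

/-- A coefficient depending on the position only is annihilated by velocity derivatives. -/
theorem integral_fst_mul_fderiv_snd {β : Rd d → ℝ} {C : ℝ} (hβ : AEStronglyMeasurable β)
    (hC : ∀ᵐ x, ‖β x‖ ≤ C) {Φ : Phase d → ℝ} (hΦ : IsTestFunction Φ) (e : Rd d) :
    ∫ p : Phase d, β p.1 * fderiv ℝ Φ p (0, e) = 0 := by
  have hi : Integrable (fun p : Phase d => β p.1 * fderiv ℝ Φ p (0, e)) :=
    (hΦ.fderiv_apply (0, e)).integrable.bdd_mul (c := C)
      (hβ.comp_fst : AEStronglyMeasurable (fun p : Phase d => β p.1) (volume.prod volume))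
      (Measure.quasiMeasurePreserving_fst.ae hC)
  rw [Measure.volume_eq_prod] at hi ⊢
  rw [integral_prod _ hi]
  refine integral_eq_zero_of_ae (Eventually.of_forall fun x => ?_)
  have hx : IsTestFunction fun v : Rd d => Φ (x, v) := by
    refine ⟨hΦ.1.comp (contDiff_const.prodMk contDiff_id), ?_⟩
    refine HasCompactSupport.of_support_subset_isCompact (hΦ.2.isCompact.image continuous_snd) ?_
    intro v hv
    exact ⟨(x, v), subset_tsupport _ hv, rfl⟩
  have h1 : ∀ v, fderiv ℝ Φ (x, v) (0, e) = fderiv ℝ (fun v : Rd d => Φ (x, v)) v e := by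
    intro v
    have h2 : HasFDerivAt (fun v : Rd d => (x, v)) (ContinuousLinearMap.inr ℝ (Rd d) (Rd d)) v :=
      (hasFDerivAt_const x v).prodMk (hasFDerivAt_id v)
    have h3 := (hΦ.differentiable (x, v)).hasFDerivAt.comp v h2
    have h4 : fderiv ℝ (fun v : Rd d => Φ (x, v)) v = _ := h3.fderiv
    rw [h4]
    rfl
  have h5 := IsTestFunction.integral_mul_fderiv (μ := volume) (ψ := fun _ : Rd d => (1 : ℝ))
    contDiff_const hx e
  simp only [one_mul, fderiv_fun_const, Pi.zero_apply, zero_apply, zero_mul, integral_zero,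
    neg_zero] at h5
  change ∫ v, β x * fderiv ℝ Φ (x, v) (0, e) = 0
  rw [integral_const_mul]
  simp only [h1, h5, mul_zero]

end Mollifier

/-! ### The energy inequality for the conjugated equation -/

section Energy

variable {d : ℕ}

instance instIsAddHaarMeasurePhase : (volume : Measure (Phase d)).IsAddHaarMeasure :=
  inferInstanceAs ((volume : Measure (Rd d)).prod (volume : Measure (Rd d))).IsAddHaarMeasure

/-- The operator `V + s v·∇ₓ - β·∇ᵥ - Δᵥ`, in coordinates. -/
def flatOp (V : Phase d → ℝ) (β : Fin d → Rd d → ℝ) (s : ℝ) (ψ : Phase d → ℝ) (p : Phase d) : ℝ :=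
  V p * ψ p + s * ∑ i, vCoord i p * fderiv ℝ ψ p (xDir i)
    - ∑ i, β i p.1 * fderiv ℝ ψ p (vDir i)
    - ∑ i, fderiv ℝ (fun q => fderiv ℝ ψ q (vDir i)) p (vDir i)

theorem Integrable.mul_isTestFunction {F φ : Phase d → ℝ} (hF : Integrable F)
    (hφ : IsTestFunction φ) : Integrable fun p => F p * φ p := by
  obtain ⟨C, hC⟩ := hφ.exists_bound
  exact hF.mul_bdd (c := C) hφ.continuous.aestronglyMeasurable (Eventually.of_forall hC)

theorem aestronglyMeasurable_comp_fst {β : Rd d → ℝ} (hβ : AEStronglyMeasurable β) :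
    AEStronglyMeasurable (fun p : Phase d => β p.1) :=
  (hβ.comp_fst : AEStronglyMeasurable (fun p : Phase d => β p.1) (volume.prod volume))

theorem ae_comp_fst {P : Rd d → Prop} (hP : ∀ᵐ x, P x) : ∀ᵐ p : Phase d, P p.1 :=
  Measure.quasiMeasurePreserving_fst.ae hP

/-- The weak equation tested with a mollified localisation, after moving the mollifier. -/
theorem integral_flatOp_mollify {h V w κ : Phase d → ℝ} {β : Fin d → Rd d → ℝ} {C s : ℝ}
    (hβm : ∀ i, AEStronglyMeasurable (β i)) (hβC : ∀ i, ∀ᵐ x, ‖β i x‖ ≤ C)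
    (hh : Integrable h) (hV : Integrable fun p => V p * h p)
    (hv : ∀ i, Integrable fun p => vCoord i p * h p) (hw : IsTestFunction w)
    (hκ : IsTestFunction κ) (heven : ∀ z, κ (-z) = κ z) :
    ∫ p, h p * flatOp V β s (mollify w κ) p
      = (∫ p, mollify (fun q => V q * h q) κ p * w p)
        + ∑ i, (s * ((∫ p, vCoord i p * mollify h κ p * fderiv ℝ w p (xDir i))
            + ∫ p, mollify h (fun z => vCoord i z * fderiv ℝ κ z (xDir i)) p * w p)
          - (∫ p, mollify (fun q => β i q.1 * h q) κ p * fderiv ℝ w p (vDir i))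
          + ∫ p, fderiv ℝ (mollify h κ) p (vDir i) * fderiv ℝ w p (vDir i)) := by
  have hβh : ∀ i, Integrable fun p : Phase d => β i p.1 * h p := fun i =>
    hh.bdd_mul (c := C) (aestronglyMeasurable_comp_fst (hβm i)) (ae_comp_fst (hβC i))
  have hψ : IsTestFunction (mollify w κ) := isTestFunction_mollify hw hκ
  have hD : ∀ e p, fderiv ℝ (mollify w κ) p e = mollify (fun q => fderiv ℝ w q e) κ p :=
    fun e p => fderiv_mollify_apply_left hw hκ p e
  have hDD : ∀ e p, fderiv ℝ (fun q => fderiv ℝ (mollify w κ) q e) p e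
      = mollify (fun q => fderiv ℝ (fun q => fderiv ℝ w q e) q e) κ p := by
    intro e p
    simp only [hD]
    exact fderiv_mollify_apply_left (hw.fderiv_apply e) hκ p e
  have i1 : Integrable fun p => V p * h p * mollify w κ p := Integrable.mul_isTestFunction hV hψ
  have i2 : ∀ i, Integrable fun p => vCoord i p * h p * fderiv ℝ (mollify w κ) p (xDir i) :=
    fun i => Integrable.mul_isTestFunction (hv i) (hψ.fderiv_apply _)
  have i3 : ∀ i, Integrable fun p => β i p.1 * h p * fderiv ℝ (mollify w κ) p (vDir i) :=
    fun i => Integrable.mul_isTestFunction (hβh i) (hψ.fderiv_apply _)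
  have i4 : ∀ i, Integrable fun p =>
      h p * fderiv ℝ (fun q => fderiv ℝ (mollify w κ) q (vDir i)) p (vDir i) :=
    fun i => Integrable.mul_isTestFunction hh ((hψ.fderiv_apply _).fderiv_apply _)
  have e0 : ∀ p, h p * flatOp V β s (mollify w κ) p = V p * h p * mollify w κ p
      + ∑ i, (s * (vCoord i p * h p * fderiv ℝ (mollify w κ) p (xDir i))
        - β i p.1 * h p * fderiv ℝ (mollify w κ) p (vDir i)
        - h p * fderiv ℝ (fun q => fderiv ℝ (mollify w κ) q (vDir i)) p (vDir i)) := by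
    intro p
    rw [flatOp, Finset.sum_sub_distrib, Finset.sum_sub_distrib]
    simp only [mul_sub, mul_add, Finset.mul_sum]
    have a1 : ∀ i, h p * (s * (vCoord i p * fderiv ℝ (mollify w κ) p (xDir i)))
        = s * (vCoord i p * h p * fderiv ℝ (mollify w κ) p (xDir i)) := fun i => by ring
    have a2 : ∀ i, h p * (β i p.1 * fderiv ℝ (mollify w κ) p (vDir i))
        = β i p.1 * h p * fderiv ℝ (mollify w κ) p (vDir i) := fun i => by ring
    simp only [a1, a2]
    ring
  simp only [e0]
  have i23 : ∀ i, Integrable fun p => s * (vCoord i p * h p * fderiv ℝ (mollify w κ) p (xDir i))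
        - β i p.1 * h p * fderiv ℝ (mollify w κ) p (vDir i) := fun i =>
    ((i2 i).const_mul s).sub (i3 i)
  have i5 : ∀ i, Integrable fun p =>
      s * (vCoord i p * h p * fderiv ℝ (mollify w κ) p (xDir i))
        - β i p.1 * h p * fderiv ℝ (mollify w κ) p (vDir i)
        - h p * fderiv ℝ (fun q => fderiv ℝ (mollify w κ) q (vDir i)) p (vDir i) := fun i =>
    (i23 i).sub (i4 i)
  rw [integral_add i1 (integrable_finsetSum _ fun i _ => i5 i),
    integral_finsetSum _ fun i _ => i5 i]
  congr 1
  · exact integral_mul_mollify hV hw hκ heven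
  refine Finset.sum_congr rfl fun i _ => ?_
  rw [integral_sub (i23 i) (i4 i),
    integral_sub ((i2 i).const_mul s) (i3 i), integral_const_mul]
  simp only [hDD]
  simp only [hD]
  rw [integral_mul_mollify (hv i) (hw.fderiv_apply _) hκ heven,
    integral_mul_mollify (hβh i) (hw.fderiv_apply _) hκ heven,
    integral_mul_mollify hh ((hw.fderiv_apply _).fderiv_apply _) hκ heven]
  have hg : ContDiff ℝ ∞ (mollify h κ) := contDiff_mollify hh.locallyIntegrable hκ
  rw [IsTestFunction.integral_mul_fderiv hg (hw.fderiv_apply (vDir i)) (vDir i)]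
  have hκ' : IsTestFunction fun z => vCoord i z * κ z := hκ.mul_left (vCoord i).contDiff
  -- The commutator of `vᵢ` with mollification is integrated by parts in `xᵢ`; as `vᵢ` does not
  -- depend on position, its kernel becomes `vᵢ ∂ₓᵢκ`, which is small in `L¹`.
  have hX : ∫ p, mollify (fun q => vCoord i q * h q) κ p * fderiv ℝ w p (xDir i)
      = (∫ p, vCoord i p * mollify h κ p * fderiv ℝ w p (xDir i))
        + ∫ p, mollify h (fun z => vCoord i z * fderiv ℝ κ z (xDir i)) p * w p := by
    have hc := contDiff_mollify hh.locallyIntegrable hκ'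
    simp only [mollify_linear_mul hh.locallyIntegrable hκ (vCoord i), sub_mul]
    rw [integral_sub ((hw.fderiv_apply (xDir i)).mul_left ((vCoord i).contDiff.mul hg)).integrable
      ((hw.fderiv_apply (xDir i)).mul_left hc).integrable, sub_eq_add_neg,
      IsTestFunction.integral_mul_fderiv hc hw (xDir i), neg_neg]
    congr 2
    ext p
    rw [fderiv_mollify_apply hh.locallyIntegrable hκ']
    congr 2
    ext z
    rw [fderiv_mul_apply (vCoord i).differentiable hκ.differentiable,
      ContinuousLinearMap.fderiv, vCoord_xDir, mul_zero, add_zero]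
  rw [hX]
  ring

/-- The localised energy inequality for mollified weak solutions. -/
theorem energy_inequality_mollify {h V χ κ : Phase d → ℝ} {β : Fin d → Rd d → ℝ} {C s : ℝ}
    (hβm : ∀ i, AEStronglyMeasurable (β i)) (hβC : ∀ i, ∀ᵐ x, ‖β i x‖ ≤ C)
    (hh : Integrable h) (hV : Integrable fun p => V p * h p)
    (hv : ∀ i, Integrable fun p => vCoord i p * h p) (hχ : IsTestFunction χ)
    (hκ : IsTestFunction κ) (heven : ∀ z, κ (-z) = κ z)
    (hweak : ∫ p, h p * flatOp V β s (mollify (fun p => χ p * (χ p * mollify h κ p)) κ) p = 0) :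
    (∫ p, (χ p * mollify (fun q => V q * h q) κ p) * (χ p * mollify h κ p))
      + ∑ i, (s * ((∫ p, (vCoord i p * χ p * fderiv ℝ χ p (xDir i) * mollify h κ p)
              * mollify h κ p)
            + ∫ p, (χ p * mollify h (fun z => vCoord i z * fderiv ℝ κ z (xDir i)) p)
              * (χ p * mollify h κ p))
          - (∫ p, (β i p.1 * (χ p * fderiv ℝ χ p (vDir i)) * mollify h κ p) * mollify h κ p)
          - (1 / 4 * ∫ p, (χ p * (mollify (fun q => β i q.1 * h q) κ p - β i p.1 * mollify h κ p))
              * (χ p * (mollify (fun q => β i q.1 * h q) κ p - β i p.1 * mollify h κ p)))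
          - (∫ p, (χ p * (mollify (fun q => β i q.1 * h q) κ p - β i p.1 * mollify h κ p))
              * (fderiv ℝ χ p (vDir i) * mollify h κ p))
          - ∫ p, (fderiv ℝ χ p (vDir i) * mollify h κ p)
              * (fderiv ℝ χ p (vDir i) * mollify h κ p)) ≤ 0 := by
  set g := mollify h κ with hgdef
  have hg : ContDiff ℝ ∞ g := contDiff_mollify hh.locallyIntegrable hκ
  have hgd : Differentiable ℝ g := hg.differentiable (by simp)
  have hk : IsTestFunction fun p => χ p * g p := by
    have := hχ.mul_left hg
    simpa only [mul_comm] using this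
  have hw : IsTestFunction fun p => χ p * (χ p * g p) := hk.mul_left hχ.1
  rw [integral_flatOp_mollify hβm hβC hh hV hv hw hκ heven, ← hgdef] at hweak
  -- The zero on the right is replaced by the expanded weak equation, and the two sides are compared
  -- term by term.
  rw [← hweak]
  have hDk : ∀ e p, fderiv ℝ (fun p => χ p * g p) p e
      = χ p * fderiv ℝ g p e + g p * fderiv ℝ χ p e := fun e p =>
    fderiv_mul_apply hχ.differentiable hgd p e
  have hDw : ∀ e p, fderiv ℝ (fun p => χ p * (χ p * g p)) p e
      = χ p * fderiv ℝ (fun p => χ p * g p) p e + χ p * g p * fderiv ℝ χ p e := fun e p =>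
    fderiv_mul_apply hχ.differentiable hk.differentiable p e
  have hk2 : IsTestFunction fun p => (χ p * g p) * (χ p * g p) := hk.mul_left hk.1
  have hDk2 : ∀ e p, fderiv ℝ (fun p => (χ p * g p) * (χ p * g p)) p e
      = 2 * (χ p * g p * fderiv ℝ (fun p => χ p * g p) p e) := fun e p => by
    rw [fderiv_mul_apply hk.differentiable hk.differentiable]
    ring
  refine add_le_add (le_of_eq ?_) (Finset.sum_le_sum fun i _ => ?_)
  · congr 1
    ext p
    ring
  have hβi := aestronglyMeasurable_comp_fst (hβm i)
  have hβb := ae_comp_fst (hβC i)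
  have hβtest : ∀ {φ : Phase d → ℝ}, IsTestFunction φ → Integrable fun p => β i p.1 * φ p :=
    fun hφ => hφ.integrable.bdd_mul (c := C) hβi hβb
  -- the transport term in position
  have hX : ∫ p, vCoord i p * g p * fderiv ℝ (fun p => χ p * (χ p * g p)) p (xDir i)
      = ∫ p, (vCoord i p * χ p * fderiv ℝ χ p (xDir i) * g p) * g p := by
    have h1 : ∫ p, vCoord i p * fderiv ℝ (fun p => (χ p * g p) * (χ p * g p)) p (xDir i) = 0 := by
      rw [IsTestFunction.integral_mul_fderiv (vCoord i).contDiff hk2]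
      simp only [ContinuousLinearMap.fderiv, vCoord_xDir, zero_mul, integral_zero, neg_zero]
    have h2 : ∀ p, vCoord i p * g p * fderiv ℝ (fun p => χ p * (χ p * g p)) p (xDir i)
        = 1 / 2 * (vCoord i p * fderiv ℝ (fun p => (χ p * g p) * (χ p * g p)) p (xDir i))
          + (vCoord i p * χ p * fderiv ℝ χ p (xDir i) * g p) * g p := by
      intro p
      rw [hDk2, hDw]
      ring
    simp only [h2]
    rw [integral_add, integral_const_mul, h1, mul_zero, zero_add]
    · exact ((hk2.fderiv_apply _).mul_left (vCoord i).contDiff).integrable.const_mul _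
    · have := ((hχ.fderiv_apply (xDir i)).mul_left
        (((vCoord i).contDiff.mul hχ.1).mul (hg.mul hg))).integrable (μ := volume)
      refine this.congr (Eventually.of_forall fun p => ?_)
      simp only
      ring
  -- the transport term in velocity
  have hB : ∫ p, β i p.1 * (g p * fderiv ℝ (fun p => χ p * (χ p * g p)) p (vDir i))
      = ∫ p, (β i p.1 * (χ p * fderiv ℝ χ p (vDir i)) * g p) * g p := by
    have h1 : ∫ p : Phase d, β i p.1
        * fderiv ℝ (fun p => (χ p * g p) * (χ p * g p)) p (vDir i) = 0 :=
      integral_fst_mul_fderiv_snd (hβm i) (hβC i) hk2 _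
    have h2 : ∀ p : Phase d, β i p.1 * (g p * fderiv ℝ (fun p => χ p * (χ p * g p)) p (vDir i))
        = 1 / 2 * (β i p.1 * fderiv ℝ (fun p => (χ p * g p) * (χ p * g p)) p (vDir i))
          + (β i p.1 * (χ p * fderiv ℝ χ p (vDir i)) * g p) * g p := by
      intro p
      rw [hDk2, hDw]
      ring
    simp only [h2]
    rw [integral_add, integral_const_mul, h1, mul_zero, zero_add]
    · exact (hβtest (hk2.fderiv_apply _)).const_mul _
    · have := hβtest ((hχ.fderiv_apply (vDir i)).mul_left (hχ.1.mul (hg.mul hg)))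
      refine this.congr (Eventually.of_forall fun p => ?_)
      simp only
      ring
  -- the diffusion term
  have hG : ∫ p, fderiv ℝ g p (vDir i) * fderiv ℝ (fun p => χ p * (χ p * g p)) p (vDir i)
      = (∫ p, fderiv ℝ (fun p => χ p * g p) p (vDir i)
          * fderiv ℝ (fun p => χ p * g p) p (vDir i))
        - ∫ p, (fderiv ℝ χ p (vDir i) * g p) * (fderiv ℝ χ p (vDir i) * g p) := by
    rw [← integral_sub]
    · congr 1
      ext p
      rw [hDw, hDk]
      ring
    · exact ((hk.fderiv_apply _).mul_left (hk.fderiv_apply _).1).integrable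
    · have := ((hχ.fderiv_apply (vDir i)).mul_left
        ((hχ.fderiv_apply (vDir i)).1.mul (hg.mul hg))).integrable (μ := volume)
      refine this.congr (Eventually.of_forall fun p => ?_)
      simp only
      ring
  set B := mollify (fun q : Phase d => β i q.1 * h q) κ with hBdef
  have hBc : ContDiff ℝ ∞ B := contDiff_mollify
    (hh.bdd_mul (c := C) hβi hβb).locallyIntegrable hκ
  have hErr : ∀ {φ : Phase d → ℝ}, IsTestFunction φ →
      Integrable fun p => (χ p * (B p - β i p.1 * g p)) * φ p := by
    intro φ hφ
    have h1 := ((hφ.mul_left (hχ.1.mul hBc)).integrable (μ := volume)).sub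
      (hβtest (hφ.mul_left (hχ.1.mul hg)))
    refine h1.congr (Eventually.of_forall fun p => ?_)
    simp only [Pi.sub_apply]
    ring
  have hErr2 : Integrable fun p =>
      (χ p * (B p - β i p.1 * g p)) * (χ p * (B p - β i p.1 * g p)) := by
    have h1 := ((hχ.mul_left ((hχ.1.mul hBc).mul hBc)).integrable (μ := volume))
    have h2 := (hβtest (hχ.mul_left ((hχ.1.mul hBc).mul hg))).const_mul 2
    have h3 := (hβtest (hχ.mul_left ((hχ.1.mul hg).mul hg))).bdd_mul (c := C) hβi hβb
    refine ((h1.sub h2).add h3).congr (Eventually.of_forall fun p => ?_)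
    simp only [Pi.sub_apply, Pi.add_apply]
    ring
  have hgχ : IsTestFunction fun p => fderiv ℝ χ p (vDir i) * g p := by
    have := (hχ.fderiv_apply (vDir i)).mul_left hg
    simpa only [mul_comm] using this
  -- The mollified product `β h` is `β g` plus an error; the error is paired with `χ ∂ᵥw`-type terms
  -- regrouped so that one factor is the full derivative of `χ g`.
  have hBw : ∫ p, B p * fderiv ℝ (fun p => χ p * (χ p * g p)) p (vDir i)
      = (∫ p, (χ p * (B p - β i p.1 * g p)) * fderiv ℝ (fun p => χ p * g p) p (vDir i))
        + (∫ p, (χ p * (B p - β i p.1 * g p)) * (fderiv ℝ χ p (vDir i) * g p))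
        + ∫ p, β i p.1 * (g p * fderiv ℝ (fun p => χ p * (χ p * g p)) p (vDir i)) := by
    have hsum : Integrable fun p =>
        (χ p * (B p - β i p.1 * g p)) * fderiv ℝ (fun p => χ p * g p) p (vDir i)
          + (χ p * (B p - β i p.1 * g p)) * (fderiv ℝ χ p (vDir i) * g p) :=
      (hErr (hk.fderiv_apply _)).add (hErr hgχ)
    rw [← integral_add (hErr (hk.fderiv_apply _)) (hErr hgχ), ← integral_add
      hsum (hβtest ((hw.fderiv_apply _).mul_left hg))]
    congr 1
    ext p
    rw [hDw]
    ring
  -- No bound on the velocity derivative of `χ g` uniform in the mollifier is available. Young's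
  -- inequality absorbs it into the diffusion at the price of a quarter of the squared error.
  have hYoung : ∫ p, (χ p * (B p - β i p.1 * g p)) * fderiv ℝ (fun p => χ p * g p) p (vDir i)
      ≤ (∫ p, fderiv ℝ (fun p => χ p * g p) p (vDir i)
          * fderiv ℝ (fun p => χ p * g p) p (vDir i))
        + 1 / 4 * ∫ p, (χ p * (B p - β i p.1 * g p)) * (χ p * (B p - β i p.1 * g p)) := by
    rw [← integral_const_mul, ← integral_add
      ((hk.fderiv_apply _).mul_left (hk.fderiv_apply _).1).integrable (hErr2.const_mul _)]
    refine integral_mono (hErr (hk.fderiv_apply _))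
      (((hk.fderiv_apply _).mul_left (hk.fderiv_apply _).1).integrable.add (hErr2.const_mul _))
      fun p => ?_
    simp only
    nlinarith [sq_nonneg (fderiv ℝ (fun p => χ p * g p) p (vDir i)
      - 1 / 2 * (χ p * (B p - β i p.1 * g p)))]
  have hr : ∫ p, mollify h (fun z => vCoord i z * fderiv ℝ κ z (xDir i)) p * (χ p * (χ p * g p))
      = ∫ p, (χ p * mollify h (fun z => vCoord i z * fderiv ℝ κ z (xDir i)) p)
        * (χ p * g p) := by
    congr 1
    ext p
    ring
  rw [hX, hr, hBw, hB, hG]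
  linarith

end Energy

/-! ### Uniqueness of square-integrable weak solutions -/

section FlatUniqueness

variable {d : ℕ}

theorem tendstoL2_mollify {f : Phase d → ℝ} (hf : MemLp f 2) {κ : ℕ → Phase d → ℝ}
    (hκ : ∀ n, IsTestFunction (κ n)) (hpos : ∀ n z, 0 ≤ κ n z) (hone : ∀ n, ∫ z, κ n z = 1)
    (hsupp : ∀ n z, κ n z ≠ 0 → ‖z‖ ≤ 1 / ((n : ℝ) + 1)) :
    TendstoL2 (fun n => mollify f (κ n)) f := by
  refine ⟨fun n => ⟨?_, ?_⟩, hf, tendsto_eLpNorm_mollify_sub hf hκ hpos hone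
    tendsto_one_div_add_atTop_nhds_zero_nat hsupp⟩
  · exact (contDiff_mollify (hf.locallyIntegrable (by norm_num))
      (hκ n)).continuous.aestronglyMeasurable
  · refine (eLpNorm_mollify_le hf.1 (hκ n).continuous.aestronglyMeasurable).trans_lt ?_
    exact ENNReal.mul_lt_top (hκ n).integrable.2 hf.2

theorem tendstoL2_mollify_zero {f : Phase d → ℝ} (hf : MemLp f 2) {k : ℕ → Phase d → ℝ}
    (hk : ∀ n, IsTestFunction (k n))
    (hlim : Tendsto (fun n => ∫⁻ z, ‖k n z‖ₑ) atTop (𝓝 0)) :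
    TendstoL2 (fun n => mollify f (k n)) (fun _ => 0) := by
  have hle := fun n => eLpNorm_mollify_le hf.1 (hk n).continuous.aestronglyMeasurable
  refine ⟨fun n => ⟨?_, ?_⟩, MemLp.zero, ?_⟩
  · exact (contDiff_mollify (hf.locallyIntegrable (by norm_num))
      (hk n)).continuous.aestronglyMeasurable
  · refine (hle n).trans_lt ?_
    exact ENNReal.mul_lt_top (hk n).integrable.2 hf.2
  · have hfin : eLpNorm f 2 volume ≠ ⊤ := hf.eLpNorm_ne_top
    have h3 := ENNReal.Tendsto.mul_const (b := eLpNorm f 2 volume) hlim (Or.inr hfin)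
    rw [zero_mul] at h3
    refine tendsto_of_tendsto_of_tendsto_of_le_of_le tendsto_const_nhds h3
      (fun _ => zero_le) fun n => ?_
    have h4 : (mollify f (k n) - fun _ : Phase d => (0 : ℝ)) = mollify f (k n) := by
      ext p
      simp
    simp only [h4]
    exact hle n

/-- The localised energy inequality for weak solutions. -/
theorem energy_inequality {h V χ : Phase d → ℝ} {β : Fin d → Rd d → ℝ} {C s : ℝ}
    (hβm : ∀ i, AEStronglyMeasurable (β i)) (hβC : ∀ i, ∀ᵐ x, ‖β i x‖ ≤ C)
    (hh : Integrable h) (hh2 : MemLp h 2) (hV : Integrable fun p => V p * h p)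
    (hV2 : MemLp (fun p => V p * h p) 2) (hv : ∀ i, Integrable fun p => vCoord i p * h p)
    (hχ : IsTestFunction χ) {B : Set (Phase d)} (hB : ∀ p z, χ p ≠ 0 → ‖z‖ ≤ 1 → p + z ∈ B)
    (hweak : ∀ ψ, IsTestFunction ψ → (∀ p, ψ p ≠ 0 → p ∈ B) →
      ∫ p, h p * flatOp V β s ψ p = 0) :
    (∫ p, (χ p * (V p * h p)) * (χ p * h p))
      + ∑ i, (s * (∫ p, (vCoord i p * χ p * fderiv ℝ χ p (xDir i) * h p) * h p)
          - (∫ p, (β i p.1 * (χ p * fderiv ℝ χ p (vDir i)) * h p) * h p)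
          - ∫ p, (fderiv ℝ χ p (vDir i) * h p) * (fderiv ℝ χ p (vDir i) * h p)) ≤ 0 := by
  obtain ⟨κ, hκ, hκ0, hκ1, hκe, hκs, hκv⟩ := exists_mollifier d
  have hβi := fun i => aestronglyMeasurable_comp_fst (hβm i)
  have hβb := fun i => ae_comp_fst (hβC i)
  have hβh : ∀ i, MemLp (fun p : Phase d => β i p.1 * h p) 2 := fun i =>
    memLp_mul_of_bound (hβi i) (hβb i) hh2
  have test_bound : ∀ {φ : Phase d → ℝ}, IsTestFunction φ →
      ∃ K, AEStronglyMeasurable φ ∧ ∀ᵐ p, ‖φ p‖ ≤ K := fun hφ =>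
    ⟨_, hφ.continuous.aestronglyMeasurable, Eventually.of_forall hφ.exists_bound.choose_spec⟩
  have hg := tendstoL2_mollify hh2 hκ hκ0 hκ1 hκs
  have hχg : TendstoL2 (fun n p => χ p * mollify h (κ n) p) (fun p => χ p * h p) := by
    obtain ⟨K, h1, h2⟩ := test_bound hχ
    exact hg.mul_left h1 h2
  have hχW : TendstoL2 (fun n p => χ p * mollify (fun q => V q * h q) (κ n) p)
      (fun p => χ p * (V p * h p)) := by
    obtain ⟨K, h1, h2⟩ := test_bound hχ
    exact (tendstoL2_mollify hV2 hκ hκ0 hκ1 hκs).mul_left h1 h2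
  have hDg : ∀ i, TendstoL2 (fun n p => fderiv ℝ χ p (vDir i) * mollify h (κ n) p)
      (fun p => fderiv ℝ χ p (vDir i) * h p) := by
    intro i
    obtain ⟨K, h1, h2⟩ := test_bound (hχ.fderiv_apply (vDir i))
    exact hg.mul_left h1 h2
  have hXg : ∀ i, TendstoL2
      (fun n p => vCoord i p * χ p * fderiv ℝ χ p (xDir i) * mollify h (κ n) p)
      (fun p => vCoord i p * χ p * fderiv ℝ χ p (xDir i) * h p) := by
    intro i
    obtain ⟨K, h1, h2⟩ := test_bound
      ((hχ.fderiv_apply (xDir i)).mul_left ((vCoord i).contDiff.mul hχ.1))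
    exact hg.mul_left h1 h2
  have hBg : ∀ i, TendstoL2
      (fun n p => β i p.1 * (χ p * fderiv ℝ χ p (vDir i)) * mollify h (κ n) p)
      (fun p => β i p.1 * (χ p * fderiv ℝ χ p (vDir i)) * h p) := by
    intro i
    obtain ⟨K, h1, h2⟩ := test_bound ((hχ.fderiv_apply (vDir i)).mul_left hχ.1)
    refine hg.mul_left (C := C * K) ((hβi i).mul h1) ?_
    filter_upwards [hβb i, h2] with p hp1 hp2
    rw [norm_mul]
    exact mul_le_mul hp1 hp2 (norm_nonneg _) ((norm_nonneg _).trans hp1)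
  -- Both `β h` mollified and `β` times the mollified `h` converge to `β h`, so no regularity of `β`
  -- is needed.
  have hErr : ∀ i, TendstoL2 (fun n p => χ p * (mollify (fun q => β i q.1 * h q) (κ n) p
      - β i p.1 * mollify h (κ n) p)) (fun _ => 0) := by
    intro i
    obtain ⟨K, h1, h2⟩ := test_bound hχ
    have := ((tendstoL2_mollify (hβh i) hκ hκ0 hκ1 hκs).sub (hg.mul_left (hβi i) (hβb i))).mul_left
      h1 h2
    simpa only [sub_self, mul_zero] using this
  -- The transport commutator vanishes because of the anisotropy of the kernels.
  have hr : ∀ i, TendstoL2 (fun n p => χ p *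
      mollify h (fun z => vCoord i z * fderiv ℝ (κ n) z (xDir i)) p) (fun _ => 0) := by
    intro i
    have hk : ∀ n, IsTestFunction fun z => vCoord i z * fderiv ℝ (κ n) z (xDir i) := fun n =>
      ((hκ n).fderiv_apply _).mul_left (vCoord i).contDiff
    have h0 := tendstoL2_mollify_zero hh2 hk (hκv i)
    obtain ⟨K, h1, h2⟩ := test_bound hχ
    simpa only [mul_zero] using h0.mul_left h1 h2
  -- The kernels are supported in the unit ball, so the mollified test function stays inside `B`,
  -- where the weak equation is assumed.
  have hstep := fun n => energy_inequality_mollify (h := h) (V := V) (χ := χ) (κ := κ n) (s := s)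
    hβm hβC hh hV hv hχ (hκ n) (hκe n) (hweak _ (isTestFunction_mollify (by
      have := (hχ.mul_left (contDiff_mollify hh.locallyIntegrable (hκ n))).mul_left hχ.1
      simpa only [mul_comm] using this) (hκ n)) (by
        intro p hp
        by_contra hcon
        refine hp ?_
        rw [mollify_apply]
        refine integral_eq_zero_of_ae (Eventually.of_forall fun q => ?_)
        by_cases hq : χ q = 0
        · simp [hq]
        · by_cases hz : κ n (p - q) = 0
          · simp [hz]
          · exfalso
            refine hcon ?_
            have := hB q (p - q) hq ((hκs n _ hz).trans ?_)
            · simpa using this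
            · rw [div_le_one (by positivity)]
              linarith [(Nat.cast_nonneg n : (0 : ℝ) ≤ n)]))
  refine le_of_tendsto' (x := (atTop : Filter ℕ)) ?_ hstep
  refine (hχW.tendsto_integral_mul hχg).add (tendsto_finsetSum _ fun i _ => ?_)
  have t1 := (hXg i).tendsto_integral_mul hg
  have t2 := (hr i).tendsto_integral_mul hχg
  have t3 := (hBg i).tendsto_integral_mul hg
  have t4 := ((hErr i).tendsto_integral_mul (hErr i)).const_mul (1 / 4)
  have t5 := (hErr i).tendsto_integral_mul (hDg i)
  have t6 := (hDg i).tendsto_integral_mul (hDg i)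
  have := (((((t1.add t2).const_mul s).sub t3).sub t4).sub t5).sub t6
  simpa only [zero_mul, integral_zero, add_zero, mul_zero, sub_zero] using this

/-- All cut-offs are dilations of a single bump, which makes `L` independent of the radius `a`. -/
theorem exists_cutoff (d : ℕ) : ∃ L : ℝ, 0 ≤ L ∧ ∀ a : ℝ, 0 < a → ∃ η : Rd d → ℝ,
    IsTestFunction η ∧ (∀ x, 0 ≤ η x ∧ η x ≤ 1) ∧ (∀ x, ‖x‖ ≤ a → η x = 1) ∧
    (∀ x, η x ≠ 0 → ‖x‖ ≤ 2 * a) ∧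
    ∀ x i, |fderiv ℝ η x (EuclideanSpace.single i 1)| ≤ L / a := by
  let b : ContDiffBump (0 : Rd d) := ⟨1, 2, by norm_num, by norm_num⟩
  have hb : IsTestFunction (b : Rd d → ℝ) := ⟨b.contDiff, b.hasCompactSupport⟩
  have hbound : ∀ i, ∃ C, ∀ x, ‖fderiv ℝ b x (EuclideanSpace.single i 1)‖ ≤ C := fun i =>
    (hb.fderiv_apply _).exists_bound
  choose C hC using hbound
  have hC0 : ∀ i, 0 ≤ C i := fun i => (norm_nonneg _).trans (hC i 0)
  refine ⟨∑ i, C i, Finset.sum_nonneg fun i _ => hC0 i, fun a ha => ?_⟩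
  refine ⟨fun x => b (a⁻¹ • x), ⟨b.contDiff.comp (contDiff_const_smul _), ?_⟩,
    fun x => ⟨b.nonneg, b.le_one⟩, fun x hx => ?_, fun x hx => ?_, fun x i => ?_⟩
  · exact b.hasCompactSupport.comp_smul (inv_ne_zero ha.ne')
  · refine b.one_of_mem_closedBall ?_
    rw [mem_closedBall_zero_iff, norm_smul, norm_inv, Real.norm_of_nonneg ha.le, inv_mul_eq_div]
    exact (div_le_one ha).2 hx
  · have h1 : a⁻¹ • x ∈ Function.support (b : Rd d → ℝ) := hx
    rw [b.support_eq, mem_ball_zero_iff, norm_smul, norm_inv, Real.norm_of_nonneg ha.le,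
      inv_mul_eq_div, div_lt_iff₀ ha] at h1
    exact h1.le
  · have h1 : HasFDerivAt (fun x : Rd d => b (a⁻¹ • x))
        ((fderiv ℝ b (a⁻¹ • x)).comp (a⁻¹ • ContinuousLinearMap.id ℝ (Rd d))) x :=
      (hb.differentiable (a⁻¹ • x)).hasFDerivAt.comp x ((hasFDerivAt_id x).const_smul a⁻¹)
    rw [h1.fderiv]
    have h2 : ((fderiv ℝ b (a⁻¹ • x)).comp (a⁻¹ • ContinuousLinearMap.id ℝ (Rd d)))
        (EuclideanSpace.single i 1) = a⁻¹ * fderiv ℝ b (a⁻¹ • x) (EuclideanSpace.single i 1) := by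
      simp
    rw [h2, abs_mul, abs_inv, abs_of_pos ha, inv_mul_eq_div]
    gcongr
    exact (hC i _).trans (Finset.single_le_sum (fun i _ => hC0 i) (Finset.mem_univ i))

/-- The topological support is needed: derivatives at a point see a whole neighbourhood. -/
theorem flatOp_eq_zero_of_notMem {V ψ : Phase d → ℝ} {β : Fin d → Rd d → ℝ} {s : ℝ}
    {p : Phase d} (hp : p ∉ tsupport ψ) : flatOp V β s ψ p = 0 := by
  have h0 : ψ =ᶠ[𝓝 p] fun _ => 0 := notMem_tsupport_iff_eventuallyEq.1 hp
  have h1 : ∀ e, (fun q => fderiv ℝ ψ q e) =ᶠ[𝓝 p] fun _ => 0 := by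
    intro e
    filter_upwards [h0.eventuallyEq_nhds] with q hq
    rw [hq.fderiv_eq]
    simp
  have h2 : ∀ e, fderiv ℝ ψ p e = 0 := fun e => (h1 e).self_of_nhds
  have h3 : ∀ e, fderiv ℝ (fun q => fderiv ℝ ψ q e) p e = 0 := fun e => by
    rw [(h1 e).fderiv_eq]
    simp
  simp [flatOp, h2, h3, h0.self_of_nhds]

theorem MemLp.integrable_of_forall_notMem {f : Phase d → ℝ} (hf : MemLp f 2)
    {B : Set (Phase d)} (hB : IsCompact B) (h0 : ∀ p ∉ B, f p = 0) : Integrable f := by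
  have h1 : IntegrableOn f B := by
    have : IsFiniteMeasure ((volume : Measure (Phase d)).restrict B) :=
      ⟨by rw [Measure.restrict_apply_univ]; exact hB.measure_lt_top⟩
    exact (hf.restrict B).integrable (by norm_num)
  refine (integrableOn_iff_integrable_of_support_subset ?_).1 h1
  intro p hp
  by_contra hcon
  exact hp (h0 p hcon)

/-- The localised `L²` estimate obtained from the energy inequality with product cut-offs. -/
theorem flat_cutoff_estimate {h : Phase d → ℝ} (hh : MemLp h 2) {β : Fin d → Rd d → ℝ}
    (hβm : ∀ i, AEStronglyMeasurable (β i)) {c s L C a b : ℝ}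
    (hweak : ∀ ψ, IsTestFunction ψ →
      ∫ p, h p * flatOp (fun p => c + ‖p.2‖ ^ 2 / 4) β s ψ p = 0)
    {ξ ζ : Rd d → ℝ} (hξ : IsTestFunction ξ) (hζ : IsTestFunction ζ)
    (hξ1 : ∀ x, 0 ≤ ξ x ∧ ξ x ≤ 1) (hζ1 : ∀ x, 0 ≤ ζ x ∧ ζ x ≤ 1)
    (hξs : ∀ x, ξ x ≠ 0 → ‖x‖ ≤ 2 * a) (hζs : ∀ x, ζ x ≠ 0 → ‖x‖ ≤ 2 * b)
    (hξd : ∀ x i, |fderiv ℝ ξ x (EuclideanSpace.single i 1)| ≤ L / a)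
    (hζd : ∀ x i, |fderiv ℝ ζ x (EuclideanSpace.single i 1)| ≤ L / b)
    (hC : 0 ≤ C) (hβC : ∀ i, ∀ᵐ x, ‖x‖ ≤ 2 * a + 1 → ‖β i x‖ ≤ C) :
    c * ∫ p : Phase d, (ξ p.1 * ζ p.2 * h p) ^ 2
      ≤ d * (s ^ 2 * (L / a) ^ 2 + C * (L / b) + (L / b) ^ 2) * ∫ p, h p ^ 2 := by
  set B : Set (Phase d) := Metric.closedBall 0 (2 * a + 1) ×ˢ Metric.closedBall 0 (2 * b + 1)
    with hBdef
  have hBc : IsCompact B := (isCompact_closedBall _ _).prod (isCompact_closedBall _ _)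
  have hBm : MeasurableSet B := hBc.measurableSet
  set χ : Phase d → ℝ := fun p => ξ p.1 * ζ p.2 with hχdef
  have hχ : IsTestFunction χ := isTestFunction_comp_fst_mul_comp_snd hξ hζ
  -- Truncation of `h` and `β` to a set containing the unit neighbourhood of the support of `χ`
  -- gives integrability against polynomial weights and a global bound on the coefficient. The weak
  -- equation survives for test functions supported there.
  set h₀ : Phase d → ℝ := B.indicator h with hh₀
  set β₀ : Fin d → Rd d → ℝ := fun i => (Metric.closedBall (0 : Rd d) (2 * a + 1)).indicator (β i)
    with hβ₀
  set V : Phase d → ℝ := fun p => c + ‖p.2‖ ^ 2 / 4 with hVdef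
  have hVc : Continuous V := by fun_prop
  have h₀2 : MemLp h₀ 2 := hh.indicator hBm
  have h₀1 : Integrable h₀ := MemLp.integrable_of_forall_notMem h₀2 hBc fun p hp =>
    Set.indicator_of_notMem hp _
  have hcont : ∀ {F : Phase d → ℝ}, Continuous F → MemLp (fun p => F p * h₀ p) 2 ∧
      Integrable fun p => F p * h₀ p := by
    intro F hF
    obtain ⟨K, hK⟩ := hBc.exists_bound_of_continuousOn hF.continuousOn
    have h1 : MemLp (fun p => F p * h₀ p) 2 := by
      refine MemLp.of_le_mul (c := K) h₀2 (hF.aestronglyMeasurable.mul h₀2.1)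
        (Eventually.of_forall fun p => ?_)
      by_cases hp : p ∈ B
      · rw [norm_mul]
        gcongr
        exact hK p hp
      · simp [hh₀, Set.indicator_of_notMem hp]
    exact ⟨h1, MemLp.integrable_of_forall_notMem h1 hBc fun p hp => by
      simp [hh₀, Set.indicator_of_notMem hp]⟩
  have hβ₀m : ∀ i, AEStronglyMeasurable (β₀ i) := fun i =>
    (hβm i).indicator Metric.isClosed_closedBall.measurableSet
  have hβ₀C : ∀ i, ∀ᵐ x, ‖β₀ i x‖ ≤ C := by
    intro i
    filter_upwards [hβC i] with x hx
    by_cases hxB : x ∈ Metric.closedBall (0 : Rd d) (2 * a + 1)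
    · rw [hβ₀]
      simp only [Set.indicator_of_mem hxB]
      exact hx (by simpa using hxB)
    · rw [hβ₀]
      simpa only [Set.indicator_of_notMem hxB, norm_zero] using hC
  have hBχ : ∀ p z, χ p ≠ 0 → ‖z‖ ≤ 1 → p + z ∈ B := by
    intro p z hp hz
    have e1 := hξs _ (left_ne_zero_of_mul hp)
    have e2 := hζs _ (right_ne_zero_of_mul hp)
    refine ⟨?_, ?_⟩
    · rw [mem_closedBall_zero_iff]
      exact (norm_add_le _ _).trans (add_le_add e1 ((norm_fst_le z).trans hz))
    · rw [mem_closedBall_zero_iff]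
      exact (norm_add_le _ _).trans (add_le_add e2 ((norm_snd_le z).trans hz))
  have hen := energy_inequality (h := h₀) (V := V) (χ := χ) (β := β₀) (s := s) hβ₀m hβ₀C h₀1 h₀2
    (hcont hVc).2 (hcont hVc).1 (fun i => (hcont (vCoord i).continuous).2) hχ hBχ (by
      intro ψ hψ hψB
      rw [← hweak ψ hψ]
      congr 1
      ext p
      by_cases hp : p ∈ B
      · have e1 : h₀ p = h p := Set.indicator_of_mem hp _
        have e2 : ∀ i, β₀ i p.1 = β i p.1 := fun i => Set.indicator_of_mem hp.1 _
        simp only [flatOp, e1, e2, hVdef]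
      · have hpt : p ∉ tsupport ψ := fun hpt =>
          hp (closure_minimal (fun q hq => hψB q hq) hBc.isClosed hpt)
        rw [flatOp_eq_zero_of_notMem hpt, flatOp_eq_zero_of_notMem hpt, mul_zero, mul_zero])
  have hDx : ∀ i p, |fderiv ℝ χ p (xDir i)| ≤ L / a := by
    intro i p
    rw [hχdef, fderiv_comp_fst_mul_comp_snd hξ.differentiable hζ.differentiable]
    simp only [xDir, map_zero, mul_zero, add_zero, abs_mul]
    rw [abs_of_nonneg (hζ1 p.2).1]
    exact (mul_le_of_le_one_right (abs_nonneg _) (hζ1 p.2).2).trans (hξd _ i)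
  have hDv : ∀ i p, |fderiv ℝ χ p (vDir i)| ≤ L / b := by
    intro i p
    rw [hχdef, fderiv_comp_fst_mul_comp_snd hξ.differentiable hζ.differentiable]
    simp only [vDir, map_zero, zero_mul, zero_add, abs_mul]
    rw [abs_of_nonneg (hξ1 p.1).1]
    exact (mul_le_of_le_one_left (abs_nonneg _) (hξ1 p.1).2).trans (hζd _ i)
  have hχ1 : ∀ p, 0 ≤ χ p ∧ χ p ≤ 1 := fun p =>
    ⟨mul_nonneg (hξ1 _).1 (hζ1 _).1, mul_le_one₀ (hξ1 _).2 (hζ1 _).1 (hζ1 _).2⟩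
  have hsq : ∀ {F : Phase d → ℝ} {K : ℝ}, AEStronglyMeasurable F → (∀ᵐ p, ‖F p‖ ≤ K) →
      Integrable fun p => F p * h₀ p * h₀ p := by
    intro F K hF hK
    have h1 := memLp_mul_of_bound hF hK h₀2
    exact MemLp.integrable_mul h1 h₀2
  have hχ0 : ∀ p ∉ B, χ p = 0 := by
    intro p hp
    by_contra hcon
    exact hp (by simpa using hBχ p 0 hcon (by simp))
  have hχh : ∀ p, χ p * h₀ p = χ p * h p := by
    intro p
    by_cases hp : p ∈ B
    · rw [hh₀, Set.indicator_of_mem hp]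
    · rw [hχ0 p hp, zero_mul, zero_mul]
  -- integrability of all terms
  have test_bound : ∀ {φ : Phase d → ℝ}, IsTestFunction φ →
      ∃ K, AEStronglyMeasurable φ ∧ ∀ᵐ p, ‖φ p‖ ≤ K := fun hφ =>
    ⟨_, hφ.continuous.aestronglyMeasurable, Eventually.of_forall hφ.exists_bound.choose_spec⟩
  have I1 : Integrable fun p => (χ p * (V p * h₀ p)) * (χ p * h₀ p) := by
    obtain ⟨K, h1, h2⟩ := test_bound hχ
    exact MemLp.integrable_mul (memLp_mul_of_bound h1 h2 (hcont hVc).1)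
      (memLp_mul_of_bound h1 h2 h₀2)
  have I2 : ∀ i, Integrable fun p =>
      (vCoord i p * χ p * fderiv ℝ χ p (xDir i) * h₀ p) * h₀ p := by
    intro i
    obtain ⟨K, h1, h2⟩ := test_bound
      ((hχ.fderiv_apply (xDir i)).mul_left ((vCoord i).contDiff.mul hχ.1))
    exact hsq h1 h2
  have I3 : ∀ i, Integrable fun p : Phase d =>
      (β₀ i p.1 * (χ p * fderiv ℝ χ p (vDir i)) * h₀ p) * h₀ p := by
    intro i
    obtain ⟨K, h1, h2⟩ := test_bound ((hχ.fderiv_apply (vDir i)).mul_left hχ.1)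
    refine hsq (K := C * K) ((aestronglyMeasurable_comp_fst (hβ₀m i)).mul h1) ?_
    filter_upwards [ae_comp_fst (hβ₀C i), h2] with p hp1 hp2
    rw [norm_mul]
    exact mul_le_mul hp1 hp2 (norm_nonneg _) hC
  have I4 : ∀ i, Integrable fun p =>
      (fderiv ℝ χ p (vDir i) * h₀ p) * (fderiv ℝ χ p (vDir i) * h₀ p) := by
    intro i
    obtain ⟨K, h1, h2⟩ := test_bound (hχ.fderiv_apply (vDir i))
    exact MemLp.integrable_mul (memLp_mul_of_bound h1 h2 h₀2) (memLp_mul_of_bound h1 h2 h₀2)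
  have I23 : ∀ i, Integrable fun p : Phase d =>
      s * ((vCoord i p * χ p * fderiv ℝ χ p (xDir i) * h₀ p) * h₀ p)
        - (β₀ i p.1 * (χ p * fderiv ℝ χ p (vDir i)) * h₀ p) * h₀ p := fun i =>
    ((I2 i).const_mul s).sub (I3 i)
  have I5 : ∀ i, Integrable fun p : Phase d =>
      s * ((vCoord i p * χ p * fderiv ℝ χ p (xDir i) * h₀ p) * h₀ p)
        - (β₀ i p.1 * (χ p * fderiv ℝ χ p (vDir i)) * h₀ p) * h₀ p
        - (fderiv ℝ χ p (vDir i) * h₀ p) * (fderiv ℝ χ p (vDir i) * h₀ p) := fun i =>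
    (I23 i).sub (I4 i)
  have I6 : Integrable fun p => ∑ i,
      (s * ((vCoord i p * χ p * fderiv ℝ χ p (xDir i) * h₀ p) * h₀ p)
        - (β₀ i p.1 * (χ p * fderiv ℝ χ p (vDir i)) * h₀ p) * h₀ p
        - (fderiv ℝ χ p (vDir i) * h₀ p) * (fderiv ℝ χ p (vDir i) * h₀ p)) :=
    integrable_finsetSum _ fun i _ => I5 i
  have hen' : ∫ p, ((χ p * (V p * h₀ p)) * (χ p * h₀ p) + ∑ i,
      (s * ((vCoord i p * χ p * fderiv ℝ χ p (xDir i) * h₀ p) * h₀ p)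
        - (β₀ i p.1 * (χ p * fderiv ℝ χ p (vDir i)) * h₀ p) * h₀ p
        - (fderiv ℝ χ p (vDir i) * h₀ p) * (fderiv ℝ χ p (vDir i) * h₀ p))) ≤ 0 := by
    rw [integral_add I1 I6, integral_finsetSum _ fun i _ => I5 i]
    refine le_trans (le_of_eq ?_) hen
    congr 1
    refine Finset.sum_congr rfl fun i _ => ?_
    rw [integral_sub (I23 i) (I4 i), integral_sub ((I2 i).const_mul s) (I3 i), integral_const_mul]
  set Q : ℝ := s ^ 2 * (L / a) ^ 2 + C * (L / b) + (L / b) ^ 2 with hQ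
  have hβall : ∀ᵐ p : Phase d, ∀ i, ‖β₀ i p.1‖ ≤ C := ae_all_iff.2 fun i => ae_comp_fst (hβ₀C i)
  have hpt : ∀ᵐ p : Phase d, c * (χ p * h₀ p) ^ 2 - d * Q * h₀ p ^ 2
      ≤ (χ p * (V p * h₀ p)) * (χ p * h₀ p) + ∑ i,
      (s * ((vCoord i p * χ p * fderiv ℝ χ p (xDir i) * h₀ p) * h₀ p)
        - (β₀ i p.1 * (χ p * fderiv ℝ χ p (vDir i)) * h₀ p) * h₀ p
        - (fderiv ℝ χ p (vDir i) * h₀ p) * (fderiv ℝ χ p (vDir i) * h₀ p)) := by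
    filter_upwards [hβall] with p hp
    have hnorm : ‖p.2‖ ^ 2 = ∑ i, vCoord i p ^ 2 := by
      rw [EuclideanSpace.real_norm_sq_eq]
      rfl
    -- Completing the square, `s vᵢ χ X ≥ -χ² vᵢ²/4 - s² X²`: the growth in velocity is exactly what
    -- the `|v|²/4` in the potential pays for.
    have hterm : ∀ i, -(χ p ^ 2 * (vCoord i p) ^ 2 / 4 * h₀ p ^ 2) - Q * h₀ p ^ 2
        ≤ s * ((vCoord i p * χ p * fderiv ℝ χ p (xDir i) * h₀ p) * h₀ p)
        - (β₀ i p.1 * (χ p * fderiv ℝ χ p (vDir i)) * h₀ p) * h₀ p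
        - (fderiv ℝ χ p (vDir i) * h₀ p) * (fderiv ℝ χ p (vDir i) * h₀ p) := by
      intro i
      set X := fderiv ℝ χ p (xDir i)
      set D := fderiv ℝ χ p (vDir i)
      have hX2 : X ^ 2 ≤ (L / a) ^ 2 := by
        rw [← sq_abs X]
        have := hDx i p
        gcongr
      have hD2 : D ^ 2 ≤ (L / b) ^ 2 := by
        rw [← sq_abs D]
        have := hDv i p
        gcongr
      have hβD : β₀ i p.1 * (χ p * D) ≤ C * (L / b) := by
        refine (le_abs_self _).trans ?_
        rw [abs_mul, abs_mul, abs_of_nonneg (hχ1 p).1]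
        refine mul_le_mul (hp i) ?_ (mul_nonneg (hχ1 p).1 (abs_nonneg _)) hC
        exact (mul_le_of_le_one_left (abs_nonneg _) (hχ1 p).2).trans (hDv i p)
      have hsX : s ^ 2 * X ^ 2 ≤ s ^ 2 * (L / a) ^ 2 := by gcongr
      have h1 : 0 ≤ (χ p * vCoord i p / 2 + s * X) ^ 2 := sq_nonneg _
      have h2 : 0 ≤ χ p ^ 2 * vCoord i p ^ 2 / 4 + Q + s * (vCoord i p * χ p * X)
          - β₀ i p.1 * (χ p * D) - D ^ 2 := by
        rw [hQ]
        nlinarith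
      nlinarith [mul_nonneg h2 (sq_nonneg (h₀ p))]
    have hsum := Finset.sum_le_sum fun i (_ : i ∈ Finset.univ) => hterm i
    refine le_trans (le_of_eq ?_) (add_le_add le_rfl hsum)
    rw [Finset.sum_sub_distrib, Finset.sum_neg_distrib, Finset.sum_const, Finset.card_univ,
      Fintype.card_fin, nsmul_eq_mul]
    have : ∑ i, χ p ^ 2 * vCoord i p ^ 2 / 4 * h₀ p ^ 2 = χ p ^ 2 * ‖p.2‖ ^ 2 / 4 * h₀ p ^ 2 := by
      rw [hnorm, Finset.mul_sum, Finset.sum_div, Finset.sum_mul]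
    rw [this, hVdef]
    ring
  have J1 : Integrable fun p => c * (χ p * h₀ p) ^ 2 := by
    obtain ⟨K, h1, h2⟩ := test_bound hχ
    exact (memLp_mul_of_bound h1 h2 h₀2).integrable_sq.const_mul c
  have J2 : Integrable fun p => d * Q * h₀ p ^ 2 := h₀2.integrable_sq.const_mul _
  have hfin := (integral_mono_ae (J1.sub J2) (I1.add I6) hpt).trans hen'
  have hsplit : ∫ p, ((fun p => c * (χ p * h₀ p) ^ 2) - fun p => d * Q * h₀ p ^ 2) p
      = c * (∫ p, (χ p * h₀ p) ^ 2) - d * Q * ∫ p, h₀ p ^ 2 := by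
    simp only [Pi.sub_apply]
    rw [integral_sub J1 J2, integral_const_mul, integral_const_mul]
  rw [hsplit] at hfin
  simp only [hχh] at hfin
  -- No sign is assumed for `L / b`; for `d > 0` it follows from the derivative bound, and for `d =
  -- 0` the product is zero.
  have hQ0 : 0 ≤ d * Q := by
    rcases Nat.eq_zero_or_pos d with h0 | h0
    · simp [h0]
    · have hLb : 0 ≤ L / b := (abs_nonneg _).trans (hζd 0 ⟨0, h0⟩)
      positivity
  have hmono : ∫ p, h₀ p ^ 2 ≤ ∫ p, h p ^ 2 := by
    refine integral_mono h₀2.integrable_sq hh.integrable_sq fun p => ?_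
    by_cases hp : p ∈ B
    · simp [hh₀, Set.indicator_of_mem hp]
    · simpa [hh₀, Set.indicator_of_notMem hp] using sq_nonneg (h p)
  calc c * ∫ p, (χ p * h p) ^ 2 ≤ d * Q * ∫ p, h₀ p ^ 2 := by linarith
    _ ≤ d * Q * ∫ p, h p ^ 2 := by gcongr

/-- Square-integrable weak solutions of the conjugated kinetic equation vanish. -/
theorem flat_uniqueness {h : Phase d → ℝ} (hh : MemLp h 2) {β : Fin d → Rd d → ℝ}
    (hβm : ∀ i, AEStronglyMeasurable (β i))
    (hβloc : ∀ R : ℝ, ∃ C : ℝ, 0 ≤ C ∧ ∀ i, ∀ᵐ x, ‖x‖ ≤ R → ‖β i x‖ ≤ C) {c s : ℝ} (hc : 0 < c)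
    (hweak : ∀ ψ, IsTestFunction ψ →
      ∫ p, h p * flatOp (fun p => c + ‖p.2‖ ^ 2 / 4) β s ψ p = 0) : ∀ᵐ p, h p = 0 := by
  obtain ⟨L, hL, hcut⟩ := exists_cutoff d
  set I := ∫ p, h p ^ 2 with hI
  have hI0 : 0 ≤ I := integral_nonneg fun p => sq_nonneg _
  have key : ∀ R : ℝ, 0 < R → ∫ p in Metric.closedBall (0 : Phase d) R, h p ^ 2 ≤ 0 := by
    intro R hR
    have hlocal : ∀ a b : ℝ, R ≤ a → R ≤ b → ∀ C : ℝ, 0 ≤ C →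
        (∀ i, ∀ᵐ x, ‖x‖ ≤ 2 * a + 1 → ‖β i x‖ ≤ C) →
        c * ∫ p in Metric.closedBall (0 : Phase d) R, h p ^ 2
          ≤ d * (s ^ 2 * (L / a) ^ 2 + C * (L / b) + (L / b) ^ 2) * I := by
      intro a b ha hb C hC hβC
      obtain ⟨ξ, hξ, hξ1, hξe, hξs, hξd⟩ := hcut a (hR.trans_le ha)
      obtain ⟨ζ, hζ, hζ1, hζe, hζs, hζd⟩ := hcut b (hR.trans_le hb)
      refine le_trans ?_ (flat_cutoff_estimate hh hβm hweak hξ hζ hξ1 hζ1 hξs hζs hξd hζd hC hβC)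
      gcongr
      have hmem : MemLp (fun p : Phase d => ξ p.1 * ζ p.2 * h p) 2 := by
        have ht := isTestFunction_comp_fst_mul_comp_snd hξ hζ
        exact memLp_mul_of_bound ht.continuous.aestronglyMeasurable
          (Eventually.of_forall ht.exists_bound.choose_spec) hh
      refine le_trans (le_of_eq (setIntegral_congr_fun
        Metric.isClosed_closedBall.measurableSet fun p hp => ?_))
        (setIntegral_le_integral hmem.integrable_sq (Eventually.of_forall fun p => sq_nonneg _))
      have hp' : ‖p‖ ≤ R := by simpa using hp
      simp only [hξe p.1 ((norm_fst_le p).trans (hp'.trans ha)),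
        hζe p.2 ((norm_snd_le p).trans (hp'.trans hb)), one_mul]
    -- The order of limits matters: `C` bounds `β` on a ball depending on `a`, so `b → ∞` is taken
    -- at fixed `a`, killing `C L / b`, before `a → ∞`.
    have hlim1 : ∀ a : ℝ, R ≤ a → c * ∫ p in Metric.closedBall (0 : Phase d) R, h p ^ 2
        ≤ d * (s ^ 2 * (L / a) ^ 2) * I := by
      intro a ha
      obtain ⟨C, hC, hβC⟩ := hβloc (2 * a + 1)
      have hLb : Tendsto (fun b : ℝ => L / b) atTop (𝓝 0) := tendsto_const_nhds.div_atTop tendsto_id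
      have ht := (((hLb.const_mul C).const_add (s ^ 2 * (L / a) ^ 2)).add
        (hLb.pow 2)).const_mul (d : ℝ) |>.mul_const I
      simp only [mul_zero, add_zero, ne_eq, OfNat.ofNat_ne_zero, not_false_eq_true, zero_pow] at ht
      refine ge_of_tendsto ht ?_
      filter_upwards [eventually_ge_atTop R] with b hb
      exact hlocal a b ha hb C hC hβC
    have hLa : Tendsto (fun a : ℝ => L / a) atTop (𝓝 0) := tendsto_const_nhds.div_atTop tendsto_id
    have ht := (((hLa.pow 2).const_mul (s ^ 2)).const_mul (d : ℝ)).mul_const I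
    simp only [mul_zero, ne_eq, OfNat.ofNat_ne_zero, not_false_eq_true, zero_pow, zero_mul] at ht
    have h0 : c * ∫ p in Metric.closedBall (0 : Phase d) R, h p ^ 2 ≤ 0 :=
      ge_of_tendsto ht (by filter_upwards [eventually_ge_atTop R] with a ha using hlim1 a ha)
    exact nonpos_of_mul_nonpos_right h0 hc
  have hae : ∀ n : ℕ, ∀ᵐ p, p ∈ Metric.closedBall (0 : Phase d) ((n : ℝ) + 1) → h p = 0 := by
    intro n
    have h1 : ∫ p in Metric.closedBall (0 : Phase d) ((n : ℝ) + 1), h p ^ 2 = 0 :=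
      le_antisymm (key _ (by positivity)) (integral_nonneg fun p => sq_nonneg _)
    have h2 := (integral_eq_zero_iff_of_nonneg (fun p => sq_nonneg (h p))
      hh.integrable_sq.integrableOn).1 h1
    have h3 := (ae_restrict_iff' Metric.isClosed_closedBall.measurableSet).1 h2
    filter_upwards [h3] with p hp hpB
    simpa using hp hpB
  filter_upwards [ae_all_iff.2 hae] with p hp
  obtain ⟨n, hn⟩ := exists_nat_ge ‖p‖
  refine hp n ?_
  rw [mem_closedBall_zero_iff]
  linarith

end FlatUniqueness

/-! ### Operators given on a core: closure, adjoint and abstract well-posedness -/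

section Core

variable {H : Type*} [NormedAddCommGroup H] [InnerProductSpace ℝ H] [CompleteSpace H]
  {D : Type*} [AddCommGroup D] [Module ℝ D]

/-- The closure of the graph of the operator `j φ ↦ a φ`. -/
def closedGraph (j a : D →ₗ[ℝ] H) : Submodule ℝ (H × H) :=
  (LinearMap.range (j.prod a)).topologicalClosure

variable {j a b m n : D →ₗ[ℝ] H}

theorem mem_closedGraph (j a : D →ₗ[ℝ] H) (φ : D) : (j φ, a φ) ∈ closedGraph j a :=
  Submodule.le_topologicalClosure _ ⟨φ, rfl⟩

theorem closedGraph_induction {P : H × H → Prop} (hP : IsClosed {p | P p})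
    (h : ∀ φ, P (j φ, a φ)) {p : H × H} (hp : p ∈ closedGraph j a) : P p := by
  refine closure_minimal (s := (LinearMap.range (j.prod a) : Set (H × H))) (t := {p | P p}) ?_ hP hp
  rintro _ ⟨φ, rfl⟩
  exact h φ

theorem closedGraph_dissipative (hdiss : ∀ φ, inner ℝ (j φ) (a φ) ≤ 0) {p : H × H}
    (hp : p ∈ closedGraph j a) : inner ℝ p.1 p.2 ≤ 0 :=
  closedGraph_induction (P := fun p => inner ℝ p.1 p.2 ≤ 0)
    (isClosed_le (by fun_prop) continuous_const) hdiss hp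

/-- If the range of `l - a` is dense and `a` is dissipative, then `l - ā` is onto. -/
theorem exists_mem_closedGraph (hdiss : ∀ φ, inner ℝ (j φ) (a φ) ≤ 0) {l : ℝ} (hl : 0 < l)
    (hrange : ∀ f : H, (∀ φ, inner ℝ f (l • j φ - a φ) = 0) → f = 0) (y : H) :
    ∃ x, (x, l • x - y) ∈ closedGraph j a := by
  set r : D →ₗ[ℝ] H := l • j - a with hr
  have htop : (LinearMap.range r).topologicalClosure = ⊤ := by
    rw [Submodule.topologicalClosure_eq_top_iff, Submodule.eq_bot_iff]
    intro f hf
    refine hrange f fun φ => ?_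
    rw [real_inner_comm]
    exact (Submodule.mem_orthogonal _ f).1 hf (r φ) ⟨φ, rfl⟩
  have hy : y ∈ closure (LinearMap.range r : Set H) := by
    have : y ∈ (LinearMap.range r).topologicalClosure := htop ▸ Submodule.mem_top
    exact this
  obtain ⟨w, hw, hwy⟩ := mem_closure_iff_seq_limit.1 hy
  choose φ hφ using hw
  -- The resolvent estimate makes preimages of a convergent sequence Cauchy, so the range of the
  -- closure is closed.
  have hbound : ∀ k k', dist (j (φ k)) (j (φ k')) ≤ l⁻¹ * dist (w k) (w k') := by
    intro k k'
    have h1 := mul_norm_le_of_dissipative (hdiss (φ k - φ k')) l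
    have h2 : l • j (φ k - φ k') - a (φ k - φ k') = w k - w k' := by
      rw [← hφ k, ← hφ k', ← map_sub, hr]
      rfl
    rw [h2, map_sub] at h1
    rw [dist_eq_norm, dist_eq_norm, inv_mul_eq_div, le_div_iff₀ hl, mul_comm]
    exact h1
  have hcauchy : CauchySeq fun k => j (φ k) := by
    have hw' := hwy.cauchySeq
    rw [Metric.cauchySeq_iff'] at hw' ⊢
    intro ε hε
    obtain ⟨N, hN⟩ := hw' (l * ε) (by positivity)
    refine ⟨N, fun k hk => (hbound k N).trans_lt ?_⟩
    rw [inv_mul_eq_div, div_lt_iff₀ hl, mul_comm]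
    exact hN k hk
  obtain ⟨x, hx⟩ := cauchySeq_tendsto_of_complete hcauchy
  refine ⟨x, ?_⟩
  have ha : Tendsto (fun k => a (φ k)) atTop (𝓝 (l • x - y)) := by
    refine ((hx.const_smul l).sub hwy).congr fun k => ?_
    rw [← hφ k, hr]
    simp
  exact (Submodule.isClosed_topologicalClosure _).mem_of_tendsto (hx.prodMk_nhds ha)
    (Eventually.of_forall fun k => mem_closedGraph j a (φ k))

theorem closedGraph_isMaximalDissipative (hdense : DenseRange j)
    (hdiss : ∀ φ, inner ℝ (j φ) (a φ) ≤ 0) {l₀ : ℝ} (hl₀ : 0 < l₀)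
    (hrange : ∀ l ≥ l₀, ∀ f : H, (∀ φ, inner ℝ f (l • j φ - a φ) = 0) → f = 0) :
    IsMaximalDissipative (closedGraph j a) where
  dissipative _ hp := closedGraph_dissipative hdiss hp
  dense_domain := hdense.mono (by
    rintro _ ⟨φ, rfl⟩
    exact ⟨_, mem_closedGraph j a φ, rfl⟩)
  range_eq := ⟨l₀, fun l hl y => by
    obtain ⟨x, hx⟩ := exists_mem_closedGraph hdiss (hl₀.trans_le hl) (hrange l hl) y
    exact ⟨_, hx, sub_sub_cancel _ _⟩⟩

theorem closedGraph_le_adjoint (hadj : ∀ φ ψ, inner ℝ (a φ) (j ψ) = inner ℝ (j φ) (b ψ)) :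
    closedGraph j b ≤ (closedGraph j a).adjoint := by
  intro q hq
  rw [Submodule.mem_adjoint_iff]
  intro x y hxy
  refine closedGraph_induction (P := fun p : H × H => inner ℝ p.2 q.1 - inner ℝ p.1 q.2 = 0)
    (isClosed_eq (by fun_prop) continuous_const) (fun φ => ?_) hxy
  refine closedGraph_induction (P := fun q : H × H => inner ℝ (a φ) q.1 - inner ℝ (j φ) q.2 = 0)
    (isClosed_eq (by fun_prop) continuous_const) (fun ψ => ?_) hq
  rw [hadj, sub_self]

/-- The formal adjoint `b` is a core of the adjoint of `ā`. -/
theorem adjoint_closedGraph_le (hadj : ∀ φ ψ, inner ℝ (a φ) (j ψ) = inner ℝ (j φ) (b ψ))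
    (hdiss : ∀ φ, inner ℝ (j φ) (b φ) ≤ 0) {l : ℝ} (hl : 0 < l)
    (hrange : ∀ f : H, (∀ φ, inner ℝ f (l • j φ - a φ) = 0) → f = 0)
    (hrange' : ∀ f : H, (∀ φ, inner ℝ f (l • j φ - b φ) = 0) → f = 0) :
    (closedGraph j a).adjoint ≤ closedGraph j b := by
  intro z hz
  -- `(l - b̄) x = (l - A†) z` is solved in the closure of `b`. As `b̄` is contained in `A†`, the
  -- difference `x - z` lies in the kernel of `l - A†`, which is the orthogonal complement of the
  -- range of `l - a`, hence zero.
  obtain ⟨x, hx⟩ := exists_mem_closedGraph hdiss hl hrange' (l • z.1 - z.2)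
  have hsub := Submodule.sub_mem _ (closedGraph_le_adjoint hadj hx) hz
  have h0 : x - z.1 = 0 := by
    refine hrange _ fun φ => ?_
    have h1 := (Submodule.mem_adjoint_iff _ _).1 hsub _ _ (mem_closedGraph j a φ)
    have h2 : ((x, l • x - (l • z.1 - z.2)) - z : H × H) = (x - z.1, l • (x - z.1)) := by
      refine Prod.ext rfl ?_
      simp only [Prod.snd_sub, smul_sub]
      abel
    rw [h2] at h1
    rw [inner_sub_right, real_inner_smul_right, real_inner_comm _ (x - z.1),
      real_inner_comm _ (x - z.1)]
    rw [real_inner_smul_right] at h1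
    linarith
  rw [sub_eq_zero] at h0
  have h3 : z = (x, l • x - (l • z.1 - z.2)) := Prod.ext h0.symm (by simp [h0])
  rw [h3]
  exact hx

/-- Well-posedness of `y' = ā y + u N y` for an operator `a` with core `D` whose formal adjoint `b`
controls the formal adjoint `m` of the control operator `n`. -/
theorem wellPosed_of_core (hdense : DenseRange j)
    (hdiss : ∀ φ, inner ℝ (j φ) (a φ) ≤ 0) (hdiss' : ∀ φ, inner ℝ (j φ) (b φ) ≤ 0)
    (hadj : ∀ φ ψ, inner ℝ (a φ) (j ψ) = inner ℝ (j φ) (b ψ)) {l₀ : ℝ} (hl₀ : 0 < l₀)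
    (hrange : ∀ l ≥ l₀, ∀ f : H, (∀ φ, inner ℝ f (l • j φ - a φ) = 0) → f = 0)
    (hrange' : ∀ f : H, (∀ φ, inner ℝ f (l₀ • j φ - b φ) = 0) → f = 0)
    (hnm : ∀ φ ψ, inner ℝ (n φ) (j ψ) = inner ℝ (j φ) (m ψ)) {C : ℝ} (hC : 0 ≤ C)
    (hm : ∀ φ, ‖m φ‖ ^ 2 ≤ C * -inner ℝ (j φ) (b φ)) :
    (∃! S : C0Semigroup H, IsGenerator (closedGraph j a) S) ∧
    (∃! N : H →L[ℝ] Extrap (closedGraph j a),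
      ∀ φ, N (j φ) = toExtrap (closedGraph j a) (n φ)) ∧
    ∀ (S : C0Semigroup H) (hS : IsGenerator (closedGraph j a) S)
      (N : H →L[ℝ] Extrap (closedGraph j a)),
      (∀ φ, N (j φ) = toExtrap (closedGraph j a) (n φ)) →
      ∀ (T : ℝ) (hT : 0 < T) (y₀ : H) (u : ℝ → ℝ), MemLp u 2 (volume.restrict (Set.Ioo 0 T)) →
        ∃! y : C(Set.Icc (0 : ℝ) T, H), IsMildSolution hS N hT.le y₀ u y := by
  have hA := closedGraph_isMaximalDissipative hdense hdiss hl₀ hrange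
  set A := closedGraph j a with hAdef
  have hle : ∀ φ, (j φ, b φ) ∈ A.adjoint := fun φ =>
    closedGraph_le_adjoint hadj (mem_closedGraph j b φ)
  let e : D →ₗ[ℝ] AdjDomain A := LinearMap.codRestrict A.adjoint (j.prod b) hle
  have hincl : ∀ φ, AdjDomain.incl A (e φ) = (j φ, b φ) := fun φ => rfl
  -- Density in graph norm, which is the core property of the formal adjoint.
  have he : DenseRange e := by
    intro z
    rw [Metric.mem_closure_range_iff]
    intro ε hε
    have hz : (AdjDomain.incl A z) ∈ closure (LinearMap.range (j.prod b) : Set (H × H)) :=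
      adjoint_closedGraph_le hadj hdiss' hl₀ (hrange l₀ le_rfl) hrange' (AdjDomain.incl_mem z)
    obtain ⟨_, ⟨φ, rfl⟩, hφ⟩ := Metric.mem_closure_iff.1 hz ε hε
    refine ⟨φ, ?_⟩
    rw [dist_eq_norm, AdjDomain.norm_eq, map_sub, hincl, ← dist_eq_norm]
    exact hφ
  -- By Cauchy–Schwarz the form `-⟨jφ, bφ⟩` is at most the squared graph norm.
  have hme : ∃ K, ∀ φ, ‖m φ‖ ≤ K * ‖e φ‖ := by
    refine ⟨√C, fun φ => ?_⟩
    refine abs_le_of_sq_le_sq' ?_ (by positivity) |>.2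
    rw [mul_pow, Real.sq_sqrt hC]
    refine (hm φ).trans ?_
    gcongr
    have h1 : ‖j φ‖ ≤ ‖e φ‖ := norm_fst_le (j φ, b φ)
    have h2 : ‖b φ‖ ≤ ‖e φ‖ := norm_snd_le (j φ, b φ)
    calc -inner ℝ (j φ) (b φ) ≤ ‖j φ‖ * ‖b φ‖ := by
          rw [← inner_neg_left, ← norm_neg (j φ)]
          exact real_inner_le_norm _ _
      _ ≤ ‖e φ‖ * ‖e φ‖ := by gcongr
      _ = ‖e φ‖ ^ 2 := (sq _).symm
  set M : AdjDomain A →L[ℝ] H := m.extendOfNorm e with hMdef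
  have hMe : ∀ φ, M (e φ) = m φ := fun φ => LinearMap.extendOfNorm_eq he hme φ
  have hM : ∀ z, ‖M z‖ ^ 2 ≤ C * -inner ℝ (AdjDomain.incl A z).1 (AdjDomain.incl A z).2 := by
    intro z
    refine he.induction_on (p := fun z => ‖M z‖ ^ 2
      ≤ C * -inner ℝ (AdjDomain.incl A z).1 (AdjDomain.incl A z).2) z ?_ fun φ => ?_
    · exact isClosed_le (by fun_prop) (by fun_prop)
    · rw [hMe, hincl]
      exact hm φ
  -- The control operator is the dual of `M`; on the core it agrees with the given expression by
  -- `hnm`.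
  let N₀ : H →L[ℝ] Extrap A := (ContinuousLinearMap.precomp ℝ M).comp (innerSL ℝ)
  have hN₀ : ∀ y z, N₀ y z = inner ℝ y (M z) := fun y z => rfl
  have hN₀j : ∀ φ, N₀ (j φ) = toExtrap A (n φ) := by
    intro φ
    ext z
    rw [hN₀, toExtrap_apply]
    refine he.induction_on (p := fun z => inner ℝ (j φ) (M z)
      = inner ℝ (n φ) (AdjDomain.incl A z).1) z ?_ fun ψ => ?_
    · exact isClosed_eq (by fun_prop) (by fun_prop)
    · rw [hMe, hincl, hnm]
  have huniq : ∀ N : H →L[ℝ] Extrap A, (∀ φ, N (j φ) = toExtrap A (n φ)) → N = N₀ := by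
    intro N hN
    refine ContinuousLinearMap.coeFn_injective
      (hdense.equalizer N.continuous N₀.continuous (funext fun φ => ?_))
    exact (hN φ).trans (hN₀j φ).symm
  refine ⟨hA.existsUnique_semigroup, ⟨N₀, hN₀j, huniq⟩, ?_⟩
  intro S hS N hN T hT y₀ u hu
  rw [huniq N hN]
  refine existsUnique_isMildSolution hA.dissipative hA.dense_domain ?_ hS N₀ M hN₀ hC hM hT.le y₀ hu
  refine hdense.mono ?_
  rintro _ ⟨φ, rfl⟩
  exact ⟨e φ, congrArg Prod.fst (hincl φ)⟩

end Core

/-! ### Locally Lipschitz potentials and integration by parts against `e^{-H}` -/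

section Potential

variable {d : ℕ}

/-- Measurable functions on `ℝᵈ` that are essentially bounded on balls. -/
structure IsLocBounded (b : Rd d → ℝ) : Prop where
  aestronglyMeasurable : AEStronglyMeasurable b
  exists_bound : ∀ R : ℝ, ∃ C : ℝ, 0 ≤ C ∧ ∀ᵐ x, ‖x‖ ≤ R → ‖b x‖ ≤ C

theorem exists_ae_bound_of_memLp_top {E F : Type*} [MeasurableSpace E] [NormedAddCommGroup F]
    {μ : Measure E} {f : E → F} (hf : MemLp f ⊤ μ) : ∃ C : ℝ, 0 ≤ C ∧ ∀ᵐ x ∂μ, ‖f x‖ ≤ C := by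
  refine ⟨(eLpNormEssSup f μ).toReal, ENNReal.toReal_nonneg, ?_⟩
  have hfin : eLpNormEssSup f μ ≠ ⊤ := by
    rw [← eLpNorm_exponent_top]
    exact hf.2.ne
  filter_upwards [ae_le_eLpNormEssSup (f := f) (μ := μ)] with x hx
  rw [← toReal_enorm]
  exact ENNReal.toReal_mono hfin hx

theorem exists_ae_bound_on_ball {F : Type*} [NormedAddCommGroup F] {f : Rd d → F}
    (hf : ∀ K : Set (Rd d), IsCompact K → MemLp f ⊤ (volume.restrict K)) (R : ℝ) :
    ∃ C : ℝ, 0 ≤ C ∧ ∀ᵐ x, ‖x‖ ≤ R → ‖f x‖ ≤ C := by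
  obtain ⟨C, hC0, hC⟩ := exists_ae_bound_of_memLp_top
    (hf (Metric.closedBall 0 R) (isCompact_closedBall 0 R))
  refine ⟨C, hC0, ?_⟩
  rw [ae_restrict_iff' Metric.isClosed_closedBall.measurableSet] at hC
  filter_upwards [hC] with x hx hxR
  exact hx (by simpa using hxR)

theorem IsLocBounded.mul {b c : Rd d → ℝ} (hb : IsLocBounded b) (hc : IsLocBounded c) :
    IsLocBounded fun x => b x * c x := by
  refine ⟨hb.1.mul hc.1, fun R => ?_⟩
  obtain ⟨B, hB0, hB⟩ := hb.2 R
  obtain ⟨C, hC0, hC⟩ := hc.2 R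
  refine ⟨B * C, by positivity, ?_⟩
  filter_upwards [hB, hC] with x h1 h2 hx
  rw [norm_mul]
  exact mul_le_mul (h1 hx) (h2 hx) (norm_nonneg _) hB0

theorem IsLocBounded.const (c : ℝ) : IsLocBounded fun _ : Rd d => c :=
  ⟨aestronglyMeasurable_const, fun _ => ⟨‖c‖, norm_nonneg c, Eventually.of_forall fun _ _ => le_rfl⟩⟩

theorem IsLocBounded.exp_neg {b : Rd d → ℝ} (hb : IsLocBounded b) :
    IsLocBounded fun x => Real.exp (-b x) := by
  refine ⟨Real.continuous_exp.comp_aestronglyMeasurable hb.1.neg, fun R => ?_⟩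
  obtain ⟨B, hB0, hB⟩ := hb.2 R
  refine ⟨Real.exp B, (Real.exp_pos _).le, ?_⟩
  filter_upwards [hB] with x h1 hx
  rw [Real.norm_of_nonneg (Real.exp_pos _).le, Real.exp_le_exp]
  exact (neg_le_abs _).trans (h1 hx)

theorem IsLocBounded.coord {f : Rd d → Rd d} (hm : AEStronglyMeasurable f)
    (hf : ∀ R : ℝ, ∃ C : ℝ, 0 ≤ C ∧ ∀ᵐ x, ‖x‖ ≤ R → ‖f x‖ ≤ C) (i : Fin d) :
    IsLocBounded fun x => f x i := by
  refine ⟨(EuclideanSpace.proj (𝕜 := ℝ) i).continuous.comp_aestronglyMeasurable hm, fun R => ?_⟩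
  obtain ⟨C, hC0, hC⟩ := hf R
  refine ⟨C, hC0, ?_⟩
  filter_upwards [hC] with x hx hR
  exact (PiLp.norm_apply_le (f x) i).trans (hx hR)

theorem IsConfinementPotential.isLocBounded {G : Rd d → ℝ} {DG : Rd d → Rd d}
    (hG : IsConfinementPotential G DG) : IsLocBounded G :=
  ⟨hG.weakGradient.1.aestronglyMeasurable, exists_ae_bound_on_ball hG.locally_bounded⟩

theorem IsConfinementPotential.isLocBounded_gradient {G : Rd d → ℝ} {DG : Rd d → Rd d}
    (hG : IsConfinementPotential G DG) (i : Fin d) : IsLocBounded fun x => DG x i :=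
  IsLocBounded.coord hG.weakGradient.2.1.aestronglyMeasurable
    (exists_ae_bound_on_ball hG.gradient_locally_bounded) i

/-- An average over a ball of radius one: the bound on the ball of radius `R + 1` is inherited on
radius `R`, uniformly in the kernel. -/
theorem norm_mollify_le {f κ : Rd d → ℝ} {C R : ℝ} (hκ : IsTestFunction κ) (hκ0 : ∀ z, 0 ≤ κ z)
    (hκ1 : ∫ z, κ z = 1) (hκs : ∀ z, κ z ≠ 0 → ‖z‖ ≤ 1)
    (hf : ∀ᵐ x, ‖x‖ ≤ R + 1 → ‖f x‖ ≤ C) {x : Rd d} (hx : ‖x‖ ≤ R) :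
    ‖mollify f κ x‖ ≤ C := by
  have hint : Integrable fun q => C * κ (x - q) :=
    (hκ.integrable.comp_sub_left x).const_mul C
  rw [mollify_apply]
  refine (norm_integral_le_of_norm_le hint ?_).trans (le_of_eq ?_)
  · filter_upwards [hf] with q hq
    rw [norm_mul, Real.norm_of_nonneg (hκ0 _)]
    rcases eq_or_ne (κ (x - q)) 0 with h0 | h0
    · simp [h0]
    · refine mul_le_mul_of_nonneg_right (hq ?_) (hκ0 _)
      have h1 := norm_sub_le x (x - q)
      rw [sub_sub_cancel] at h1
      linarith [hκs _ h0]
  · rw [integral_const_mul, integral_sub_left_eq_self κ volume x, hκ1, mul_one]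

/-- Smooth approximations of a locally Lipschitz potential, together with their gradients. -/
theorem IsConfinementPotential.exists_smooth_approx {G : Rd d → ℝ} {DG : Rd d → Rd d}
    (hG : IsConfinementPotential G DG) : ∃ g : ℕ → Rd d → ℝ, (∀ n, ContDiff ℝ ∞ (g n)) ∧
    (∀ R : ℝ, ∃ C : ℝ, 0 ≤ C ∧ ∀ n x, ‖x‖ ≤ R →
      ‖g n x‖ ≤ C ∧ ∀ i, ‖fderiv ℝ (g n) x (EuclideanSpace.single i 1)‖ ≤ C) ∧
    ∀ᵐ x, Tendsto (fun n => g n x) atTop (𝓝 (G x)) ∧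
      ∀ i, Tendsto (fun n => fderiv ℝ (g n) x (EuclideanSpace.single i 1)) atTop
        (𝓝 (DG x i)) := by
  have hpos : ∀ n : ℕ, (0 : ℝ) < 1 / ((n : ℝ) + 1) := fun n => by positivity
  let b : ℕ → ContDiffBump (0 : Rd d) := fun n =>
    ⟨1 / ((n : ℝ) + 1) / 2, 1 / ((n : ℝ) + 1), by linarith [hpos n], by linarith [hpos n]⟩
  set κ : ℕ → Rd d → ℝ := fun n => (b n).normed volume with hκdef
  have hκ : ∀ n, IsTestFunction (κ n) := fun n =>
    ⟨(b n).contDiff_normed, (b n).hasCompactSupport_normed⟩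
  have hκ0 : ∀ n z, 0 ≤ κ n z := fun n => (b n).nonneg_normed
  have hκ1 : ∀ n, ∫ z, κ n z = 1 := fun n => (b n).integral_normed
  have hκs : ∀ n z, κ n z ≠ 0 → ‖z‖ ≤ 1 := by
    intro n z hz
    have h1 : z ∈ Function.support ((b n).normed volume) := hz
    rw [(b n).support_normed_eq, mem_ball_zero_iff] at h1
    refine h1.le.trans ?_
    change 1 / ((n : ℝ) + 1) ≤ 1
    rw [div_le_one (by positivity)]
    linarith [(Nat.cast_nonneg n : (0 : ℝ) ≤ n)]
  have hlim : ∀ {f : Rd d → ℝ}, LocallyIntegrable f →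
      ∀ᵐ x, Tendsto (fun n => mollify f (κ n) x) atTop (𝓝 (f x)) := by
    intro f hf
    -- Lebesgue differentiation for bumps whose outer and inner radii have bounded ratio, here
    -- exactly `2`.
    have h1 := ContDiffBump.ae_convolution_tendsto_right_of_locallyIntegrable (φ := b) (K := 2)
      (l := atTop) (μ := volume) (tendsto_one_div_add_atTop_nhds_zero_nat (𝕜 := ℝ))
      (Eventually.of_forall fun n => by
        change 1 / ((n : ℝ) + 1) ≤ 2 * (1 / ((n : ℝ) + 1) / 2)
        linarith) hf
    filter_upwards [h1] with x hx
    simp only [mollify_comm f]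
    exact hx
  obtain ⟨hGi, hDGi, hw⟩ := hG.weakGradient
  have hDi : ∀ i, LocallyIntegrable fun x => DG x i := by
    intro i x
    obtain ⟨U, hU, hU'⟩ := hDGi x
    exact ⟨U, hU, (EuclideanSpace.proj (𝕜 := ℝ) i).integrable_comp hU'⟩
  -- The weak gradient tested with `q ↦ κ (x - q)`: the sign from the inner derivative cancels the
  -- one in the definition, so the gradient of the mollified potential is the mollified weak
  -- gradient.
  have hder : ∀ n x i, fderiv ℝ (mollify G (κ n)) x (EuclideanSpace.single i 1)
      = mollify (fun q => DG q i) (κ n) x := by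
    intro n x i
    have htest : IsTestFunction fun q => κ n (x - q) :=
      ⟨(hκ n).1.comp (contDiff_const.sub contDiff_id),
        (hκ n).2.comp_homeomorph (Homeomorph.subLeft x)⟩
    have hD : ∀ q, fderiv ℝ (fun q => κ n (x - q)) q (EuclideanSpace.single i 1)
        = -fderiv ℝ (κ n) (x - q) (EuclideanSpace.single i 1) := by
      intro q
      have h1 : HasFDerivAt (fun q : Rd d => x - q) (-ContinuousLinearMap.id ℝ (Rd d)) q := by
        exact (hasFDerivAt_id q).const_sub x
      have h2 := ((hκ n).differentiable (x - q)).hasFDerivAt.comp q h1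
      have h3 : fderiv ℝ (fun q => κ n (x - q)) q = _ := h2.fderiv
      rw [h3]
      simp
    have h1 := hw _ htest (EuclideanSpace.single i 1)
    simp only [hD, mul_neg, integral_neg, neg_inj] at h1
    rw [fderiv_mollify_apply hGi (hκ n), mollify_apply, h1, mollify_apply]
    congr 1
    ext q
    simp [EuclideanSpace.inner_single_right]
  refine ⟨fun n => mollify G (κ n), fun n => contDiff_mollify hGi (hκ n), fun R => ?_, ?_⟩
  · obtain ⟨C₁, h1, hC₁⟩ := hG.isLocBounded.2 (R + 1)
    obtain ⟨C₂, h2, hC₂⟩ := exists_ae_bound_on_ball hG.gradient_locally_bounded (R + 1)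
    refine ⟨max C₁ C₂, le_max_of_le_left h1, fun n x hx => ⟨?_, fun i => ?_⟩⟩
    · exact (norm_mollify_le (hκ n) (hκ0 n) (hκ1 n) (hκs n) hC₁ hx).trans (le_max_left _ _)
    · rw [hder]
      refine (norm_mollify_le (hκ n) (hκ0 n) (hκ1 n) (hκs n) (C := C₂) ?_ hx).trans
        (le_max_right _ _)
      filter_upwards [hC₂] with q hq hqR
      exact (PiLp.norm_apply_le (DG q) i).trans (hq hqR)
  · filter_upwards [hlim hGi, ae_all_iff.2 fun i => hlim (hDi i)] with x hx1 hx2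
    refine ⟨hx1, fun i => ?_⟩
    simpa only [hder] using hx2 i

/-- The coefficients are bounded only locally; dominated convergence applies because `Ψ` vanishes
outside a ball. -/
theorem tendsto_integral_mul_of_locBounded {F : ℕ → Phase d → ℝ} {f Ψ : Phase d → ℝ} {R : ℝ}
    (hF : ∀ n, AEStronglyMeasurable (F n)) {C : ℝ} (hC : ∀ n, ∀ᵐ p, ‖p‖ ≤ R → ‖F n p‖ ≤ C)
    (hlim : ∀ᵐ p, Tendsto (fun n => F n p) atTop (𝓝 (f p))) (hΨ : Integrable Ψ)
    (hR : ∀ p, Ψ p ≠ 0 → ‖p‖ ≤ R) :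
    Tendsto (fun n => ∫ p, F n p * Ψ p) atTop (𝓝 (∫ p, f p * Ψ p)) := by
  refine tendsto_integral_of_dominated_convergence (fun p => C * ‖Ψ p‖)
    (fun n => (hF n).mul hΨ.1) (hΨ.norm.const_mul C) (fun n => ?_) ?_
  · filter_upwards [hC n] with p hp
    rw [norm_mul]
    rcases eq_or_ne (Ψ p) 0 with h0 | h0
    · simp [h0]
    · exact mul_le_mul_of_nonneg_right (hp (hR p h0)) (norm_nonneg _)
  · filter_upwards [hlim] with p hp
    exact hp.mul_const _

theorem IsTestFunction.exists_radius {φ : Phase d → ℝ} (hφ : IsTestFunction φ) :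
    ∃ R : ℝ, ∀ p, φ p ≠ 0 → ‖p‖ ≤ R := by
  obtain ⟨R, hR⟩ := hφ.2.isCompact.isBounded.exists_norm_le
  exact ⟨R, fun p hp => hR p (subset_tsupport _ hp)⟩

/-- The weight `exp (a |v|² + g x)`. -/
def expWeight (a : ℝ) (g : Rd d → ℝ) (p : Phase d) : ℝ := Real.exp (a * ‖p.2‖ ^ 2 + g p.1)

theorem contDiff_expWeight (a : ℝ) {g : Rd d → ℝ} (hg : ContDiff ℝ ∞ g) :
    ContDiff ℝ ∞ (expWeight a g) :=
  Real.contDiff_exp.comp ((contDiff_const.mul (contDiff_snd.norm_sq ℝ)).add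
    (hg.comp contDiff_fst))

theorem hasFDerivAt_expWeight (a : ℝ) {g : Rd d → ℝ} (hg : ContDiff ℝ ∞ g) (p : Phase d) :
    HasFDerivAt (expWeight a g) (expWeight a g p •
      (a • ((2 • innerSL ℝ p.2).comp (ContinuousLinearMap.snd ℝ (Rd d) (Rd d)))
        + (fderiv ℝ g p.1).comp (ContinuousLinearMap.fst ℝ (Rd d) (Rd d)))) p := by
  have h1 : HasFDerivAt (fun p : Phase d => ‖p.2‖ ^ 2)
      ((2 • innerSL ℝ p.2).comp (ContinuousLinearMap.snd ℝ (Rd d) (Rd d))) p :=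
    (hasStrictFDerivAt_norm_sq p.2).hasFDerivAt.comp p hasFDerivAt_snd
  have h2 : HasFDerivAt (fun p : Phase d => g p.1)
      ((fderiv ℝ g p.1).comp (ContinuousLinearMap.fst ℝ (Rd d) (Rd d))) p :=
    ((hg.differentiable (by simp)) p.1).hasFDerivAt.comp p hasFDerivAt_fst
  exact ((h1.const_mul a).add h2).exp

theorem fderiv_expWeight_xDir (a : ℝ) {g : Rd d → ℝ} (hg : ContDiff ℝ ∞ g) (p : Phase d)
    (i : Fin d) : fderiv ℝ (expWeight a g) p (xDir i)
      = fderiv ℝ g p.1 (EuclideanSpace.single i 1) * expWeight a g p := by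
  rw [(hasFDerivAt_expWeight a hg p).fderiv]
  simp [xDir, mul_comm]

theorem fderiv_expWeight_vDir (a : ℝ) {g : Rd d → ℝ} (hg : ContDiff ℝ ∞ g) (p : Phase d)
    (i : Fin d) : fderiv ℝ (expWeight a g) p (vDir i)
      = 2 * a * vCoord i p * expWeight a g p := by
  rw [(hasFDerivAt_expWeight a hg p).fderiv]
  simp [vDir, vCoord_apply, EuclideanSpace.inner_single_right]
  ring

theorem vCoord_vDir (i : Fin d) : vCoord i (vDir i) = 1 := by
  simp [vDir, vCoord_apply]

theorem exp_neg_hamiltonian (G : Rd d → ℝ) (p : Phase d) :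
    Real.exp (-hamiltonian G p) = Real.exp (-G p.1) * expWeight (-1 / 2) (fun _ => 0) p := by
  rw [expWeight, ← Real.exp_add, hamiltonian]
  congr 1
  ring

/-- Gaussian integration by parts in velocity with a coefficient depending on the position. -/
theorem integral_exp_mul_fderiv_vDir {G b : Rd d → ℝ} (hG : IsLocBounded G) (hb : IsLocBounded b)
    {Φ : Phase d → ℝ} (hΦ : IsTestFunction Φ) (i : Fin d) :
    ∫ p, Real.exp (-hamiltonian G p) * (b p.1 * fderiv ℝ Φ p (vDir i))
      = ∫ p, Real.exp (-hamiltonian G p) * (b p.1 * (vCoord i p * Φ p)) := by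
  set W := expWeight (d := d) (-1 / 2) fun _ => 0 with hW
  have hWc : ContDiff ℝ ∞ W := contDiff_expWeight _ contDiff_const
  have hWΦ : IsTestFunction fun p => W p * Φ p := hΦ.mul_left hWc
  obtain ⟨R, hR⟩ := hΦ.2.isCompact.isBounded.exists_norm_le
  have hβ' : IsLocBounded fun x => Real.exp (-G x) * b x := hG.exp_neg.mul hb
  -- Truncation to a ball containing the support of `Φ` makes the coefficient globally bounded
  -- without changing the integrals.
  set β : Rd d → ℝ := (Metric.closedBall (0 : Rd d) R).indicator fun x => Real.exp (-G x) * b x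
    with hβ
  obtain ⟨C, hC0, hC⟩ := hβ'.2 R
  have hβC : ∀ᵐ x, ‖β x‖ ≤ C := by
    filter_upwards [hC] with x hx
    by_cases hxB : x ∈ Metric.closedBall (0 : Rd d) R
    · rw [hβ, Set.indicator_of_mem hxB]
      exact hx (by simpa using hxB)
    · rw [hβ, Set.indicator_of_notMem hxB, norm_zero]
      exact hC0
  have hβm : AEStronglyMeasurable β :=
    hβ'.1.indicator Metric.isClosed_closedBall.measurableSet
  -- Applied to `e^{-|v|²/2} Φ`, whose velocity derivative is `e^{-|v|²/2} (∂ᵥᵢΦ - vᵢ Φ)`; the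
  -- position factor is never differentiated.
  have h0 := integral_fst_mul_fderiv_snd hβm hβC hWΦ (EuclideanSpace.single i 1)
  have hD : ∀ p, fderiv ℝ (fun p => W p * Φ p) p (vDir i)
      = W p * (fderiv ℝ Φ p (vDir i) - vCoord i p * Φ p) := by
    intro p
    rw [fderiv_mul_apply (hWc.differentiable (by simp)) hΦ.differentiable, hW,
      fderiv_expWeight_vDir _ contDiff_const]
    ring
  have hβeq : ∀ p, p ∈ tsupport Φ → β p.1 = Real.exp (-G p.1) * b p.1 := fun p hp =>
    Set.indicator_of_mem (by simpa using (norm_fst_le p).trans (hR p hp)) _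
  have hint : ∀ {Ψ : Phase d → ℝ}, IsTestFunction Ψ → tsupport Ψ ⊆ tsupport Φ →
      Integrable fun p => Real.exp (-hamiltonian G p) * (b p.1 * Ψ p) := by
    intro Ψ hΨ hsub
    have h1 : Integrable fun p : Phase d => β p.1 * (W p * Ψ p) :=
      (hΨ.mul_left hWc).integrable.bdd_mul (c := C) (aestronglyMeasurable_comp_fst hβm)
        (ae_comp_fst hβC)
    refine h1.congr (Eventually.of_forall fun p => ?_)
    simp only [exp_neg_hamiltonian]
    by_cases hp : p ∈ tsupport Φ
    · rw [hβeq p hp]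
      ring
    · have : Ψ p = 0 := image_eq_zero_of_notMem_tsupport fun h => hp (hsub h)
      simp [this]
  have i1 := hint (hΦ.fderiv_apply (vDir i)) (tsupport_fderiv_apply_subset ℝ _)
  have i2 := hint (hΦ.mul_left (vCoord i).contDiff) (tsupport_mul_subset_right)
  rw [← sub_eq_zero, ← integral_sub i1 i2, ← h0]
  congr 1
  ext p
  have hD' := hD p
  rw [vDir] at hD'
  rw [hD']
  simp only [exp_neg_hamiltonian]
  by_cases hp : p ∈ tsupport Φ
  · rw [hβeq p hp, vDir]
    ring
  · have h1 : Φ p = 0 := image_eq_zero_of_notMem_tsupport hp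
    have h2 : fderiv ℝ Φ p (vDir i) = 0 :=
      image_eq_zero_of_notMem_tsupport (f := fun p => fderiv ℝ Φ p (vDir i)) fun h =>
        hp (tsupport_fderiv_apply_subset ℝ _ h)
    rw [vDir] at h2
    simp [h1, h2, vDir]

/-- Integration by parts in position against `v e^{-H}`. -/
theorem IsConfinementPotential.integral_exp_mul_fderiv_xDir {G : Rd d → ℝ} {DG : Rd d → Rd d}
    (hG : IsConfinementPotential G DG) {Φ : Phase d → ℝ} (hΦ : IsTestFunction Φ) (i : Fin d) :
    ∫ p, Real.exp (-hamiltonian G p) * (vCoord i p * fderiv ℝ Φ p (xDir i))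
      = ∫ p, Real.exp (-hamiltonian G p) * (DG p.1 i * (vCoord i p * Φ p)) := by
  -- Here the derivative does fall on `e^{-G}`, so the identity is proved for smooth approximations
  -- of `G` and passed to the limit.
  obtain ⟨g, hg, hbound, hlim⟩ := hG.exists_smooth_approx
  set W : ℕ → Phase d → ℝ := fun n => expWeight (-1 / 2) fun x => -g n x with hW
  have hgn : ∀ n, ContDiff ℝ ∞ fun x => -g n x := fun n => (hg n).neg
  have hWc : ∀ n, ContDiff ℝ ∞ (W n) := fun n => contDiff_expWeight _ (hgn n)
  have hgc : ∀ n, Continuous fun x => fderiv ℝ (g n) x (EuclideanSpace.single i 1) := fun n =>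
    (IsTestFunction.contDiff_fderiv_apply (hg n) _).continuous
  have hvΦ : IsTestFunction fun p => vCoord i p * Φ p := hΦ.mul_left (vCoord i).contDiff
  have hvD : IsTestFunction fun p => vCoord i p * fderiv ℝ Φ p (xDir i) :=
    (hΦ.fderiv_apply _).mul_left (vCoord i).contDiff
  have hstep : ∀ n, ∫ p, W n p * (vCoord i p * fderiv ℝ Φ p (xDir i))
      = ∫ p, (fderiv ℝ (g n) p.1 (EuclideanSpace.single i 1) * W n p) * (vCoord i p * Φ p) := by
    intro n
    have h1 := IsTestFunction.integral_mul_fderiv (μ := volume) (hWc n) hvΦ (xDir i)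
    have h2 : ∀ p, fderiv ℝ (fun p => vCoord i p * Φ p) p (xDir i)
        = vCoord i p * fderiv ℝ Φ p (xDir i) := by
      intro p
      rw [fderiv_mul_apply (vCoord i).differentiable hΦ.differentiable,
        ContinuousLinearMap.fderiv, vCoord_xDir, mul_zero, add_zero]
    have h3 : ∀ p : Phase d, fderiv ℝ (fun x => -g n x) p.1 (EuclideanSpace.single i 1)
        = -fderiv ℝ (g n) p.1 (EuclideanSpace.single i 1) := by
      intro p
      rw [fderiv_fun_neg]
      rfl
    simp only [h2] at h1
    rw [h1, ← integral_neg]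
    congr 1
    ext p
    rw [hW, fderiv_expWeight_xDir _ (hgn n), h3]
    ring
  have hWlim : ∀ᵐ p : Phase d, Tendsto (fun n => W n p) atTop (𝓝 (Real.exp (-hamiltonian G p))) ∧
      Tendsto (fun n => fderiv ℝ (g n) p.1 (EuclideanSpace.single i 1)) atTop (𝓝 (DG p.1 i)) := by
    filter_upwards [ae_comp_fst hlim] with p hp
    refine ⟨?_, hp.2 i⟩
    have h1 : -hamiltonian G p = -1 / 2 * ‖p.2‖ ^ 2 + -G p.1 := by
      rw [hamiltonian]
      ring
    rw [h1]
    exact (Real.continuous_exp.tendsto _).comp (hp.1.neg.const_add _)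
  have hWb : ∀ {R C : ℝ}, (∀ n x, ‖x‖ ≤ R → ‖g n x‖ ≤ C ∧
      ∀ i, ‖fderiv ℝ (g n) x (EuclideanSpace.single i 1)‖ ≤ C) → ∀ n (p : Phase d), ‖p‖ ≤ R →
      ‖W n p‖ ≤ Real.exp C := by
    intro R C h n p hp
    rw [hW]
    simp only [expWeight]
    rw [Real.norm_of_nonneg (Real.exp_pos _).le, Real.exp_le_exp]
    have h1 := (neg_le_abs _).trans (h n p.1 ((norm_fst_le p).trans hp)).1
    nlinarith [sq_nonneg ‖p.2‖]
  refine tendsto_nhds_unique (f := fun n => ∫ p, W n p * (vCoord i p * fderiv ℝ Φ p (xDir i)))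
    (l := atTop) ?_ ?_
  · obtain ⟨R, hR⟩ := hvD.exists_radius
    obtain ⟨C, hC0, hC⟩ := hbound R
    exact tendsto_integral_mul_of_locBounded (fun n => (hWc n).continuous.aestronglyMeasurable)
      (fun n => Eventually.of_forall (hWb hC n)) (hWlim.mono fun p hp => hp.1) hvD.integrable hR
  · simp only [hstep]
    obtain ⟨R, hR⟩ := hvΦ.exists_radius
    obtain ⟨C, hC0, hC⟩ := hbound R
    have h1 := tendsto_integral_mul_of_locBounded
      (F := fun n p => fderiv ℝ (g n) p.1 (EuclideanSpace.single i 1) * W n p)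
      (f := fun p => DG p.1 i * Real.exp (-hamiltonian G p)) (C := C * Real.exp C) (R := R)
      (fun n => (((hgc n).comp continuous_fst).mul (hWc n).continuous).aestronglyMeasurable)
      (fun n => Eventually.of_forall fun p hp => by
        rw [norm_mul]
        exact mul_le_mul ((hC n p.1 ((norm_fst_le p).trans hp)).2 i) (hWb hC n p hp)
          (norm_nonneg _) hC0)
      (hWlim.mono fun p hp => hp.2.mul hp.1) hvΦ.integrable hR
    convert h1 using 3
    ext p
    ring

end Potential

/-! ### The kinetic operator in coordinates and its conjugation -/

section KineticOperator

variable {d : ℕ}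

/-- The operator `s (γ·∇ᵥ - v·∇ₓ) - v·∇ᵥ + Δᵥ`, in coordinates. -/
def kinOp (γ : Fin d → Rd d → ℝ) (s : ℝ) (φ : Phase d → ℝ) (p : Phase d) : ℝ :=
  ∑ i, (s * (γ i p.1 * fderiv ℝ φ p (vDir i) - vCoord i p * fderiv ℝ φ p (xDir i))
    - vCoord i p * fderiv ℝ φ p (vDir i)
    + fderiv ℝ (fun q => fderiv ℝ φ q (vDir i)) p (vDir i))

theorem clm_apply_eq_sum (ℓ : Rd d →L[ℝ] ℝ) (w : Rd d) :
    ℓ w = ∑ i, w i * ℓ (EuclideanSpace.single i 1) := by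
  conv_lhs => rw [← (EuclideanSpace.basisFun (Fin d) ℝ).sum_repr w]
  simp [map_sum]

theorem fderiv_apply_fst_eq_sum (φ : Phase d → ℝ) (p : Phase d) (w : Rd d) :
    fderiv ℝ φ p (w, 0) = ∑ i, w i * fderiv ℝ φ p (xDir i) :=
  clm_apply_eq_sum ((fderiv ℝ φ p).comp (ContinuousLinearMap.inl ℝ (Rd d) (Rd d))) w

theorem fderiv_apply_snd_eq_sum (φ : Phase d → ℝ) (p : Phase d) (w : Rd d) :
    fderiv ℝ φ p (0, w) = ∑ i, w i * fderiv ℝ φ p (vDir i) :=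
  clm_apply_eq_sum ((fderiv ℝ φ p).comp (ContinuousLinearMap.inr ℝ (Rd d) (Rd d))) w

theorem fderiv_slice {χ : Phase d → ℝ} (hχ : Differentiable ℝ χ) (x v e : Rd d) :
    fderiv ℝ (fun w => χ (x, w)) v e = fderiv ℝ χ (x, v) (0, e) := by
  have h2 : HasFDerivAt (fun v : Rd d => (x, v)) (ContinuousLinearMap.inr ℝ (Rd d) (Rd d)) v :=
    (hasFDerivAt_const x v).prodMk (hasFDerivAt_id v)
  have h3 := (hχ (x, v)).hasFDerivAt.comp v h2
  have h4 : fderiv ℝ (fun v : Rd d => χ (x, v)) v = _ := h3.fderiv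
  rw [h4]
  rfl

theorem laplacian_slice {φ : Phase d → ℝ} (hφ : ContDiff ℝ ∞ φ) (p : Phase d) :
    Laplacian.laplacian (fun w => φ (p.1, w)) p.2
      = ∑ i, fderiv ℝ (fun q => fderiv ℝ φ q (vDir i)) p (vDir i) := by
  rw [InnerProductSpace.laplacian_eq_iteratedFDeriv_orthonormalBasis _
    (EuclideanSpace.basisFun (Fin d) ℝ)]
  refine Finset.sum_congr rfl fun i _ => ?_
  have hs : ContDiff ℝ ∞ fun w => φ (p.1, w) := hφ.comp (contDiff_const.prodMk contDiff_id)
  have hd : Differentiable ℝ (fderiv ℝ fun w => φ (p.1, w)) :=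
    (hs.fderiv_right (m := ∞) (by simp)).differentiable (by simp)
  rw [iteratedFDeriv_two_apply]
  simp only [Matrix.cons_val_zero, Matrix.cons_val_one, EuclideanSpace.basisFun_apply]
  set e : Rd d := EuclideanSpace.single i 1
  have h1 : fderiv ℝ (fderiv ℝ fun w => φ (p.1, w)) p.2 e e
      = fderiv ℝ (fun w => fderiv ℝ (fun w => φ (p.1, w)) w e) p.2 e := by
    have h2 := ((hd p.2).hasFDerivAt.clm_apply (hasFDerivAt_const e p.2)).fderiv
    rw [h2]
    simp
  rw [h1]
  simp only [fderiv_slice (hφ.differentiable (by simp))]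
  exact fderiv_slice (χ := fun q => fderiv ℝ φ q (vDir i))
    ((IsTestFunction.contDiff_fderiv_apply hφ (vDir i)).differentiable (by simp)) p.1 p.2 e

theorem lStarFun_eq_kinOp (DG : Rd d → Rd d) {φ : Phase d → ℝ} (hφ : ContDiff ℝ ∞ φ) :
    lStarFun DG φ = kinOp (fun i x => DG x i) 1 φ := by
  funext p
  rw [lStarFun, laplacian_slice hφ, fderiv_apply_fst_eq_sum, fderiv_apply_snd_eq_sum,
    fderiv_apply_snd_eq_sum, kinOp, ← Finset.sum_neg_distrib, ← Finset.sum_add_distrib,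
    ← Finset.sum_sub_distrib, ← Finset.sum_add_distrib]
  refine Finset.sum_congr rfl fun i _ => ?_
  simp only [vCoord_apply]
  ring

theorem controlFun_eq_sum (Dα : Rd d → Rd d) (φ : Phase d → ℝ) (p : Phase d) :
    controlFun Dα φ p
      = ∑ i, (Dα p.1 i * fderiv ℝ φ p (vDir i) - Dα p.1 i * (vCoord i p * φ p)) := by
  rw [controlFun, fderiv_apply_snd_eq_sum, Finset.sum_sub_distrib, PiLp.inner_apply,
    Finset.mul_sum]
  congr 1
  refine Finset.sum_congr rfl fun i _ => ?_
  simp only [vCoord_apply, RCLike.inner_apply, conj_trivial]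
  ring

/-- Conjugation of `l - kinOp` by a Gaussian-type weight. -/
theorem mul_sub_kinOp_expWeight {g : Rd d → ℝ} (hg : ContDiff ℝ ∞ g) (γ : Fin d → Rd d → ℝ)
    (s l : ℝ) {ψ : Phase d → ℝ} (hψ : IsTestFunction ψ) (p : Phase d) :
    l * (expWeight (1 / 4) g p * ψ p) - kinOp γ s (fun q => expWeight (1 / 4) g q * ψ q) p
      = expWeight (1 / 4) g p *
        (flatOp (fun p => l - d / 2 + ‖p.2‖ ^ 2 / 4) (fun i x => s * γ i x) s ψ p
          - s * ∑ i, (γ i p.1 / 2 - fderiv ℝ g p.1 (EuclideanSpace.single i 1))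
            * (vCoord i p * ψ p)) := by
  set W := expWeight (1 / 4) g with hW
  have hWd : Differentiable ℝ W := (contDiff_expWeight _ hg).differentiable (by simp)
  have hDd : ∀ i, Differentiable ℝ fun q => fderiv ℝ ψ q (vDir i) := fun i =>
    (hψ.fderiv_apply _).differentiable
  have hx : ∀ i, fderiv ℝ (fun q => W q * ψ q) p (xDir i) = W p * (fderiv ℝ ψ p (xDir i)
      + fderiv ℝ g p.1 (EuclideanSpace.single i 1) * ψ p) := by
    intro i
    rw [fderiv_mul_apply hWd hψ.differentiable, hW, fderiv_expWeight_xDir _ hg]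
    ring
  have hv : ∀ i q, fderiv ℝ (fun q => W q * ψ q) q (vDir i)
      = W q * (fderiv ℝ ψ q (vDir i) + 1 / 2 * (vCoord i q * ψ q)) := by
    intro i q
    rw [fderiv_mul_apply hWd hψ.differentiable, hW, fderiv_expWeight_vDir _ hg]
    ring
  -- The zeroth-order terms here, together with `vᵢ ∂ᵥᵢ` acting on the weight, leave `-1/2 + vᵢ²/4`
  -- in each direction: this is the origin of `-d/2 + |v|²/4`. The first-order velocity terms
  -- cancel. The defect `γ/2 - ∇g` remains because `g` merely approximates `G/2`.
  have hvv : ∀ i, fderiv ℝ (fun q => fderiv ℝ (fun q => W q * ψ q) q (vDir i)) p (vDir i)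
      = W p * (fderiv ℝ (fun q => fderiv ℝ ψ q (vDir i)) p (vDir i)
        + vCoord i p * fderiv ℝ ψ p (vDir i) + 1 / 2 * ψ p + 1 / 4 * vCoord i p ^ 2 * ψ p) := by
    intro i
    have hvψ : Differentiable ℝ fun q => vCoord i q * ψ q :=
      (vCoord i).differentiable.mul hψ.differentiable
    have hsum : Differentiable ℝ fun q => fderiv ℝ ψ q (vDir i) + 1 / 2 * (vCoord i q * ψ q) :=
      (hDd i).add (hvψ.const_mul _)
    simp only [hv]
    rw [fderiv_mul_apply hWd hsum, fderiv_fun_add (hDd i p)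
      (hvψ.const_mul _ p), fderiv_const_mul (hvψ p), add_apply, smul_apply,
      fderiv_mul_apply (vCoord i).differentiable hψ.differentiable, hW,
      fderiv_expWeight_vDir _ hg, ContinuousLinearMap.fderiv, vCoord_vDir, smul_eq_mul]
    ring
  have hnorm : ‖p.2‖ ^ 2 = ∑ i, vCoord i p ^ 2 := by
    rw [EuclideanSpace.real_norm_sq_eq]
    rfl
  have hd : (d : ℝ) / 2 * ψ p = ∑ _i : Fin d, 1 / 2 * ψ p := by
    rw [Finset.sum_const, Finset.card_univ, Fintype.card_fin, nsmul_eq_mul]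
    ring
  have hflat : flatOp (fun p => l - d / 2 + ‖p.2‖ ^ 2 / 4) (fun i x => s * γ i x) s ψ p
      = l * ψ p + ∑ i, (-(1 / 2 * ψ p) + vCoord i p ^ 2 / 4 * ψ p
        + s * (vCoord i p * fderiv ℝ ψ p (xDir i)) - s * γ i p.1 * fderiv ℝ ψ p (vDir i)
        - fderiv ℝ (fun q => fderiv ℝ ψ q (vDir i)) p (vDir i)) := by
    simp only [flatOp, Finset.sum_add_distrib, Finset.sum_sub_distrib, Finset.sum_neg_distrib,
      ← hd, ← Finset.mul_sum, ← Finset.sum_mul, ← Finset.sum_div, ← hnorm]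
    ring
  rw [hflat, kinOp, mul_sub, mul_add, Finset.mul_sum, Finset.mul_sum, Finset.mul_sum, add_sub_assoc,
    ← Finset.sum_sub_distrib, sub_eq_add_neg, ← Finset.sum_neg_distrib]
  congr 1
  · ring
  refine Finset.sum_congr rfl fun i _ => ?_
  rw [hvv, hv, hx]
  ring

theorem IsLocBounded.memLp_mul_isTestFunction {b : Rd d → ℝ} (hb : IsLocBounded b)
    {φ : Phase d → ℝ} (hφ : IsTestFunction φ) {ν : Measure (Phase d)}
    [IsFiniteMeasureOnCompacts ν] (hν : ν ≪ volume) (q : ℝ≥0∞) :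
    MemLp (fun p => b p.1 * φ p) q ν := by
  obtain ⟨R, hR⟩ := hφ.exists_radius
  obtain ⟨C, hC0, hC⟩ := hb.2 R
  refine MemLp.of_le_mul (c := C) (hφ.memLp q)
    (((aestronglyMeasurable_comp_fst hb.1).mono_ac hν).mul hφ.continuous.aestronglyMeasurable) ?_
  filter_upwards [hν.ae_le (ae_comp_fst hC)] with p hp
  rw [norm_mul]
  rcases eq_or_ne (φ p) 0 with h0 | h0
  · simp [h0]
  · exact mul_le_mul_of_nonneg_right (hp ((norm_fst_le p).trans (hR p h0))) (norm_nonneg _)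

theorem memLp_kinOp {γ : Fin d → Rd d → ℝ} (hγ : ∀ i, IsLocBounded (γ i)) (s : ℝ)
    {φ : Phase d → ℝ} (hφ : IsTestFunction φ) {ν : Measure (Phase d)}
    [IsFiniteMeasureOnCompacts ν] (hν : ν ≪ volume) (q : ℝ≥0∞) : MemLp (kinOp γ s φ) q ν := by
  refine memLp_finsetSum _ fun i _ => ?_
  have h1 := (hγ i).memLp_mul_isTestFunction (hφ.fderiv_apply (vDir i)) hν q
  have h2 := ((hφ.fderiv_apply (xDir i)).mul_left (vCoord i).contDiff).memLp (μ := ν) q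
  have h3 := ((hφ.fderiv_apply (vDir i)).mul_left (vCoord i).contDiff).memLp (μ := ν) q
  have h4 := ((hφ.fderiv_apply (vDir i)).fderiv_apply (vDir i)).memLp (μ := ν) q
  exact (((h1.sub h2).const_mul s).sub h3).add h4

theorem memLp_flatOp {V : Phase d → ℝ} (hV : ContDiff ℝ ∞ V) {β : Fin d → Rd d → ℝ}
    (hβ : ∀ i, IsLocBounded (β i)) (s : ℝ) {ψ : Phase d → ℝ} (hψ : IsTestFunction ψ) (q : ℝ≥0∞) :
    MemLp (flatOp V β s ψ) q := by
  have h1 := (hψ.mul_left hV).memLp (μ := volume) q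
  have h2 := memLp_finsetSum Finset.univ fun i _ =>
    ((hψ.fderiv_apply (xDir i)).mul_left (vCoord i).contDiff).memLp (μ := volume) q
  have h3 := memLp_finsetSum Finset.univ fun i _ => (hβ i).memLp_mul_isTestFunction
    (hψ.fderiv_apply (vDir i)) Measure.AbsolutelyContinuous.rfl q
  have h4 := memLp_finsetSum Finset.univ fun i _ =>
    ((hψ.fderiv_apply (vDir i)).fderiv_apply (vDir i)).memLp (μ := volume) q
  exact ((h1.add (h2.const_mul s)).sub h3).sub h4

end KineticOperator

/-! ### The invariant measure -/

section InvariantMeasure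

variable {d : ℕ} {G : Rd d → ℝ} {DG : Rd d → Rd d}

theorem aestronglyMeasurable_hamiltonian (hG : IsConfinementPotential G DG) :
    AEStronglyMeasurable (hamiltonian G) := by
  have h1 : Continuous fun p : Phase d => ‖p.2‖ ^ 2 / 2 := by fun_prop
  exact h1.aestronglyMeasurable.add (aestronglyMeasurable_comp_fst hG.isLocBounded.1)

theorem integrable_exp_neg_hamiltonian (hG : IsConfinementPotential G DG) :
    Integrable fun p => Real.exp (-hamiltonian G p) := by
  have hgauss : Integrable fun v : Rd d => Real.exp (-(1 / 2 : ℝ) * ‖v‖ ^ 2) := by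
    refine not_imp_comm.1 integral_undef ?_
    rw [GaussianFourier.integral_rexp_neg_mul_sq_norm (by norm_num)]
    positivity
  have h := hG.integrable_exp.mul_prod hgauss
  refine h.congr (Eventually.of_forall fun p => ?_)
  simp only [hamiltonian]
  rw [← Real.exp_add]
  congr 1
  ring

theorem integral_exp_neg_hamiltonian_pos (hG : IsConfinementPotential G DG) :
    0 < ∫ p, Real.exp (-hamiltonian G p) :=
  integral_exp_pos (integrable_exp_neg_hamiltonian hG)

theorem isFiniteMeasure_invMeasure (hG : IsConfinementPotential G DG) :
    IsFiniteMeasure (invMeasure G) :=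
  isFiniteMeasure_withDensity_ofReal ((integrable_exp_neg_hamiltonian hG).const_mul _).2

theorem invMeasure_absolutelyContinuous (G : Rd d → ℝ) : invMeasure G ≪ volume :=
  withDensity_absolutelyContinuous _ _

theorem aemeasurable_density (hG : IsConfinementPotential G DG) (c : ℝ) :
    AEMeasurable (fun p : Phase d => ENNReal.ofReal (c * Real.exp (-hamiltonian G p))) :=
  (((integrable_exp_neg_hamiltonian hG).1.const_mul c).aemeasurable).ennreal_ofReal

theorem integral_invMeasure (hG : IsConfinementPotential G DG) (F : Phase d → ℝ) :
    ∫ p, F p ∂invMeasure G = (∫ p, Real.exp (-hamiltonian G p))⁻¹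
      * ∫ p, Real.exp (-hamiltonian G p) * F p := by
  have hpos := integral_exp_neg_hamiltonian_pos hG
  rw [invMeasure, integral_withDensity_eq_integral_toReal_smul₀ (aemeasurable_density hG _)
    (Eventually.of_forall fun _ => ENNReal.ofReal_lt_top), ← integral_const_mul]
  congr 1
  ext p
  rw [ENNReal.toReal_ofReal (by positivity), smul_eq_mul, mul_assoc]

/-- Multiplication by `e^{-H/2}` maps `L²_μ` into `L²`. -/
theorem memLp_exp_mul (hG : IsConfinementPotential G DG) {f : Phase d → ℝ}
    (hfm : AEStronglyMeasurable f) (hf : MemLp f 2 (invMeasure G)) :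
    MemLp (fun p => Real.exp (-hamiltonian G p / 2) * f p) 2 := by
  have hpos := integral_exp_neg_hamiltonian_pos hG
  have hexp : Continuous fun t : ℝ => Real.exp (-t / 2) := by fun_prop
  have hm : AEStronglyMeasurable fun p => Real.exp (-hamiltonian G p / 2) * f p :=
    (hexp.comp_aestronglyMeasurable (aestronglyMeasurable_hamiltonian hG)).mul hfm
  rw [memLp_two_iff_integrable_sq hm]
  have h1 := hf.integrable_sq
  rw [invMeasure, integrable_withDensity_iff_integrable_smul₀' (aemeasurable_density hG _)
    (Eventually.of_forall fun _ => ENNReal.ofReal_lt_top)] at h1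
  refine (h1.const_mul (∫ p, Real.exp (-hamiltonian G p))).congr
    (Eventually.of_forall fun p => ?_)
  simp only
  rw [ENNReal.toReal_ofReal (by positivity), smul_eq_mul, ← mul_assoc, ← mul_assoc,
    mul_inv_cancel₀ hpos.ne', one_mul, mul_pow, ← Real.exp_nat_mul]
  congr 2
  push_cast
  ring

theorem integral_invMeasure_fderiv_vDir (hG : IsConfinementPotential G DG) {b : Rd d → ℝ}
    (hb : IsLocBounded b) {Φ : Phase d → ℝ} (hΦ : IsTestFunction Φ) (i : Fin d) :
    ∫ p, b p.1 * fderiv ℝ Φ p (vDir i) ∂invMeasure G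
      = ∫ p, b p.1 * (vCoord i p * Φ p) ∂invMeasure G := by
  rw [integral_invMeasure hG, integral_invMeasure hG,
    integral_exp_mul_fderiv_vDir hG.isLocBounded hb hΦ]

theorem integral_invMeasure_fderiv_xDir (hG : IsConfinementPotential G DG) {Φ : Phase d → ℝ}
    (hΦ : IsTestFunction Φ) (i : Fin d) :
    ∫ p, vCoord i p * fderiv ℝ Φ p (xDir i) ∂invMeasure G
      = ∫ p, DG p.1 i * (vCoord i p * Φ p) ∂invMeasure G := by
  rw [integral_invMeasure hG, integral_invMeasure hG, hG.integral_exp_mul_fderiv_xDir hΦ]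

end InvariantMeasure

/-! ### Dissipation, formal adjoints and density of the ranges -/

section Identities

variable {d : ℕ} {G : Rd d → ℝ} {DG : Rd d → Rd d}

theorem IsTestFunction.mul {φ ψ : Phase d → ℝ} (hφ : IsTestFunction φ) (hψ : IsTestFunction ψ) :
    IsTestFunction fun p => φ p * ψ p := hψ.mul_left hφ.1

theorem integrable_locBounded_mul (hG : IsConfinementPotential G DG) {b : Rd d → ℝ}
    (hb : IsLocBounded b) {φ : Phase d → ℝ} (hφ : IsTestFunction φ) :
    Integrable (fun p => b p.1 * φ p) (invMeasure G) := by
  have := isFiniteMeasure_invMeasure hG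
  exact memLp_one_iff_integrable.1
    (hb.memLp_mul_isTestFunction hφ (invMeasure_absolutelyContinuous G) 1)

/-- The Hamiltonian transport term is antisymmetric in `L²_μ`. -/
theorem integral_transport_antisymm (hG : IsConfinementPotential G DG) {φ ψ : Phase d → ℝ}
    (hφ : IsTestFunction φ) (hψ : IsTestFunction ψ) (i : Fin d) :
    (∫ p, DG p.1 i * (fderiv ℝ φ p (vDir i) * ψ p) ∂invMeasure G)
      - ∫ p, vCoord i p * (fderiv ℝ φ p (xDir i) * ψ p) ∂invMeasure G
    = -((∫ p, DG p.1 i * (fderiv ℝ ψ p (vDir i) * φ p) ∂invMeasure G)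
      - ∫ p, vCoord i p * (fderiv ℝ ψ p (xDir i) * φ p) ∂invMeasure G) := by
  have := isFiniteMeasure_invMeasure hG
  have hb := hG.isLocBounded_gradient i
  have hΦ := hφ.mul hψ
  have hD : ∀ p e, fderiv ℝ (fun p => φ p * ψ p) p e
      = fderiv ℝ φ p e * ψ p + fderiv ℝ ψ p e * φ p := by
    intro p e
    rw [fderiv_mul_apply hφ.differentiable hψ.differentiable]
    ring
  -- For `Φ = φ ψ`, the velocity and the position integration by parts have the same right-hand side
  -- `∫ ∂ᵢG vᵢ Φ dμ`; this expresses the invariance of `μ` under the Hamiltonian flow.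
  have h1 := integral_invMeasure_fderiv_vDir hG hb hΦ i
  have h2 := integral_invMeasure_fderiv_xDir hG hΦ i
  simp only [hD, mul_add] at h1 h2
  rw [integral_add (integrable_locBounded_mul hG hb ((hφ.fderiv_apply _).mul hψ))
    (integrable_locBounded_mul hG hb ((hψ.fderiv_apply _).mul hφ))] at h1
  rw [integral_add (((hφ.fderiv_apply _).mul hψ).mul_left (vCoord i).contDiff).integrable
    (((hψ.fderiv_apply _).mul hφ).mul_left (vCoord i).contDiff).integrable] at h2
  linarith

/-- The weak form of the operator: Gaussian integration by parts turns `-v·∇ᵥ + Δᵥ` into minus the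
Dirichlet form in velocity, while the transport is left untouched for `integral_transport_antisymm`.
-/
theorem integral_kinOp_mul (hG : IsConfinementPotential G DG) (s : ℝ) {φ ψ : Phase d → ℝ}
    (hφ : IsTestFunction φ) (hψ : IsTestFunction ψ) :
    ∫ p, kinOp (fun i x => DG x i) s φ p * ψ p ∂invMeasure G
      = ∑ i, (s * ((∫ p, DG p.1 i * (fderiv ℝ φ p (vDir i) * ψ p) ∂invMeasure G)
          - ∫ p, vCoord i p * (fderiv ℝ φ p (xDir i) * ψ p) ∂invMeasure G)
        - ∫ p, fderiv ℝ φ p (vDir i) * fderiv ℝ ψ p (vDir i) ∂invMeasure G) := by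
  have := isFiniteMeasure_invMeasure hG
  have i1 : ∀ i, Integrable (fun p => DG p.1 i * (fderiv ℝ φ p (vDir i) * ψ p)) (invMeasure G) :=
    fun i => integrable_locBounded_mul hG (hG.isLocBounded_gradient i)
      ((hφ.fderiv_apply _).mul hψ)
  have i2 : ∀ i, Integrable (fun p => vCoord i p * (fderiv ℝ φ p (xDir i) * ψ p))
      (invMeasure G) := fun i =>
    (((hφ.fderiv_apply _).mul hψ).mul_left (vCoord i).contDiff).integrable
  have i3 : ∀ i, Integrable (fun p => vCoord i p * (fderiv ℝ φ p (vDir i) * ψ p))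
      (invMeasure G) := fun i =>
    (((hφ.fderiv_apply _).mul hψ).mul_left (vCoord i).contDiff).integrable
  have i4 : ∀ i, Integrable
      (fun p => fderiv ℝ (fun q => fderiv ℝ φ q (vDir i)) p (vDir i) * ψ p) (invMeasure G) :=
    fun i => (((hφ.fderiv_apply _).fderiv_apply _).mul hψ).integrable
  have i5 : ∀ i, Integrable (fun p => fderiv ℝ φ p (vDir i) * fderiv ℝ ψ p (vDir i))
      (invMeasure G) := fun i => ((hφ.fderiv_apply _).mul (hψ.fderiv_apply _)).integrable
  have hibp : ∀ i, ∫ p, fderiv ℝ (fun q => fderiv ℝ φ q (vDir i)) p (vDir i) * ψ p ∂invMeasure G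
      = (∫ p, vCoord i p * (fderiv ℝ φ p (vDir i) * ψ p) ∂invMeasure G)
        - ∫ p, fderiv ℝ φ p (vDir i) * fderiv ℝ ψ p (vDir i) ∂invMeasure G := by
    intro i
    have h1 := integral_invMeasure_fderiv_vDir hG (IsLocBounded.const 1)
      ((hφ.fderiv_apply (vDir i)).mul hψ) i
    simp only [one_mul, fderiv_mul_apply (hφ.fderiv_apply (vDir i)).differentiable
      hψ.differentiable] at h1
    rw [← h1, integral_add (i5 i) ((i4 i).congr (Eventually.of_forall fun p => mul_comm _ _))]
    simp only [mul_comm (ψ _)]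
    ring
  have hpt : ∀ p, kinOp (fun i x => DG x i) s φ p * ψ p
      = ∑ i, (s * (DG p.1 i * (fderiv ℝ φ p (vDir i) * ψ p)
          - vCoord i p * (fderiv ℝ φ p (xDir i) * ψ p))
        - vCoord i p * (fderiv ℝ φ p (vDir i) * ψ p)
        + fderiv ℝ (fun q => fderiv ℝ φ q (vDir i)) p (vDir i) * ψ p) := by
    intro p
    rw [kinOp, Finset.sum_mul]
    refine Finset.sum_congr rfl fun i _ => ?_
    ring
  have i12 : ∀ i, Integrable (fun p => s * (DG p.1 i * (fderiv ℝ φ p (vDir i) * ψ p)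
      - vCoord i p * (fderiv ℝ φ p (xDir i) * ψ p))) (invMeasure G) := fun i =>
    ((i1 i).sub (i2 i)).const_mul s
  have i123 : ∀ i, Integrable (fun p => s * (DG p.1 i * (fderiv ℝ φ p (vDir i) * ψ p)
      - vCoord i p * (fderiv ℝ φ p (xDir i) * ψ p))
      - vCoord i p * (fderiv ℝ φ p (vDir i) * ψ p)) (invMeasure G) := fun i => (i12 i).sub (i3 i)
  have i1234 : ∀ i, Integrable (fun p => s * (DG p.1 i * (fderiv ℝ φ p (vDir i) * ψ p)
      - vCoord i p * (fderiv ℝ φ p (xDir i) * ψ p))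
      - vCoord i p * (fderiv ℝ φ p (vDir i) * ψ p)
      + fderiv ℝ (fun q => fderiv ℝ φ q (vDir i)) p (vDir i) * ψ p) (invMeasure G) := fun i =>
    (i123 i).add (i4 i)
  simp only [hpt]
  rw [integral_finsetSum _ fun i _ => i1234 i]
  refine Finset.sum_congr rfl fun i _ => ?_
  rw [integral_add (i123 i) (i4 i), integral_sub (i12 i) (i3 i), integral_const_mul,
    integral_sub (i1 i) (i2 i), hibp]
  ring

/-- The transport drops out by antisymmetry, so the dissipation is the same for every `s`, in
particular for the operator and its formal adjoint. -/
theorem integral_kinOp_mul_self (hG : IsConfinementPotential G DG) (s : ℝ) {φ : Phase d → ℝ}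
    (hφ : IsTestFunction φ) :
    ∫ p, kinOp (fun i x => DG x i) s φ p * φ p ∂invMeasure G
      = -∑ i, ∫ p, fderiv ℝ φ p (vDir i) ^ 2 ∂invMeasure G := by
  rw [integral_kinOp_mul hG s hφ hφ, ← Finset.sum_neg_distrib]
  refine Finset.sum_congr rfl fun i _ => ?_
  have h0 := integral_transport_antisymm hG hφ hφ i
  have h1 : (∫ p, DG p.1 i * (fderiv ℝ φ p (vDir i) * φ p) ∂invMeasure G)
      - ∫ p, vCoord i p * (fderiv ℝ φ p (xDir i) * φ p) ∂invMeasure G = 0 := by linarith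
  rw [h1, mul_zero, zero_sub]
  simp only [sq]

/-- The Dirichlet form is symmetric and the transport antisymmetric, so passing to the formal
adjoint flips the sign of `s`. -/
theorem integral_kinOp_mul_eq (hG : IsConfinementPotential G DG) {φ ψ : Phase d → ℝ}
    (hφ : IsTestFunction φ) (hψ : IsTestFunction ψ) :
    ∫ p, kinOp (fun i x => DG x i) 1 φ p * ψ p ∂invMeasure G
      = ∫ p, φ p * kinOp (fun i x => DG x i) (-1) ψ p ∂invMeasure G := by
  simp only [mul_comm (φ _)]
  rw [integral_kinOp_mul hG 1 hφ hψ, integral_kinOp_mul hG (-1) hψ hφ]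
  refine Finset.sum_congr rfl fun i _ => ?_
  rw [integral_transport_antisymm hG hφ hψ i]
  simp only [mul_comm (fderiv ℝ ψ _ (vDir i)) (fderiv ℝ φ _ (vDir i))]
  ring

/-- Integration by parts for the control operator. -/
theorem integral_controlFun_mul (hG : IsConfinementPotential G DG) {Dα : Rd d → Rd d}
    (hα : ∀ i, IsLocBounded fun x => Dα x i) {φ ψ : Phase d → ℝ}
    (hφ : IsTestFunction φ) (hψ : IsTestFunction ψ) :
    ∫ p, controlFun Dα φ p * ψ p ∂invMeasure G
      = ∫ p, φ p * -(∑ i, Dα p.1 i * fderiv ℝ ψ p (vDir i)) ∂invMeasure G := by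
  have i1 : ∀ i, Integrable (fun p => Dα p.1 i * fderiv ℝ (fun p => φ p * ψ p) p (vDir i))
      (invMeasure G) := fun i =>
    integrable_locBounded_mul hG (hα i) ((hφ.mul hψ).fderiv_apply _)
  have i2 : ∀ i, Integrable (fun p => Dα p.1 i * (vCoord i p * (φ p * ψ p))) (invMeasure G) :=
    fun i => integrable_locBounded_mul hG (hα i) ((hφ.mul hψ).mul_left (vCoord i).contDiff)
  have i3 : ∀ i, Integrable (fun p => Dα p.1 i * (φ p * fderiv ℝ ψ p (vDir i))) (invMeasure G) :=
    fun i => integrable_locBounded_mul hG (hα i) (hφ.mul (hψ.fderiv_apply _))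
  -- By the product rule the control term is a full derivative of `φ ψ`, minus its Gaussian
  -- counterpart with `vᵢ`, minus `φ ∂ᵥᵢψ`; the first two integrals cancel.
  have e1 : ∀ p, controlFun Dα φ p * ψ p
      = ∑ i, (Dα p.1 i * fderiv ℝ (fun p => φ p * ψ p) p (vDir i)
        - Dα p.1 i * (vCoord i p * (φ p * ψ p)) - Dα p.1 i * (φ p * fderiv ℝ ψ p (vDir i))) := by
    intro p
    rw [controlFun_eq_sum, Finset.sum_mul]
    refine Finset.sum_congr rfl fun i _ => ?_
    rw [fderiv_mul_apply hφ.differentiable hψ.differentiable]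
    ring
  have e2 : ∀ p, φ p * -(∑ i, Dα p.1 i * fderiv ℝ ψ p (vDir i))
      = ∑ i, -(Dα p.1 i * (φ p * fderiv ℝ ψ p (vDir i))) := by
    intro p
    rw [Finset.sum_neg_distrib, mul_neg, Finset.mul_sum]
    congr 1
    refine Finset.sum_congr rfl fun i _ => ?_
    ring
  simp only [e1, e2]
  have i12 : ∀ i, Integrable (fun p => Dα p.1 i * fderiv ℝ (fun p => φ p * ψ p) p (vDir i)
      - Dα p.1 i * (vCoord i p * (φ p * ψ p))) (invMeasure G) := fun i => (i1 i).sub (i2 i)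
  have i123 : ∀ i, Integrable (fun p => Dα p.1 i * fderiv ℝ (fun p => φ p * ψ p) p (vDir i)
      - Dα p.1 i * (vCoord i p * (φ p * ψ p)) - Dα p.1 i * (φ p * fderiv ℝ ψ p (vDir i)))
      (invMeasure G) := fun i => (i12 i).sub (i3 i)
  have i3' : ∀ i, Integrable (fun p => -(Dα p.1 i * (φ p * fderiv ℝ ψ p (vDir i))))
      (invMeasure G) := fun i => (i3 i).neg
  rw [integral_finsetSum _ fun i _ => i123 i, integral_finsetSum _ fun i _ => i3' i]
  refine Finset.sum_congr rfl fun i _ => ?_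
  rw [integral_sub (i12 i) (i3 i), integral_sub (i1 i) (i2 i),
    integral_invMeasure_fderiv_vDir hG (hα i) (hφ.mul hψ) i, sub_self, zero_sub, integral_neg]

theorem integrable_mul_of_locBounded {F Ψ : Phase d → ℝ} {R C : ℝ} (hF : AEStronglyMeasurable F)
    (hC : ∀ᵐ p, ‖p‖ ≤ R → ‖F p‖ ≤ C) (hΨ : Integrable Ψ) (hR : ∀ p, Ψ p ≠ 0 → ‖p‖ ≤ R) :
    Integrable fun p => F p * Ψ p := by
  refine (hΨ.norm.const_mul C).mono' (hF.mul hΨ.1) ?_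
  filter_upwards [hC] with p hp
  rw [norm_mul]
  rcases eq_or_ne (Ψ p) 0 with h0 | h0
  · simp [h0]
  · exact mul_le_mul_of_nonneg_right (hp (hR p h0)) (norm_nonneg _)

/-- The ranges of `l - L*` and `l - L` on test functions are dense in `L²_μ` for `l > d / 2`. -/
theorem ae_eq_zero_of_integral_kinOp_eq_zero (hG : IsConfinementPotential G DG) (s : ℝ) {l : ℝ}
    (hl : (d : ℝ) / 2 < l) {f : Phase d → ℝ} (hfm : AEStronglyMeasurable f)
    (hf : MemLp f 2 (invMeasure G))
    (hweak : ∀ φ, IsTestFunction φ →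
      ∫ p, f p * (l * φ p - kinOp (fun i x => DG x i) s φ p) ∂invMeasure G = 0) :
    ∀ᵐ p, f p = 0 := by
  obtain ⟨g, hg, hbound, hlim⟩ := hG.exists_smooth_approx
  set h : Phase d → ℝ := fun p => Real.exp (-hamiltonian G p / 2) * f p with hh
  have hh2 : MemLp h 2 := memLp_exp_mul hG hfm hf
  have hγ : ∀ i, IsLocBounded fun x => DG x i := hG.isLocBounded_gradient
  have hβ : ∀ i, IsLocBounded fun x => s * DG x i := fun i => (IsLocBounded.const s).mul (hγ i)
  have hgh : ∀ n, ContDiff ℝ ∞ fun x => 1 / 2 * g n x := fun n => contDiff_const.mul (hg n)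
  have hV : ContDiff ℝ ∞ fun p : Phase d => l - d / 2 + ‖p.2‖ ^ 2 / 4 :=
    contDiff_const.add ((contDiff_snd.norm_sq ℝ).div_const 4)
  suffices hzero : ∀ᵐ p, h p = 0 by
    filter_upwards [hzero] with p hp
    exact (mul_eq_zero.1 hp).resolve_left (Real.exp_ne_zero _)
  refine flat_uniqueness hh2 (fun i => (hβ i).1) ?_ (sub_pos.2 hl) (s := s) ?_
  · intro R
    choose C hC0 hC using fun i => (hβ i).2 R
    refine ⟨∑ i, C i, Finset.sum_nonneg fun i _ => hC0 i, fun i => ?_⟩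
    filter_upwards [hC i] with x hx hxR
    exact (hx hxR).trans (Finset.single_le_sum (fun i _ => hC0 i) (Finset.mem_univ i))
  intro ψ hψ
  obtain ⟨R, hR⟩ := hψ.2.isCompact.isBounded.exists_norm_le
  set flat := flatOp (fun p => l - d / 2 + ‖p.2‖ ^ 2 / 4) (fun i x => s * DG x i) s ψ with hflat
  -- `e^{H/2} ψ` is not a legitimate test function, as `G` is not smooth. With `G` replaced by `g n`
  -- the factor `E n → 1` and the defects `Q i n → 0` appear, both bounded on the support of `ψ`.
  set E : ℕ → Phase d → ℝ := fun n p => Real.exp (1 / 2 * g n p.1 - 1 / 2 * G p.1) with hE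
  set Q : Fin d → ℕ → Phase d → ℝ := fun i n p => E n p *
    (1 / 2 * DG p.1 i - 1 / 2 * fderiv ℝ (g n) p.1 (EuclideanSpace.single i 1)) with hQ
  have hΨ₀ : Integrable fun p => h p * flat p :=
    MemLp.integrable_mul hh2 (memLp_flatOp hV hβ s hψ 2)
  have hΨ₀R : ∀ p, h p * flat p ≠ 0 → ‖p‖ ≤ R := by
    intro p hp
    refine hR p ?_
    by_contra hcon
    exact hp (by rw [hflat, flatOp_eq_zero_of_notMem hcon, mul_zero])
  have hΨ : ∀ i, Integrable fun p => h p * (vCoord i p * ψ p) := fun i =>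
    MemLp.integrable_mul hh2 ((hψ.mul_left (vCoord i).contDiff).memLp 2)
  have hΨR : ∀ i p, h p * (vCoord i p * ψ p) ≠ 0 → ‖p‖ ≤ R := fun i p hp =>
    hR p (subset_tsupport _ (right_ne_zero_of_mul (right_ne_zero_of_mul hp)))
  have hEm : ∀ n, AEStronglyMeasurable (E n) := fun n =>
    Real.continuous_exp.comp_aestronglyMeasurable
      ((((hgh n).continuous.comp continuous_fst).aestronglyMeasurable).sub
        ((aestronglyMeasurable_comp_fst hG.isLocBounded.1).const_mul _))
  have hQm : ∀ i n, AEStronglyMeasurable (Q i n) := fun i n =>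
    (hEm n).mul (((aestronglyMeasurable_comp_fst (hγ i).1).const_mul _).sub
      (((IsTestFunction.contDiff_fderiv_apply (hg n) _).continuous.comp
        continuous_fst).aestronglyMeasurable.const_mul _))
  obtain ⟨C₁, hC₁0, hC₁⟩ := hbound R
  obtain ⟨C₂, hC₂0, hC₂⟩ := hG.isLocBounded.2 R
  have hEb : ∀ n, ∀ᵐ p : Phase d, ‖p‖ ≤ R → ‖E n p‖ ≤ Real.exp (C₁ + C₂) := by
    intro n
    filter_upwards [ae_comp_fst hC₂] with p hp hpR
    have hp1 := (norm_fst_le p).trans hpR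
    rw [hE, Real.norm_of_nonneg (Real.exp_pos _).le, Real.exp_le_exp]
    have h1 := (le_abs_self _).trans (hC₁ n p.1 hp1).1
    have h2 := (neg_le_abs _).trans (hp hp1)
    linarith
  have hQb : ∀ i, ∃ C, ∀ n, ∀ᵐ p : Phase d, ‖p‖ ≤ R → ‖Q i n p‖ ≤ C := by
    intro i
    obtain ⟨C₃, hC₃0, hC₃⟩ := (hγ i).2 R
    refine ⟨Real.exp (C₁ + C₂) * (C₃ / 2 + C₁ / 2), fun n => ?_⟩
    filter_upwards [hEb n, ae_comp_fst hC₃] with p hp1 hp2 hpR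
    have hp' := (norm_fst_le p).trans hpR
    rw [hQ, norm_mul]
    refine mul_le_mul (hp1 hpR) ((norm_sub_le _ _).trans (add_le_add ?_ ?_)) (norm_nonneg _)
      (Real.exp_pos _).le
    · rw [norm_mul, Real.norm_of_nonneg (by norm_num)]
      linarith [hp2 hp']
    · rw [norm_mul, Real.norm_of_nonneg (by norm_num)]
      linarith [(hC₁ n p.1 hp').2 i]
  have hElim : ∀ᵐ p : Phase d, Tendsto (fun n => E n p) atTop (𝓝 1) := by
    filter_upwards [ae_comp_fst hlim] with p hp
    have h1 := (hp.1.const_mul (1 / 2)).sub_const (1 / 2 * G p.1)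
    rw [sub_self] at h1
    have h2 := (Real.continuous_exp.tendsto 0).comp h1
    rw [Real.exp_zero] at h2
    exact h2
  have hQlim : ∀ i, ∀ᵐ p : Phase d, Tendsto (fun n => Q i n p) atTop (𝓝 0) := by
    intro i
    filter_upwards [ae_comp_fst hlim, hElim] with p hp1 hp2
    have h1 := hp2.mul (((hp1.2 i).const_mul (1 / 2)).const_sub (1 / 2 * DG p.1 i))
    have h2 : (1 : ℝ) * (1 / 2 * DG p.1 i - 1 / 2 * DG p.1 i) = 0 := by ring
    rw [h2] at h1
    exact h1
  choose C hC using hQb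
  -- The weak equation tested with `e^{|v|²/4 + gₙ/2} ψ`, rewritten in terms of `h`.
  have hzero : ∀ n, (∫ p, E n p * (h p * flat p))
      - s * ∑ i, ∫ p, Q i n p * (h p * (vCoord i p * ψ p)) = 0 := by
    intro n
    set W := expWeight (1 / 4) fun x => 1 / 2 * g n x with hW
    have hφ : IsTestFunction fun p => W p * ψ p := hψ.mul_left (contDiff_expWeight _ (hgh n))
    have h1 := hweak _ hφ
    rw [integral_invMeasure hG, mul_eq_zero] at h1
    have h2 := h1.resolve_left (inv_ne_zero (integral_exp_neg_hamiltonian_pos hG).ne')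
    rw [← integral_finsetSum _ fun i _ =>
      integrable_mul_of_locBounded (hQm i n) (hC i n) (hΨ i) (hΨR i), ← integral_const_mul,
      ← integral_sub (integrable_mul_of_locBounded (hEm n) (hEb n) hΨ₀ hΨ₀R)
        ((integrable_finsetSum _ fun i _ =>
          integrable_mul_of_locBounded (hQm i n) (hC i n) (hΨ i) (hΨR i)).const_mul s), ← h2]
    congr 1
    ext p
    have hexp : Real.exp (-hamiltonian G p) * W p = E n p * Real.exp (-hamiltonian G p / 2) := by
      rw [hW, hE, expWeight, ← Real.exp_add, ← Real.exp_add, hamiltonian]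
      congr 1
      ring
    have hder : ∀ i, fderiv ℝ (fun x => 1 / 2 * g n x) p.1 (EuclideanSpace.single i 1)
        = 1 / 2 * fderiv ℝ (g n) p.1 (EuclideanSpace.single i 1) := by
      intro i
      rw [fderiv_const_mul ((hg n).differentiable (by simp) p.1)]
      rfl
    have h3 := mul_sub_kinOp_expWeight (hgh n) (fun i x => DG x i) s l hψ p
    rw [← hW] at h3
    rw [h3, ← hflat]
    simp only [hder]
    have h4 : ∀ X : ℝ, Real.exp (-hamiltonian G p) * (f p * (W p * X)) = E n p * (h p * X) := by
      intro X
      rw [hh]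
      linear_combination (f p * X) * hexp
    rw [h4, mul_sub, mul_sub, Finset.mul_sum, Finset.mul_sum, Finset.mul_sum, Finset.mul_sum]
    congr 1
    refine Finset.sum_congr rfl fun i _ => ?_
    rw [hQ]
    ring
  have t1 := tendsto_integral_mul_of_locBounded hEm hEb hElim hΨ₀ hΨ₀R
  have t2 := fun i => tendsto_integral_mul_of_locBounded (hQm i) (hC i) (hQlim i) (hΨ i) (hΨR i)
  have t3 := t1.sub ((tendsto_finsetSum Finset.univ fun i _ => t2 i).const_mul s)
  simp only [hzero, one_mul, zero_mul, integral_zero, Finset.sum_const_zero, mul_zero,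
    sub_zero] at t3
  exact (tendsto_nhds_unique t3 tendsto_const_nhds)

end Identities

/-! ### Operators on test functions as linear maps into `L²_μ` -/

section StateSpace

variable {d : ℕ}

/-- The space `C₀^∞(ℝ^{2d})` of test functions. -/
def testSpace (d : ℕ) : Submodule ℝ (Phase d → ℝ) where
  carrier := {φ | IsTestFunction φ}
  zero_mem' := ⟨contDiff_const, HasCompactSupport.zero⟩
  add_mem' hφ hψ := ⟨hφ.1.add hψ.1, hφ.2.add hψ.2⟩
  smul_mem' c _ hφ := ⟨hφ.1.const_smul c, hφ.2.smul_left (f := fun _ => c)⟩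

/-- A linear operation on test functions with values in `L²`, as a map into `L²`. -/
theorem exists_linearMap_toLp {μ : Measure (Phase d)} {T : (Phase d → ℝ) → Phase d → ℝ}
    (hT : ∀ φ, IsTestFunction φ → MemLp (T φ) 2 μ)
    (hadd : ∀ φ ψ, IsTestFunction φ → IsTestFunction ψ → T (φ + ψ) = T φ + T ψ)
    (hsmul : ∀ (c : ℝ) φ, IsTestFunction φ → T (c • φ) = c • T φ) :
    ∃ j : testSpace d →ₗ[ℝ] Lp ℝ 2 μ, ∀ φ, j φ =ᵐ[μ] T φ.1 :=
  ⟨{ toFun := fun φ => (hT φ.1 φ.2).toLp (T φ.1)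
     map_add' := fun φ ψ => by
      rw [← MemLp.toLp_add]
      exact MemLp.toLp_congr _ _ (Eventually.of_forall (congrFun (hadd _ _ φ.2 ψ.2)))
     map_smul' := fun c φ => by
      rw [RingHom.id_apply, ← MemLp.toLp_const_smul]
      exact MemLp.toLp_congr _ _ (Eventually.of_forall (congrFun (hsmul c _ φ.2))) },
    fun φ => (hT φ.1 φ.2).coeFn_toLp⟩

theorem inner_eq_integral_of_ae_eq {μ : Measure (Phase d)} {f g : Lp ℝ 2 μ} {f' g' : Phase d → ℝ}
    (hf : f =ᵐ[μ] f') (hg : g =ᵐ[μ] g') : inner ℝ f g = ∫ p, f' p * g' p ∂μ := by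
  rw [L2.inner_def]
  refine integral_congr_ae ?_
  filter_upwards [hf, hg] with p h1 h2
  rw [h1, h2]
  simp [mul_comm]

theorem IsTestFunction.fderiv_add_apply {φ ψ : Phase d → ℝ} (hφ : IsTestFunction φ)
    (hψ : IsTestFunction ψ) (p e : Phase d) :
    fderiv ℝ (φ + ψ) p e = fderiv ℝ φ p e + fderiv ℝ ψ p e := by
  rw [fderiv_add (hφ.differentiable p) (hψ.differentiable p)]
  rfl

theorem IsTestFunction.fderiv_smul_apply {φ : Phase d → ℝ} (hφ : IsTestFunction φ) (c : ℝ)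
    (p e : Phase d) : fderiv ℝ (c • φ) p e = c * fderiv ℝ φ p e := by
  rw [fderiv_const_smul (hφ.differentiable p)]
  rfl

theorem kinOp_add (γ : Fin d → Rd d → ℝ) (s : ℝ) (φ ψ : Phase d → ℝ) (hφ : IsTestFunction φ)
    (hψ : IsTestFunction ψ) : kinOp γ s (φ + ψ) = kinOp γ s φ + kinOp γ s ψ := by
  funext p
  have h2 : ∀ e : Phase d, fderiv ℝ (fun q => fderiv ℝ (φ + ψ) q e) p e
      = fderiv ℝ (fun q => fderiv ℝ φ q e) p e + fderiv ℝ (fun q => fderiv ℝ ψ q e) p e := by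
    intro e
    simp only [hφ.fderiv_add_apply hψ]
    exact (hφ.fderiv_apply e).fderiv_add_apply (hψ.fderiv_apply e) p e
  rw [Pi.add_apply, kinOp, kinOp, kinOp, ← Finset.sum_add_distrib]
  refine Finset.sum_congr rfl fun i _ => ?_
  rw [h2, hφ.fderiv_add_apply hψ, hφ.fderiv_add_apply hψ]
  ring

theorem kinOp_smul (γ : Fin d → Rd d → ℝ) (s c : ℝ) (φ : Phase d → ℝ) (hφ : IsTestFunction φ) :
    kinOp γ s (c • φ) = c • kinOp γ s φ := by
  funext p
  have h2 : ∀ e : Phase d, fderiv ℝ (fun q => fderiv ℝ (c • φ) q e) p e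
      = c * fderiv ℝ (fun q => fderiv ℝ φ q e) p e := by
    intro e
    simp only [hφ.fderiv_smul_apply]
    exact (hφ.fderiv_apply e).fderiv_smul_apply c p e
  rw [Pi.smul_apply, kinOp, kinOp, smul_eq_mul, Finset.mul_sum]
  refine Finset.sum_congr rfl fun i _ => ?_
  rw [h2, hφ.fderiv_smul_apply, hφ.fderiv_smul_apply]
  ring

/-- The formal adjoint `-∇α·∇ᵥ` of the control operator. -/
def adjControlFun (Dα : Rd d → Rd d) (φ : Phase d → ℝ) (p : Phase d) : ℝ :=
  -∑ i, Dα p.1 i * fderiv ℝ φ p (vDir i)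

theorem adjControlFun_add (Dα : Rd d → Rd d) (φ ψ : Phase d → ℝ) (hφ : IsTestFunction φ)
    (hψ : IsTestFunction ψ) :
    adjControlFun Dα (φ + ψ) = adjControlFun Dα φ + adjControlFun Dα ψ := by
  funext p
  simp only [adjControlFun, Pi.add_apply, hφ.fderiv_add_apply hψ, mul_add, Finset.sum_add_distrib]
  ring

theorem adjControlFun_smul (Dα : Rd d → Rd d) (c : ℝ) (φ : Phase d → ℝ) (hφ : IsTestFunction φ) :
    adjControlFun Dα (c • φ) = c • adjControlFun Dα φ := by
  funext p
  simp only [adjControlFun, Pi.smul_apply, hφ.fderiv_smul_apply, smul_eq_mul, mul_left_comm _ c,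
    ← Finset.mul_sum]
  ring

theorem controlFun_add (Dα : Rd d → Rd d) (φ ψ : Phase d → ℝ) (hφ : IsTestFunction φ)
    (hψ : IsTestFunction ψ) : controlFun Dα (φ + ψ) = controlFun Dα φ + controlFun Dα ψ := by
  funext p
  simp only [controlFun, Pi.add_apply, hφ.fderiv_add_apply hψ]
  ring

theorem controlFun_smul (Dα : Rd d → Rd d) (c : ℝ) (φ : Phase d → ℝ) (hφ : IsTestFunction φ) :
    controlFun Dα (c • φ) = c • controlFun Dα φ := by
  funext p
  simp only [controlFun, Pi.smul_apply, hφ.fderiv_smul_apply, smul_eq_mul]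
  ring

theorem memLp_controlFun {Dα : Rd d → Rd d} (hα : ∀ i, IsLocBounded fun x => Dα x i)
    {φ : Phase d → ℝ} (hφ : IsTestFunction φ) {ν : Measure (Phase d)}
    [IsFiniteMeasureOnCompacts ν] (hν : ν ≪ volume) (q : ℝ≥0∞) : MemLp (controlFun Dα φ) q ν := by
  have h : controlFun Dα φ = fun p =>
      ∑ i, (Dα p.1 i * fderiv ℝ φ p (vDir i) - Dα p.1 i * (vCoord i p * φ p)) :=
    funext (controlFun_eq_sum Dα φ)
  rw [h]
  exact memLp_finsetSum _ fun i _ =>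
    ((hα i).memLp_mul_isTestFunction (hφ.fderiv_apply _) hν q).sub
      ((hα i).memLp_mul_isTestFunction (hφ.mul_left (vCoord i).contDiff) hν q)

theorem memLp_adjControlFun {Dα : Rd d → Rd d} (hα : ∀ i, IsLocBounded fun x => Dα x i)
    {φ : Phase d → ℝ} (hφ : IsTestFunction φ) {ν : Measure (Phase d)}
    [IsFiniteMeasureOnCompacts ν] (hν : ν ≪ volume) (q : ℝ≥0∞) :
    MemLp (adjControlFun Dα φ) q ν :=
  (memLp_finsetSum _ fun i _ =>
    (hα i).memLp_mul_isTestFunction (hφ.fderiv_apply (vDir i)) hν q).neg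

/-- An element orthogonal to all test functions vanishes almost everywhere, by the fundamental lemma
of the calculus of variations applied to the measure `μ` itself. -/
theorem denseRange_of_testSpace {μ : Measure (Phase d)} [IsFiniteMeasure μ]
    {j : testSpace d →ₗ[ℝ] Lp ℝ 2 μ} (hj : ∀ φ, j φ =ᵐ[μ] φ.1) : DenseRange j := by
  have htop : (LinearMap.range j).topologicalClosure = ⊤ := by
    rw [Submodule.topologicalClosure_eq_top_iff, Submodule.eq_bot_iff]
    intro f hf
    rw [Lp.eq_zero_iff_ae_eq_zero]
    refine ae_eq_zero_of_integral_contDiff_smul_eq_zero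
      ((Lp.memLp f).integrable (by norm_num)).locallyIntegrable fun φ h1 h2 => ?_
    rw [← (Submodule.mem_orthogonal _ f).1 hf (j ⟨φ, h1, h2⟩) ⟨_, rfl⟩,
      inner_eq_integral_of_ae_eq (hj ⟨φ, h1, h2⟩) EventuallyEq.rfl]
    rfl
  intro f
  have : f ∈ (LinearMap.range j).topologicalClosure := htop ▸ Submodule.mem_top
  exact this

end StateSpace

/-! ### Verification of the abstract hypotheses -/

section WellPosedness

variable {d : ℕ} {G α : Rd d → ℝ} {DG Dα : Rd d → Rd d}

/-- The operator `Φ ↦ -∇α·∇ᵥΦ` is bounded by the dissipation of the Fokker–Planck operator. -/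
theorem integral_adjControlFun_sq_le (hG : IsConfinementPotential G DG) {C : ℝ}
    (hα : ∀ i, IsLocBounded fun x => Dα x i) (hC : ∀ᵐ x, ‖Dα x‖ ≤ C) {φ : Phase d → ℝ}
    (hφ : IsTestFunction φ) (s : ℝ) :
    ∫ p, adjControlFun Dα φ p * adjControlFun Dα φ p ∂invMeasure G
      ≤ C ^ 2 * -∫ p, φ p * kinOp (fun i x => DG x i) s φ p ∂invMeasure G := by
  have := isFiniteMeasure_invMeasure hG
  have hac := invMeasure_absolutelyContinuous G
  have hi : ∀ i, Integrable (fun p => fderiv ℝ φ p (vDir i) ^ 2) (invMeasure G) := fun i =>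
    ((hφ.fderiv_apply (vDir i)).memLp 2).integrable_sq
  simp only [mul_comm (φ _)]
  rw [integral_kinOp_mul_self hG s hφ, neg_neg, ← integral_finsetSum _ fun i _ => hi i,
    ← integral_const_mul]
  have hm := memLp_adjControlFun hα hφ hac 2
  refine integral_mono_ae (MemLp.integrable_mul hm hm)
    ((integrable_finsetSum _ fun i _ => hi i).const_mul _) ?_
  filter_upwards [hac.ae_le (ae_comp_fst hC)] with p hp
  -- Pointwise Cauchy–Schwarz in `ℝᵈ`, after which the essential bound of `|∇α|` is pulled out.
  have h1 := Finset.sum_mul_sq_le_sq_mul_sq Finset.univ (fun i => Dα p.1 i)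
    fun i => fderiv ℝ φ p (vDir i)
  have h2 : ∑ i, Dα p.1 i ^ 2 ≤ C ^ 2 := by
    rw [← EuclideanSpace.real_norm_sq_eq]
    gcongr
  calc adjControlFun Dα φ p * adjControlFun Dα φ p
      = (∑ i, Dα p.1 i * fderiv ℝ φ p (vDir i)) ^ 2 := by
        rw [adjControlFun]
        ring
    _ ≤ (∑ i, Dα p.1 i ^ 2) * ∑ i, fderiv ℝ φ p (vDir i) ^ 2 := h1
    _ ≤ C ^ 2 * ∑ i, fderiv ℝ φ p (vDir i) ^ 2 := by gcongr

/-- The graph of `L*` is described through almost everywhere representatives; as a subspace it is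
the range of a linear map on test functions, the form in which the abstract results are stated. -/
theorem opA_eq_closedGraph {j a : testSpace d →ₗ[ℝ] StateSpace G}
    (hj : ∀ φ, j φ =ᵐ[invMeasure G] φ.1)
    (ha : ∀ φ, a φ =ᵐ[invMeasure G] kinOp (fun i x => DG x i) 1 φ.1) :
    opA G DG = closedGraph j a := by
  have h : ∀ f, f ∈ lStarGraph G DG ↔ f ∈ LinearMap.range (j.prod a) := by
    intro f
    rw [LinearMap.mem_range]
    constructor
    · intro hf
      obtain ⟨φ, hφ, h1, h2⟩ := hf
      rw [lStarFun_eq_kinOp DG hφ.1] at h2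
      have e1 : j ⟨φ, hφ⟩ = f.1 := Lp.ext ((hj _).trans h1.symm)
      have e2 : a ⟨φ, hφ⟩ = f.2 := Lp.ext ((ha _).trans h2.symm)
      exact ⟨⟨φ, hφ⟩, Prod.ext e1 e2⟩
    · intro hf
      obtain ⟨φ, hφ⟩ := hf
      have e1 : f.1 = j φ := (congrArg Prod.fst hφ).symm
      have e2 : f.2 = a φ := (congrArg Prod.snd hφ).symm
      refine ⟨φ.1, φ.2, ?_, ?_⟩
      · rw [e1]
        exact hj φ
      · rw [e2, lStarFun_eq_kinOp DG φ.2.1]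
        exact ha φ
  exact congrArg Submodule.topologicalClosure (Submodule.ext h)

theorem isControlOperator_iff {j n : testSpace d →ₗ[ℝ] StateSpace G}
    (hj : ∀ φ, j φ =ᵐ[invMeasure G] φ.1) (hn : ∀ φ, n φ =ᵐ[invMeasure G] controlFun Dα φ.1)
    (N : StateSpace G →L[ℝ] Extrap (opA G DG)) :
    IsControlOperator G DG Dα N ↔ ∀ φ, N (j φ) = toExtrap (opA G DG) (n φ) := by
  refine ⟨fun h φ => h φ.1 φ.2 _ _ (hj φ) (hn φ), fun h φ hφ f g hf hg => ?_⟩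
  have hj' := hj ⟨φ, hφ⟩
  have hn' := hn ⟨φ, hφ⟩
  have e1 := Lp.ext (hf.trans hj'.symm)
  have e2 := Lp.ext (hg.trans hn'.symm)
  exact (congrArg N e1).trans ((h _).trans (congrArg (toExtrap (opA G DG)) e2.symm))

theorem inner_kinOp_nonpos (hG : IsConfinementPotential G DG) (s : ℝ)
    {j a : testSpace d →ₗ[ℝ] StateSpace G} (hj : ∀ φ, j φ =ᵐ[invMeasure G] φ.1)
    (ha : ∀ φ, a φ =ᵐ[invMeasure G] kinOp (fun i x => DG x i) s φ.1) (φ : testSpace d) :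
    inner ℝ (j φ) (a φ) ≤ 0 := by
  rw [inner_eq_integral_of_ae_eq (hj φ) (ha φ)]
  simp only [mul_comm (φ.1 _)]
  rw [integral_kinOp_mul_self hG s φ.2, neg_nonpos]
  exact Finset.sum_nonneg fun i _ => integral_nonneg fun p => sq_nonneg _

theorem eq_zero_of_inner_kinOp_eq_zero (hG : IsConfinementPotential G DG) (s : ℝ)
    {j a : testSpace d →ₗ[ℝ] StateSpace G} (hj : ∀ φ, j φ =ᵐ[invMeasure G] φ.1)
    (ha : ∀ φ, a φ =ᵐ[invMeasure G] kinOp (fun i x => DG x i) s φ.1) {l : ℝ}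
    (hl : (d : ℝ) / 2 < l) (f : StateSpace G)
    (hf : ∀ φ, inner ℝ f (l • j φ - a φ) = 0) : f = 0 := by
  rw [Lp.eq_zero_iff_ae_eq_zero]
  refine (invMeasure_absolutelyContinuous G).ae_le (ae_eq_zero_of_integral_kinOp_eq_zero hG s hl
    (Lp.stronglyMeasurable f).aestronglyMeasurable (Lp.memLp f) fun φ hφ => ?_)
  rw [← hf ⟨φ, hφ⟩, inner_eq_integral_of_ae_eq EventuallyEq.rfl
    ((Lp.coeFn_sub _ _).trans (((Lp.coeFn_smul _ _).trans ((hj ⟨φ, hφ⟩).const_smul l)).sub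
      (ha ⟨φ, hφ⟩)))]
  rfl

end WellPosedness

end KineticFP

end

open KineticFP in
theorem theorem3p5 {d : ℕ} (G α : Rd d → ℝ) (DG Dα : Rd d → Rd d)
    (hG : IsConfinementPotential G DG) (hα : IsControlPotential α Dα) :
    (∃! S : C0Semigroup (StateSpace G), IsGenerator (opA G DG) S) ∧
    (∃! N : StateSpace G →L[ℝ] Extrap (opA G DG), IsControlOperator G DG Dα N) ∧
    ∀ (S : C0Semigroup (StateSpace G)) (hS : IsGenerator (opA G DG) S)
      (N : StateSpace G →L[ℝ] Extrap (opA G DG)), IsControlOperator G DG Dα N →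
      ∀ (T : ℝ) (hT : 0 < T) (y₀ : StateSpace G) (u : ℝ → ℝ),
        MeasureTheory.MemLp u 2 (MeasureTheory.volume.restrict (Set.Ioo 0 T)) →
        ∃! y : C(Set.Icc (0 : ℝ) T, StateSpace G), IsMildSolution hS N hT.le y₀ u y := by
  have hfin := isFiniteMeasure_invMeasure hG
  have hac := invMeasure_absolutelyContinuous G
  have hγ := hG.isLocBounded_gradient
  obtain ⟨C, hC0, hC⟩ := exists_ae_bound_of_memLp_top hα.gradient_bounded
  have hDα : ∀ i, IsLocBounded fun x => Dα x i := IsLocBounded.coord hα.gradient_bounded.1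
    fun _ => ⟨C, hC0, hC.mono fun _ h _ => h⟩
  obtain ⟨j, hj⟩ := exists_linearMap_toLp (d := d) (μ := invMeasure G) (T := id)
    (fun _ hφ => hφ.memLp 2) (fun _ _ _ _ => rfl) fun _ _ _ => rfl
  obtain ⟨a, ha⟩ := exists_linearMap_toLp (fun _ hφ => memLp_kinOp hγ 1 hφ hac 2)
    (kinOp_add _ 1) (kinOp_smul _ 1)
  obtain ⟨b, hb⟩ := exists_linearMap_toLp (fun _ hφ => memLp_kinOp hγ (-1) hφ hac 2)
    (kinOp_add _ (-1)) (kinOp_smul _ (-1))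
  obtain ⟨n, hn⟩ := exists_linearMap_toLp (fun _ hφ => memLp_controlFun hDα hφ hac 2)
    (controlFun_add Dα) (controlFun_smul Dα)
  obtain ⟨m, hm⟩ := exists_linearMap_toLp (fun _ hφ => memLp_adjControlFun hDα hφ hac 2)
    (adjControlFun_add Dα) (adjControlFun_smul Dα)
  -- Any `l₀ > d / 2` would do, since the conjugated potential needs `l - d / 2 > 0`. The constant
  -- `C ^ 2` is the square of an essential bound for the gradient of `α`.
  have key := wellPosed_of_core (j := j) (a := a) (b := b) (m := m) (n := n) (C := C ^ 2)
    (l₀ := (d : ℝ) / 2 + 1) (denseRange_of_testSpace hj) (inner_kinOp_nonpos hG 1 hj ha)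
    (inner_kinOp_nonpos hG (-1) hj hb)
    (fun φ ψ => by
      rw [inner_eq_integral_of_ae_eq (ha φ) (hj ψ), inner_eq_integral_of_ae_eq (hj φ) (hb ψ)]
      exact integral_kinOp_mul_eq hG φ.2 ψ.2)
    (by positivity)
    (fun l hl => eq_zero_of_inner_kinOp_eq_zero hG 1 hj ha (by linarith))
    (eq_zero_of_inner_kinOp_eq_zero hG (-1) hj hb (by linarith))
    (fun φ ψ => by
      rw [inner_eq_integral_of_ae_eq (hn φ) (hj ψ), inner_eq_integral_of_ae_eq (hj φ) (hm ψ)]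
      exact integral_controlFun_mul hG hDα φ.2 ψ.2)
    (sq_nonneg C)
    (fun φ => by
      rw [← real_inner_self_eq_norm_sq, inner_eq_integral_of_ae_eq (hm φ) (hm φ),
        inner_eq_integral_of_ae_eq (hj φ) (hb φ)]
      exact integral_adjControlFun_sq_le hG hDα hC φ.2 (-1))
  rw [← opA_eq_closedGraph hj ha] at key
  simp only [isControlOperator_iff hj hn]
  exact key
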